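/- There is an absolute constant $c>0$ such that for every integer $n\ge 10$, every set $P$ of $n$ points in general position in the Euclidean plane (that is, no three points of $P$ lie on the same line) determines at least $c\,n^{4/3}$ $5$-holes. Here a $5$-hole of $P$ is a convex polygon with exactly five vertices, all of them in $P$, whose interior contains no point of $P$. -/

import Mathlib

/-- The Euclidean plane. -/
abbrev Plane : Type := EuclideanSpace ℝ (Fin 2)

/-- A set of points in the plane is in general position if no three distinct points of it lie on
the same line. -/
def InGeneralPosition (P : Set Plane) : Prop :=
  ∀ a ∈ P, ∀ b ∈ P, ∀ c ∈ P, a ≠ b → a ≠ c → b ≠ c → ¬ Collinear ℝ {a, b, c}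

/-- `IsHole k P H`: the points of `H` are the vertices of a `k`-hole of `P`, that is, of a convex
polygon with exactly `k` vertices, all of them in `P`, whose interior contains no point of `P`.
A convex polygon is determined by its set of vertices, so it is represented by this set `H`: the
(solid) polygon is the convex hull of `H`, and `H` is its set of vertices precisely if no point
of `H` lies in the convex hull of the others. -/
structure IsHole (k : ℕ) (P H : Finset Plane) : Prop where
  subset : H ⊆ P
  card_eq : H.card = k
  convexIndependent : ConvexIndependent ℝ (fun x : (H : Set Plane) => (x : Plane))
  empty : ∀ p ∈ P, p ∉ interior (convexHull ℝ (H : Set Plane))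

open Classical in
/-- The finite set of all `k`-holes of a finite set `P` of points in the plane. -/
noncomputable def holes (k : ℕ) (P : Finset Plane) : Finset (Finset Plane) :=
  P.powerset.filter (IsHole k P)

/-! Let `n` be the number of points and `m` the number of 5-holes. About `n²` incidences "the point
`r` sees the pair `a b`" (`Viewer`) are produced, and so many incidences are shown to force `n⁴ =
O(m³)`.

Local existence. Nine points sorted by angle about a tenth one always yield an empty convex pentagon
(`exists_hole5_of_sorted`). The orientations of triples of sorted points obey a local rule (in each
quadruple the signs change at most once), and an exhaustive search finds no assignment of signs to
nine points that obeys it and avoids empty pentagons.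

Lower bound. The points in a half-plane at `r` are sorted about `r` and cut into windows of ten. In
each window either `r` is a vertex of a 5-hole on `r` and points of the window, or `r` sees a pair
of its points (`Window.exists_viewer`). Summing over `r`, about `n²/20` is at most `5m` plus the
number of viewers (`card_viewers_ge`).

Upper bound. At most `125m` viewers share a 5-hole with the pair they see. The other viewers of a
fixed pair are in convex position (`exists_cup`). Each of them, `c`, gets a key `(a, b, e)`, read
off from the convex hull of certain points that share a 5-hole with `a`. There are at most `50m`
keys (`card_keys_le`), the classes of points with a common key have total size at most `n²`
(`sum_card_keyClass_le`), and a triangle spanned by a class contains only points of that class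
(`Key.of_mem_inTri`). If there are at least `n²/γ` such viewers, then by pigeonhole some key has `k`
of them, where `n² = O(mk)`, and a class of only `O(k)` points: this is a convex `k`-gon with `O(k)`
points inside.

Such a polygon forces `k² = O(k + m)` (`Cup.card_holes_ge`). Of the order of `k²` pairs of vertices
have boundedly many points in the relevant triangles. Each pair is charged to an empty triangle at
one of its two vertices, out of `O(k)` triangles. If an empty triangle extends in two ways over the
same side to an empty convex quadrilateral, then the extension lies in a 5-hole; otherwise it is
unique. Following the extensions for a bounded number of rounds bounds the charged pairs by `O(k +
m)` (`card_supported_le`). Hence `k² = O(m)` (small `k` being harmless), and `n⁴ = O(m²k²) = O(m³)`.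
-/

/-! ### Orientations and general position -/

/-- Twice the signed area of the triangle `a b c`: positive iff it is counterclockwise. -/
def orient (a b c : Plane) : ℝ := (b 0 - a 0) * (c 1 - a 1) - (b 1 - a 1) * (c 0 - a 0)

theorem orient_rot (a b c : Plane) : orient a b c = orient b c a := by
  unfold orient; ring

theorem orient_swap (a b c : Plane) : orient a b c = -orient b a c := by
  unfold orient; ring

theorem orient_swap' (a b c : Plane) : orient a b c = -orient a c b := by
  unfold orient; ring

theorem orient_rev (a b c : Plane) : orient a b c = -orient c b a := by
  unfold orient; ring

@[simp] theorem orient_self_left (a b : Plane) : orient a a b = 0 := by unfold orient; ring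

@[simp] theorem orient_self_right (a b : Plane) : orient a b b = 0 := by unfold orient; ring

@[simp] theorem orient_self_mid (a b : Plane) : orient a b a = 0 := by unfold orient; ring

/-- The Grassmann–Plücker relation. -/
theorem orient_gp (p a b c d : Plane) :
    orient p a b * orient p c d - orient p a c * orient p b d + orient p a d * orient p b c = 0 := by
  unfold orient; ring

theorem orient_bary (a b c p x y : Plane) : orient a b c * orient p x y =
    orient p b c * orient a x y + orient a p c * orient b x y + orient a b p * orient c x y := by
  unfold orient; ring

theorem orient_sum (a b c p : Plane) :
    orient a b c = orient p b c + orient a p c + orient a b p := by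
  unfold orient; ring

/-- Quantitative general position: all triples of distinct points have nonzero orientation. -/
def GenPos (S : Finset Plane) : Prop :=
  ∀ a ∈ S, ∀ b ∈ S, ∀ c ∈ S, a ≠ b → a ≠ c → b ≠ c → orient a b c ≠ 0

theorem collinear_of_orient_eq_zero {a b c : Plane} (h : orient a b c = 0) :
    Collinear ℝ {a, b, c} := by
  by_cases hab : b = a
  · subst hab; simpa using collinear_pair ℝ b c
  rw [collinear_iff_of_mem (p₀ := a) (by simp)]
  refine ⟨b - a, ?_⟩
  have hne : b 0 - a 0 ≠ 0 ∨ b 1 - a 1 ≠ 0 := by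
    by_contra hcon
    push Not at hcon
    apply hab
    ext i
    fin_cases i
    · simpa using sub_eq_zero.1 hcon.1
    · simpa using sub_eq_zero.1 hcon.2
  simp only [Set.mem_insert_iff, Set.mem_singleton_iff, forall_eq_or_imp, forall_eq]
  refine ⟨⟨0, by simp⟩, ⟨1, by simp⟩, ?_⟩
  unfold orient at h
  rcases hne with h0 | h0
  · refine ⟨(c 0 - a 0) / (b 0 - a 0), ?_⟩
    ext i
    fin_cases i
    · simp; field_simp; ring
    · simp; field_simp; linarith
  · refine ⟨(c 1 - a 1) / (b 1 - a 1), ?_⟩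
    ext i
    fin_cases i
    · simp; field_simp; linarith
    · simp; field_simp; ring

theorem genPos_of_inGeneralPosition {S : Finset Plane} (h : InGeneralPosition (S : Set Plane)) :
    GenPos S := fun a ha b hb c hc hab hac hbc h0 =>
  h a ha b hb c hc hab hac hbc (collinear_of_orient_eq_zero h0)

/-! ### Empty pentagons in terms of orientations -/

/-- `a b c d e` is a counterclockwise convex pentagon with vertices in `S` and no point of `S`
in its interior. -/
structure Hole5 (S : Finset Plane) (a b c d e : Plane) : Prop where
  ma : a ∈ S
  mb : b ∈ S
  mc : c ∈ S
  md : d ∈ S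
  me : e ∈ S
  abc : 0 < orient a b c
  abd : 0 < orient a b d
  abe : 0 < orient a b e
  acd : 0 < orient a c d
  ace : 0 < orient a c e
  ade : 0 < orient a d e
  bcd : 0 < orient b c d
  bce : 0 < orient b c e
  bde : 0 < orient b d e
  cde : 0 < orient c d e
  empty : ∀ p ∈ S, 0 < orient a b p → 0 < orient b c p → 0 < orient c d p → 0 < orient d e p →
    0 < orient e a p → False

theorem Hole5.rot {S : Finset Plane} {a b c d e : Plane} (h : Hole5 S a b c d e) :
    Hole5 S b c d e a where
  ma := h.mb
  mb := h.mc
  mc := h.md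
  md := h.me
  me := h.ma
  abc := h.bcd
  abd := h.bce
  abe := by rw [← orient_rot]; exact h.abc
  acd := h.bde
  ace := by rw [← orient_rot]; exact h.abd
  ade := by rw [← orient_rot]; exact h.abe
  bcd := h.cde
  bce := by rw [← orient_rot]; exact h.acd
  bde := by rw [← orient_rot]; exact h.ace
  cde := by rw [← orient_rot]; exact h.ade
  empty := fun p hp h1 h2 h3 h4 h5 => h.empty p hp h5 h1 h2 h3 h4

theorem ne_of_orient_pos {a b c : Plane} (h : 0 < orient a b c) : a ≠ b ∧ a ≠ c ∧ b ≠ c := by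
  refine ⟨?_, ?_, ?_⟩ <;> rintro rfl <;> simp at h

theorem convex_orient_nonneg (a b : Plane) : Convex ℝ {z : Plane | 0 ≤ orient a b z} := by
  intro x hx y hy s t hs ht hst
  simp only [Set.mem_ofPred_eq] at *
  have : orient a b (s • x + t • y) = s * orient a b x + t * orient a b y := by
    obtain rfl : t = 1 - s := by linarith
    unfold orient
    simp
    ring
  rw [this]; positivity

theorem orient_pos_of_mem_interior {a b p : Plane} {C : Set Plane} (hab : a ≠ b)
    (hC : C ⊆ {z | 0 ≤ orient a b z}) (hp : p ∈ interior C) : 0 < orient a b p := by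
  by_contra hcon
  -- The normal pointing to the right of `a b`: moving along it decreases `orient a b` at the rate
  -- `|b - a|²`, so a small move out of `p` would leave `C`.
  set v : Plane := !₂[b 1 - a 1, -(b 0 - a 0)] with hv
  have hcont : Continuous fun t : ℝ => p + t • v := by fun_prop
  have hmem : (fun t : ℝ => p + t • v) ⁻¹' interior C ∈ nhds (0 : ℝ) :=
    (isOpen_interior.preimage hcont).mem_nhds (by simpa using hp)
  obtain ⟨ε, hε, hball⟩ := Metric.mem_nhds_iff.1 hmem
  have h1 : (ε / 2) ∈ Metric.ball (0 : ℝ) ε := by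
    simp [abs_of_pos hε, show 0 < ε from hε]
  have h2 := hC (interior_subset (hball h1))
  simp only [Set.mem_ofPred_eq] at h2
  have h3 : orient a b (p + (ε / 2) • v) =
      orient a b p - ε / 2 * ((b 0 - a 0) ^ 2 + (b 1 - a 1) ^ 2) := by
    unfold orient
    simp [hv]
    ring
  have h4 : 0 < (b 0 - a 0) ^ 2 + (b 1 - a 1) ^ 2 := by
    by_contra h5
    apply hab
    have e0 : b 0 - a 0 = 0 := by nlinarith [sq_nonneg (b 0 - a 0), sq_nonneg (b 1 - a 1)]
    have e1 : b 1 - a 1 = 0 := by nlinarith [sq_nonneg (b 0 - a 0), sq_nonneg (b 1 - a 1)]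
    ext i
    fin_cases i
    · simp; linarith
    · simp; linarith
  rw [h3] at h2
  nlinarith [mul_pos hε h4]

/-- The diagonal `e b` separates: `c` and `d` are to its left, `a` is strictly to its right. -/
theorem Hole5.notMem_convexHull {S : Finset Plane} {a b c d e : Plane} (h : Hole5 S a b c d e) :
    a ∉ convexHull ℝ ({b, c, d, e} : Set Plane) := by
  intro ha
  have hsub : convexHull ℝ ({b, c, d, e} : Set Plane) ⊆ {z | 0 ≤ orient e b z} := by
    refine convexHull_min ?_ (convex_orient_nonneg e b)
    intro z hz
    simp only [Set.mem_insert_iff, Set.mem_singleton_iff] at hz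
    simp only [Set.mem_ofPred_eq]
    rcases hz with rfl | rfl | rfl | rfl
    · simp
    · rw [orient_rot]; exact h.bce.le
    · rw [orient_rot]; exact h.bde.le
    · simp
  have h1 := hsub ha
  simp only [Set.mem_ofPred_eq] at h1
  have := h.abe
  rw [orient_rot, orient_rot, orient_swap'] at this
  linarith

theorem Hole5.orient_pos_of_mem {S : Finset Plane} {a b c d e p : Plane} (h : Hole5 S a b c d e)
    (hp : p ∈ interior (convexHull ℝ ({a, b, c, d, e} : Set Plane))) : 0 < orient a b p := by
  refine orient_pos_of_mem_interior (ne_of_orient_pos h.abc).1 ?_ hp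
  refine convexHull_min ?_ (convex_orient_nonneg a b)
  intro z hz
  simp only [Set.mem_insert_iff, Set.mem_singleton_iff] at hz
  simp only [Set.mem_ofPred_eq]
  rcases hz with rfl | rfl | rfl | rfl | rfl
  · simp
  · simp
  · exact h.abc.le
  · exact h.abd.le
  · exact h.abe.le

-- Only this direction is needed: pentagons are found by their orientations and counted as members
-- of `holes`.
open Classical in
theorem Hole5.mem_holes {S : Finset Plane} {a b c d e : Plane} (h : Hole5 S a b c d e) :
    ({a, b, c, d, e} : Finset Plane) ∈ holes 5 S := by
  have hab := ne_of_orient_pos h.abc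
  have had := ne_of_orient_pos h.ade
  have hbc := ne_of_orient_pos h.bcd
  have hbe := ne_of_orient_pos h.bde
  have hcd := ne_of_orient_pos h.cde
  have hr := h.rot
  have hr2 := hr.rot
  have hr3 := hr2.rot
  have hr4 := hr3.rot
  have hcoe : (({a, b, c, d, e} : Finset Plane) : Set Plane) = {a, b, c, d, e} := by simp
  have e1 : ({a, b, c, d, e} : Set Plane) = {b, c, d, e, a} := by ext; simp; tauto
  have e2 : ({a, b, c, d, e} : Set Plane) = {c, d, e, a, b} := by ext; simp; tauto
  have e3 : ({a, b, c, d, e} : Set Plane) = {d, e, a, b, c} := by ext; simp; tauto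
  have e4 : ({a, b, c, d, e} : Set Plane) = {e, a, b, c, d} := by ext; simp; tauto
  unfold holes
  rw [Finset.mem_filter, Finset.mem_powerset]
  have hsub : ({a, b, c, d, e} : Finset Plane) ⊆ S := by
    intro z hz
    simp only [Finset.mem_insert, Finset.mem_singleton] at hz
    rcases hz with rfl | rfl | rfl | rfl | rfl
    exacts [h.ma, h.mb, h.mc, h.md, h.me]
  refine ⟨hsub, hsub, ?_, ?_, ?_⟩
  · rw [Finset.card_insert_of_notMem, Finset.card_insert_of_notMem, Finset.card_insert_of_notMem,
      Finset.card_insert_of_notMem, Finset.card_singleton] <;>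
    simp [hab.1, hab.2.1, had.1, had.2.1, hbc.1, hbc.2.1, hbe.2.1, hcd.1, hcd.2.1, hcd.2.2]
  · rw [convexIndependent_set_iff_notMem_convexHull_sdiff]
    intro x hx
    rw [hcoe] at hx ⊢
    have key : ∀ {a b c d e : Plane}, Hole5 S a b c d e →
        a ∉ convexHull ℝ (({a, b, c, d, e} : Set Plane) \ {a}) := by
      intro a b c d e h hmem
      refine h.notMem_convexHull (convexHull_mono ?_ hmem)
      intro z hz
      simp only [Set.mem_sdiff, Set.mem_insert_iff, Set.mem_singleton_iff] at hz ⊢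
      tauto
    simp only [Set.mem_insert_iff, Set.mem_singleton_iff] at hx
    rcases hx with rfl | rfl | rfl | rfl | rfl
    · exact key h
    · rw [e1]; exact key hr
    · rw [e2]; exact key hr2
    · rw [e3]; exact key hr3
    · rw [e4]; exact key hr4
  · intro p hp hint
    rw [hcoe] at hint
    exact h.empty p hp (h.orient_pos_of_mem hint) (hr.orient_pos_of_mem (e1 ▸ hint))
      (hr2.orient_pos_of_mem (e2 ▸ hint)) (hr3.orient_pos_of_mem (e3 ▸ hint))
      (hr4.orient_pos_of_mem (e4 ▸ hint))

/-! ### Exhaustive search over the orientations of nine points -/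

namespace SignSearch

/-! A sign assignment to the triples `i < j < k < 9` is stored as a natural number: for each triple
exactly one of two bits is set. A mask `m` is a
conjunction of signs, which holds for `M` if `m` is contained in `M`. -/

def holds (M m : ℕ) : Bool := Nat.beq (Nat.land M m) m

/-- None of the masks holds. This and the following functions are defined by recursors, which
the kernel evaluates faster than compiled pattern matching. -/
noncomputable def noneHolds (M : ℕ) (l : List ℕ) : Bool :=
  List.rec true (fun m _ ih => Bool.rec ih false (Nat.beq (Nat.land M m) m)) l

/-- A decision tree: it succeeds at a leaf unless the first mask holds and no other does. -/
inductive Test : Type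
  | leaf (m : ℕ) (l : List ℕ) : Test
  | node (m : ℕ) (s t : Test) : Test

noncomputable def Test.ok (M : ℕ) (t : Test) : Bool :=
  Test.rec (fun m l => Bool.rec true (Bool.rec true false (noneHolds M l))
      (Nat.beq (Nat.land M m) m))
    (fun m _ _ s t => Bool.rec t s (Nat.beq (Nat.land M m) m)) t

noncomputable def allOk (M : ℕ) (l : List Test) : Bool :=
  List.rec true (fun t _ ih => Bool.rec false ih (t.ok M)) l

/-! Continuation passing versions of the identity, which make the kernel evaluate the argument. -/

def forceNat {α : Type} : ℕ → (ℕ → α) → α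
  | 0, k => k 0
  | n + 1, k => k (Nat.succ n)

def forceList {α : Type} : List ℕ → (List ℕ → α) → α
  | [], k => k []
  | x :: l, k => forceNat x fun x => forceList l fun l => k (x :: l)

def Test.force {α : Type} : Test → (Test → α) → α
  | .leaf m l, k => forceNat m fun m => forceList l fun l => k (.leaf m l)
  | .node m s t, k => forceNat m fun m => s.force fun s => t.force fun t => k (.node m s t)

def forceTests {α : Type} : List Test → (List Test → α) → α
  | [], k => k []
  | x :: l, k => x.force fun x => forceTests l fun l => k (x :: l)

/-- A choice between two bits, each with the masks that are thereby to be avoided. -/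
structure Step : Type where
  pos : ℕ
  posMasks : List ℕ
  neg : ℕ
  negMasks : List ℕ

def forceSteps {α : Type} : List Step → (List Step → α) → α
  | [], k => k []
  | ⟨u, c, v, d⟩ :: l, k => forceNat u fun u => forceList c fun c => forceNat v fun v =>
      forceList d fun d => forceSteps l fun l => k (⟨u, c, v, d⟩ :: l)

/-- At level `n`: an assignment for the first `n - 1` points, and a list of assignments for `n`
points that extend it. -/
abbrev Group : Type := ℕ × List ℕ

def forceGroups {α : Type} : List Group → (List Group → α) → α
  | [], k => k []
  | (u, c) :: l, k => forceNat u fun u => forceList c fun c => forceGroups l fun l =>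
      k ((u, c) :: l)

/-- The bit that says that the triple `i < j < k` is positive; the bit that says that it is negative
comes 32 places later. -/
def code (i j k : ℕ) : ℕ := 64 * i + (k - i - 1) * (k - i - 2) / 2 + (j - i - 1)

/-- The bit that says that the triple `i j k` (in any order) is positive. -/
def lit (i j k : ℕ) : ℕ :=
  bif Nat.blt i j then
    bif Nat.blt j k then code i j k
    else bif Nat.blt i k then code i k j + 32 else code k i j
  else
    bif Nat.blt i k then code j i k + 32
    else bif Nat.blt j k then code j k i else code k j i + 32

/-- The stored form of a number: its residue modulo a prime is put in front, so that the numbers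
occurring in the search have different hashes. -/
def salt (r : ℕ) : ℕ := Nat.lor (Nat.shiftLeft r 16) (Nat.mod r 65521)

def rawMask : List ℕ → ℕ
  | [] => 0
  | e :: l => rawMask l ||| 2 ^ e

def mask (l : List ℕ) : ℕ := rawMask l <<< 16

/-- The numbers strictly between `a` and `b`. -/
def between (a b : ℕ) : List ℕ := List.range' (a + 1) (b - a - 1)

/-- Decides the sign of the triple `0 l n`. The masks are the sign patterns that `Good.signotope`
forbids in the quadruples `0 l m n` and `0 j l n`. The triples `0 m n` with `m > l` are still
undecided, so patterns with them are left out. -/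
def signStep (n l : ℕ) : Step :=
    ⟨2 ^ code 0 l n,
     ((between l n).map fun m => mask [code 0 l m + 32, code 0 l n, code l m n + 32]) ++
     (between 0 l).flatMap fun j =>
      [mask [code 0 j l + 32, code 0 l n, code j l n + 32],
       mask [code 0 j l, code 0 j n + 32, code 0 l n],
       mask [code 0 j n + 32, code 0 l n, code j l n + 32]],
     2 ^ (code 0 l n + 32),
     ((between l n).map fun m => mask [code 0 l m, code 0 l n + 32, code l m n]) ++
     (between 0 l).flatMap fun j =>
      [mask [code 0 j l, code 0 l n + 32, code j l n],
       mask [code 0 j l + 32, code 0 j n, code 0 l n + 32],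
       mask [code 0 j n, code 0 l n + 32, code j l n]]⟩

def signSteps (n : ℕ) : List Step := (between 0 n).map (signStep n)

/-- There is no empty convex pentagon with the vertices `a b c d` and the apex. -/
def apexTest (a b c d : ℕ) : Test :=
  -- Together with the apex, these two left turns already make the pentagon convex; a negative `a q
  -- b` puts `q` inside the triangle of `a`, `b` and the apex.
  .leaf (mask [code a b c, code b c d])
    (((between a b).map fun q => mask [code a q b + 32]) ++
    (((between b c).map fun q => mask [code b q c + 32]) ++
    ((between c d).map fun q => mask [code c q d + 32])))

/-- The pentagon `a b c d e` with vertices between `0` and `n` is not an empty convex one. -/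
def pentagonTest (n a b c d e : ℕ) : Test :=
  .leaf (mask [lit a b c, lit a b d, lit a b e, lit a c d, lit a c e, lit a d e, lit b c d,
      lit b c e, lit b d e, lit c d e])
    (((between 0 n).filter fun q =>
      !(Nat.beq q a || Nat.beq q b || Nat.beq q c || Nat.beq q d || Nat.beq q e)).map
    fun q => mask [lit a b q, lit b c q, lit c d q, lit d e q, lit e a q])

/-- In a convex pentagon whose first and last vertices in angular order are `0` and `n`, the
vertices to the right of the line `0 n` are passed in increasing order and the others in decreasing
order. So three signs leave one candidate for the counterclockwise order. -/
def pentagonTree (n b c d : ℕ) : Test :=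
  .node (mask [code 0 b n])
    (.node (mask [code 0 c n])
      (.node (mask [code 0 d n]) (pentagonTest n 0 b c d n) (pentagonTest n 0 b c n d))
      (.node (mask [code 0 d n]) (pentagonTest n 0 b d n c) (pentagonTest n 0 b n d c)))
    (.node (mask [code 0 c n])
      (.node (mask [code 0 d n]) (pentagonTest n 0 c d n b) (pentagonTest n 0 c n d b))
      (.node (mask [code 0 d n]) (pentagonTest n 0 d n c b) (pentagonTest n 0 n d c b)))

/-- Configurations that avoid `0` or `n` were tested at a lower level, on one of the two sequences
of `n` points that are being joined. -/
def holeTests (n : ℕ) : List Test :=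
  (between 0 n).flatMap fun b => (between b n).flatMap fun c =>
    apexTest 0 b c n :: (between c n).map fun d => pentagonTree n b c d

/-- Those extensions of `M` by the steps that respect all tests, in front of `acc`. -/
noncomputable def collect (ts : List Test) (ss : List Step) : ℕ → List ℕ → List ℕ :=
  List.rec (fun M acc => Bool.rec acc (M :: acc) (allOk M ts))
    (fun s _ ih M acc => forceNat (salt (Nat.lor (Nat.shiftRight M 16) s.pos)) fun Mu =>
      forceNat (salt (Nat.lor (Nat.shiftRight M 16) s.neg)) fun Mv =>
      Bool.rec (Bool.rec acc (ih Mv acc) (noneHolds Mv s.negMasks))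
        (Bool.rec (ih Mu acc) (ih Mu (ih Mv acc)) (noneHolds Mv s.negMasks))
        (noneHolds Mu s.posMasks)) ss

/-- All extensions of `A` whose part without the point `0` is in the list. -/
noncomputable def extend (ts : List Test) (ss : List Step) (A : ℕ) (l acc : List ℕ) : List ℕ :=
  List.rec acc (fun B _ ih => forceNat (salt (Nat.lor (Nat.shiftRight A 16)
    (Nat.shiftLeft (Nat.shiftRight B 16) 64))) fun M =>
    collect ts ss M ih) l

/-- Joins `A`, for the points `0, …, n - 1`, to all assignments for `1, …, n` that agree with it on
the common points; this agreement is what `key` expresses. -/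
noncomputable def extendBy (ts : List Test) (ss : List Step) (key A : ℕ) (T : List Group) :
    List ℕ :=
  List.rec [] (fun g _ ih => Bool.rec ih (extend ts ss A g.2 ih) (Nat.beq key g.1)) T

/-- The bits of the triples of numbers below `n`. -/
def fullMask (n : ℕ) : ℕ :=
  rawMask ((between 0 n).flatMap fun k => (between 0 k).flatMap fun j =>
    (List.range j).flatMap fun i => [code i j k, code i j k + 32])

noncomputable def nextGroups (ts : List Test) (ss : List Step) (F : ℕ) (T : List Group) :
    List ℕ → List Group → List Group
  | [], acc => acc
  -- The shift by 80 = 16 + 64 drops the salt and the block of triples that contain the point `0`.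
  | A :: l, acc => forceNat (salt ((A >>> 80) &&& F)) fun key =>
      (A, extendBy ts ss key A T) :: nextGroups ts ss F T l acc

noncomputable def nextAll (ts : List Test) (ss : List Step) (F : ℕ) (T : List Group) :
    List Group → List Group
  | [] => []
  | (_, c) :: l => nextGroups ts ss F T c (nextAll ts ss F T l)

noncomputable def nextLevel {α : Type} (n : ℕ) (T : List Group) (k : List Group → α) : α :=
  forceTests (holeTests n) fun ts => forceSteps (signSteps n) fun ss =>
    forceNat (fullMask (n - 1)) fun F => forceGroups (nextAll ts ss F T T) k

def noneLeft : List Group → Bool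
  | [] => true
  | (_, []) :: l => noneLeft l
  | (_, _ :: _) :: _ => false

noncomputable def search : Bool :=
  nextLevel 2 [(0, [0])] fun T => nextLevel 3 T fun T => nextLevel 4 T fun T =>
    nextLevel 5 T fun T => nextLevel 6 T fun T => nextLevel 7 T fun T => nextLevel 8 T noneLeft

/-- The finite computation behind Harborth's theorem: seven levels lead from two points to nine,
where every assignment has been eliminated. -/
theorem search_eq_true : search = true := by decide +kernel

end SignSearch

/-! ### Correctness of the search procedure -/

namespace SignSearch

theorem forceNat_eq {α : Type} (n : ℕ) (k : ℕ → α) : forceNat n k = k n := by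
  cases n <;> rfl

theorem forceList_eq {α : Type} (l : List ℕ) (k : List ℕ → α) : forceList l k = k l := by
  induction l generalizing k with
  | nil => rfl
  | cons x l ih => simp only [forceList, forceNat_eq, ih]

theorem Test.force_eq {α : Type} (t : Test) (k : Test → α) : t.force k = k t := by
  induction t generalizing k with
  | leaf m l => simp only [Test.force, forceNat_eq, forceList_eq]
  | node m s t hs ht => simp only [Test.force, forceNat_eq, hs, ht]

theorem forceTests_eq {α : Type} (l : List Test) (k : List Test → α) : forceTests l k = k l := by
  induction l generalizing k with
  | nil => rfl
  | cons x l ih => simp only [forceTests, Test.force_eq, ih]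

theorem forceSteps_eq {α : Type} (l : List Step) (k : List Step → α) : forceSteps l k = k l := by
  induction l generalizing k with
  | nil => rfl
  | cons x l ih => simp only [forceSteps, forceNat_eq, forceList_eq, ih]

theorem forceGroups_eq {α : Type} (l : List Group) (k : List Group → α) :
    forceGroups l k = k l := by
  induction l generalizing k with
  | nil => rfl
  | cons x l ih => simp only [forceGroups, forceNat_eq, forceList_eq, ih]

theorem noneHolds_cons (M m : ℕ) (l : List ℕ) :
    noneHolds M (m :: l) = bif holds M m then false else noneHolds M l := by
  change @Bool.rec (fun _ => Bool) (noneHolds M l) false (holds M m) = _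
  cases holds M m <;> rfl

theorem noneHolds_eq_true {M : ℕ} {l : List ℕ} :
    noneHolds M l = true ↔ ∀ m ∈ l, holds M m = false := by
  induction l with
  | nil => simp [noneHolds]
  | cons m l ih =>
    rw [noneHolds_cons]
    cases h : holds M m <;> simp [h, ih]

/-- If the first mask of a leaf holds, then so does another one. -/
def Test.Valid (M : ℕ) : Test → Prop
  | .leaf m l => holds M m = true → ∃ q ∈ l, holds M q = true
  | .node _ s t => s.Valid M ∧ t.Valid M

theorem Test.Valid.ok {M : ℕ} {t : Test} (h : t.Valid M) : t.ok M = true := by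
  induction t with
  | leaf m l =>
    change @Bool.rec (fun _ => Bool) true
      (@Bool.rec (fun _ => Bool) true false (noneHolds M l)) (holds M m) = _
    cases h1 : holds M m
    · rfl
    · cases h2 : noneHolds M l
      · rfl
      · obtain ⟨q, hq, hq'⟩ := h h1
        rw [noneHolds_eq_true] at h2
        simp [h2 q hq] at hq'
  | node m s t hs ht =>
    change @Bool.rec (fun _ => Bool) (t.ok M) (s.ok M) (holds M m) = _
    cases holds M m
    · exact ht h.2
    · exact hs h.1

theorem allOk_eq_true {M : ℕ} {l : List Test} (h : ∀ t ∈ l, t.Valid M) : allOk M l = true := by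
  induction l with
  | nil => rfl
  | cons t l ih =>
    change @Bool.rec (fun _ => Bool) false (allOk M l) (t.ok M) = _
    rw [(h t (by simp)).ok]
    exact ih fun t ht => h t (by simp [ht])

/-- The residue is below `2 ^ 16`, so it stays within the bits that are shifted away. -/
theorem salt_shiftRight (r : ℕ) : salt r >>> 16 = r := by
  apply Nat.eq_of_testBit_eq
  intro i
  have h : (r % 65521).testBit (16 + i) = false := by
    apply Nat.testBit_lt_two_pow
    calc r % 65521 < 65521 := Nat.mod_lt _ (by norm_num)
      _ ≤ 2 ^ 16 := by norm_num
      _ ≤ 2 ^ (16 + i) := Nat.pow_le_pow_right (by norm_num) (by omega)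
  change ((r <<< 16 ||| r % 65521) >>> 16).testBit i = r.testBit i
  simp [Nat.testBit_shiftRight, Nat.testBit_or, Nat.testBit_shiftLeft, h]

theorem testBit_rawMask {l : List ℕ} {t : ℕ} : (rawMask l).testBit t = true ↔ t ∈ l := by
  induction l with
  | nil => simp [rawMask]
  | cons e l ih =>
    simp only [rawMask, Nat.testBit_or, Bool.or_eq_true, ih, Nat.testBit_two_pow, List.mem_cons,
      decide_eq_true_eq]
    constructor
    · rintro (h | h)
      · exact Or.inr h
      · exact Or.inl h.symm
    · rintro (h | h)
      · exact Or.inr h.symm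
      · exact Or.inl h

theorem holds_mask {r : ℕ} {l : List ℕ} :
    holds (salt r) (mask l) = true ↔ ∀ e ∈ l, r.testBit e = true := by
  have hs : ∀ i, (salt r).testBit (16 + i) = r.testBit i := by
    intro i
    rw [← Nat.testBit_shiftRight, salt_shiftRight]
  unfold holds mask
  rw [Nat.beq_eq]
  change (salt r &&& rawMask l <<< 16 = _) ↔ _
  constructor
  · intro h e he
    have h1 := congrArg (fun z => z.testBit (16 + e)) h
    simp only [Nat.testBit_and, hs, Nat.testBit_shiftLeft, Nat.add_sub_cancel_left,
      testBit_rawMask.2 he] at h1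
    simpa using h1
  · intro h
    apply Nat.eq_of_testBit_eq
    intro t
    rw [Nat.testBit_and, Nat.testBit_shiftLeft]
    by_cases ht : 16 ≤ t
    · obtain ⟨e, rfl⟩ := Nat.exists_eq_add_of_le ht
      rw [hs, Nat.add_sub_cancel_left]
      cases h1 : (rawMask l).testBit e
      · simp
      · simp [h e (testBit_rawMask.1 h1)]
    · simp [ht]

/-- From `r` the steps can lead to `F`. -/
inductive Reaches (F : ℕ) : List Step → ℕ → Prop
  | nil : Reaches F [] F
  | pos {s : Step} {ss : List Step} {r : ℕ} (h : noneHolds (salt (r ||| s.pos)) s.posMasks = true)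
      (h' : Reaches F ss (r ||| s.pos)) : Reaches F (s :: ss) r
  | neg {s : Step} {ss : List Step} {r : ℕ} (h : noneHolds (salt (r ||| s.neg)) s.negMasks = true)
      (h' : Reaches F ss (r ||| s.neg)) : Reaches F (s :: ss) r

theorem collect_cons (ts : List Test) (s : Step) (ss : List Step) (r : ℕ) (acc : List ℕ) :
    collect ts (s :: ss) (salt r) acc =
      bif noneHolds (salt (r ||| s.pos)) s.posMasks then
        bif noneHolds (salt (r ||| s.neg)) s.negMasks then
          collect ts ss (salt (r ||| s.pos)) (collect ts ss (salt (r ||| s.neg)) acc)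
        else collect ts ss (salt (r ||| s.pos)) acc
      else bif noneHolds (salt (r ||| s.neg)) s.negMasks then
          collect ts ss (salt (r ||| s.neg)) acc
        else acc := by
  have h : ∀ v, Nat.lor (Nat.shiftRight (salt r) 16) v = r ||| v := fun v =>
    congrArg (· ||| v) (salt_shiftRight r)
  change forceNat (salt (Nat.lor (Nat.shiftRight (salt r) 16) s.pos)) (fun Mu =>
      forceNat (salt (Nat.lor (Nat.shiftRight (salt r) 16) s.neg)) fun Mv =>
      @Bool.rec (fun _ => List ℕ)
        (@Bool.rec (fun _ => List ℕ) acc (collect ts ss Mv acc) (noneHolds Mv s.negMasks))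
        (@Bool.rec (fun _ => List ℕ) (collect ts ss Mu acc)
          (collect ts ss Mu (collect ts ss Mv acc)) (noneHolds Mv s.negMasks))
        (noneHolds Mu s.posMasks)) = _
  rw [forceNat_eq, forceNat_eq, h, h]
  cases noneHolds (salt (r ||| s.pos)) s.posMasks <;>
    cases noneHolds (salt (r ||| s.neg)) s.negMasks <;> rfl

theorem mem_collect_of_mem (ts : List Test) (ss : List Step) (r : ℕ) {acc : List ℕ} {z : ℕ}
    (hz : z ∈ acc) : z ∈ collect ts ss (salt r) acc := by
  induction ss generalizing r acc with
  | nil =>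
    change z ∈ (Bool.rec acc (salt r :: acc) (allOk (salt r) ts) : List ℕ)
    cases allOk (salt r) ts
    · exact hz
    · exact List.mem_cons_of_mem _ hz
  | cons s ss ih =>
    rw [collect_cons]
    cases noneHolds (salt (r ||| s.pos)) s.posMasks <;>
      cases noneHolds (salt (r ||| s.neg)) s.negMasks <;> simp [ih, hz]

/-- The search only has to keep every assignment that comes from points; nothing is claimed about
the other assignments in its lists. -/
theorem Reaches.mem_collect {F : ℕ} {ss : List Step} {r : ℕ} (h : Reaches F ss r) {ts : List Test}
    (hts : allOk (salt F) ts = true) (acc : List ℕ) : salt F ∈ collect ts ss (salt r) acc := by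
  induction h generalizing acc with
  | nil =>
    change _ ∈ (Bool.rec acc (salt F :: acc) (allOk (salt F) ts) : List ℕ)
    rw [hts]
    exact List.mem_cons_self
  | pos h _ ih =>
    rw [collect_cons, h]
    cases noneHolds _ _ <;> simp [ih]
  | @neg s ss r h _ ih =>
    rw [collect_cons, h]
    cases noneHolds _ _
    · simp [ih]
    · simp [mem_collect_of_mem, ih]

theorem mem_extend {F A B : ℕ} {ts : List Test} {ss : List Step} {l : List ℕ}
    (hB : salt B ∈ l) (h : Reaches F ss (A ||| B <<< 64)) (hts : allOk (salt F) ts = true)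
    (acc : List ℕ) : salt F ∈ extend ts ss (salt A) l acc := by
  have key : ∀ (B' : ℕ) (l : List ℕ), extend ts ss (salt A) (B' :: l) acc =
      collect ts ss (salt (A ||| (B' >>> 16) <<< 64)) (extend ts ss (salt A) l acc) := by
    intro B' l
    change forceNat (salt (Nat.lor (Nat.shiftRight (salt A) 16)
      (Nat.shiftLeft (Nat.shiftRight B' 16) 64))) (fun M => collect ts ss M
        (extend ts ss (salt A) l acc)) = _
    rw [forceNat_eq]
    congr 2
    exact congrArg (· ||| (B' >>> 16) <<< 64) (salt_shiftRight A)
  induction l with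
  | nil => simp at hB
  | cons B' l ih =>
    rw [key]
    rcases List.mem_cons.1 hB with rfl | hB
    · rw [salt_shiftRight]
      exact h.mem_collect hts _
    · exact mem_collect_of_mem _ _ _ (ih hB)

theorem mem_extend_of_mem (ts : List Test) (ss : List Step) (A : ℕ) (l : List ℕ) {acc : List ℕ}
    {z : ℕ} (hz : z ∈ acc) : z ∈ extend ts ss A l acc := by
  induction l with
  | nil => exact hz
  | cons B l ih =>
    change z ∈ forceNat (salt _) (fun M => collect ts ss M (extend ts ss A l acc))
    rw [forceNat_eq]
    exact mem_collect_of_mem _ _ _ ih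

theorem mem_extendBy {F A B key : ℕ} {ts : List Test} {ss : List Step} {T : List Group}
    {l : List ℕ} (hg : (key, l) ∈ T) (hB : salt B ∈ l) (h : Reaches F ss (A ||| B <<< 64))
    (hts : allOk (salt F) ts = true) : salt F ∈ extendBy ts ss key (salt A) T := by
  induction T with
  | nil => simp at hg
  | cons g T ih =>
    change salt F ∈ (Bool.rec (extendBy ts ss key (salt A) T)
      (extend ts ss (salt A) g.2 (extendBy ts ss key (salt A) T)) (Nat.beq key g.1) : List ℕ)
    rcases List.mem_cons.1 hg with rfl | hg
    · rw [Nat.beq_refl]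
      exact mem_extend hB h hts _
    · cases Nat.beq key g.1
      · exact ih hg
      · exact mem_extend_of_mem _ _ _ _ (ih hg)

theorem mem_nextGroups {A : ℕ} {ts : List Test} {ss : List Step} {F : ℕ} {T : List Group}
    {l : List ℕ} (acc : List Group) (hA : A ∈ l) :
    (A, extendBy ts ss (salt ((A >>> 80) &&& F)) A T) ∈ nextGroups ts ss F T l acc := by
  induction l with
  | nil => simp at hA
  | cons A' l ih =>
    simp only [nextGroups, forceNat_eq]
    rcases List.mem_cons.1 hA with rfl | hA
    · exact List.mem_cons_self
    · exact List.mem_cons_of_mem _ (ih hA)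

theorem mem_nextGroups_of_mem {ts : List Test} {ss : List Step} {F : ℕ} {T : List Group}
    (l : List ℕ) {acc : List Group} {z : Group} (hz : z ∈ acc) :
    z ∈ nextGroups ts ss F T l acc := by
  induction l with
  | nil => exact hz
  | cons A' l ih =>
    simp only [nextGroups, forceNat_eq]
    exact List.mem_cons_of_mem _ ih

theorem mem_nextAll {A : ℕ} {ts : List Test} {ss : List Step} {F : ℕ} {T T' : List Group}
    {g : Group} (hg : g ∈ T') (hA : A ∈ g.2) :
    (A, extendBy ts ss (salt ((A >>> 80) &&& F)) A T) ∈ nextAll ts ss F T T' := by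
  induction T' with
  | nil => simp at hg
  | cons g' T' ih =>
    simp only [nextAll]
    rcases List.mem_cons.1 hg with rfl | hg
    · exact mem_nextGroups _ hA
    · exact mem_nextGroups_of_mem _ (ih hg)

theorem eq_nil_of_noneLeft {T : List Group} (h : noneLeft T = true) {g : Group} (hg : g ∈ T) :
    g.2 = [] := by
  induction T with
  | nil => simp at hg
  | cons g' T ih =>
    obtain ⟨u, _ | ⟨z, c⟩⟩ := g'
    · rcases List.mem_cons.1 hg with rfl | hg
      · rfl
      · exact ih (by simpa [noneLeft] using h) hg
    · simp [noneLeft] at h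

end SignSearch

/-! ### Angular order, and the bits that encode point sets -/

/-- Transitivity of the angular order about `p` in a half-plane bounded by a line through `p`. -/
theorem orient_trans {p w a b c : Plane} (ha : 0 < orient p w a) (hb : 0 < orient p w b)
    (hc : 0 < orient p w c) (hab : 0 < orient p a b) (hbc : 0 < orient p b c) :
    0 < orient p a c := by
  have h := orient_gp p w a b c
  by_contra hcon
  nlinarith [mul_pos ha hbc, mul_pos hc hab, mul_nonneg hb.le (not_lt.1 hcon |> neg_nonneg.2)]

/-- A point that sees all vertices of a closed polygon on the left side of a line through it is
not on the left of all sides. -/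
theorem not_all_left {p q a b c d e : Plane} (ha : 0 < orient q p a) (hb : 0 < orient q p b)
    (hc : 0 < orient q p c) (hd : 0 < orient q p d) (he : 0 < orient q p e)
    (h1 : 0 < orient a b q) (h2 : 0 < orient b c q) (h3 : 0 < orient c d q)
    (h4 : 0 < orient d e q) (h5 : 0 < orient e a q) : False := by
  rw [orient_rot, orient_rot] at h1 h2 h3 h4 h5
  have h6 := orient_trans ha hb hc h1 h2
  have h7 := orient_trans ha hc hd h6 h3
  have h8 := orient_trans ha hd he h7 h4
  have h9 := orient_swap' q e a
  linarith

namespace SignSearch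

/-- For a fixed smallest index the offset numbers the pairs `j < k`; there are at most `8 * 7 / 2 =
28` of them, which leaves room for the negative copies 32 places later. -/
theorem code_lt {i j k : ℕ} (hij : i < j) (hjk : j < k) (hk : k < 9) :
    (k - i - 1) * (k - i - 2) / 2 + (j - i - 1) < 28 := by
  obtain ⟨d, rfl⟩ : ∃ d, k = i + 1 + d := ⟨k - i - 1, by omega⟩
  have h1 : i + 1 + d - i - 1 = d := by omega
  have h2 : i + 1 + d - i - 2 = d - 1 := by omega
  rw [h1, h2]
  have hd : d < 8 := by omega
  interval_cases d <;> norm_num <;> omega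

theorem code_inj {i j k i' j' k' : ℕ} (hij : i < j) (hjk : j < k) (hk : k < 9) (hij' : i' < j')
    (hjk' : j' < k') (hk' : k' < 9) (h : code i j k = code i' j' k') :
    i = i' ∧ j = j' ∧ k = k' := by
  have h1 := code_lt hij hjk hk
  have h2 := code_lt hij' hjk' hk'
  unfold code at h
  obtain rfl : i = i' := by omega
  have h3 : (k - i - 1) * (k - i - 2) / 2 + (j - i - 1) =
    (k' - i - 1) * (k' - i - 2) / 2 + (j' - i - 1) := by omega
  obtain ⟨d, rfl⟩ : ∃ d, k = i + 1 + d := ⟨k - i - 1, by omega⟩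
  obtain ⟨d', rfl⟩ : ∃ d, k' = i + 1 + d := ⟨k' - i - 1, by omega⟩
  have e1 : i + 1 + d - i - 1 = d := by omega
  have e2 : i + 1 + d - i - 2 = d - 1 := by omega
  have e1' : i + 1 + d' - i - 1 = d' := by omega
  have e2' : i + 1 + d' - i - 2 = d' - 1 := by omega
  rw [e1, e2, e1', e2'] at h3
  have hd : d < 8 := by omega
  have hd' : d' < 8 := by omega
  interval_cases d <;> interval_cases d' <;> norm_num at h3 <;> omega

theorem code_mod {i j k : ℕ} (hij : i < j) (hjk : j < k) (hk : k < 9) : code i j k % 64 < 28 := by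
  have h1 := code_lt hij hjk hk
  unfold code
  omega

theorem code_lt' {i j k : ℕ} (hij : i < j) (hjk : j < k) (hk : k < 9) :
    code i j k + 32 < 576 := by
  have h1 := code_lt hij hjk hk
  unfold code
  omega

/-- Blocks of 64 bits, one for each smallest index, turn the removal of the point `0` into a shift
by 64. -/
theorem code_shift (i j k : ℕ) : code (i + 1) (j + 1) (k + 1) = code i j k + 64 := by
  unfold code
  rw [Nat.add_sub_add_right, Nat.add_sub_add_right]
  ring

/-- The bit `t` is set in the stored form of the signs of the points `x 0, …, x (n - 1)`. -/
def IsBit (x : ℕ → Plane) (n t : ℕ) : Prop :=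
  ∃ i j k, i < j ∧ j < k ∧ k < n ∧ ((t = code i j k ∧ 0 < orient (x i) (x j) (x k)) ∨
    (t = code i j k + 32 ∧ orient (x i) (x j) (x k) < 0))

open Classical in
/-- The signs of the points `x 0, …, x (n - 1)`. -/
noncomputable def signs (x : ℕ → Plane) (n : ℕ) : ℕ :=
  Nat.ofBits fun t : Fin 576 => decide (IsBit x n t)

theorem testBit_signs {x : ℕ → Plane} {n t : ℕ} (hn : n ≤ 9) :
    (signs x n).testBit t = true ↔ IsBit x n t := by
  classical
  unfold signs
  by_cases ht : t < 576
  · rw [Nat.testBit_ofBits_lt _ _ ht]; simp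
  · rw [Nat.testBit_ofBits_ge _ _ (not_lt.1 ht)]
    simp only [Bool.false_eq_true, false_iff]
    rintro ⟨i, j, k, hij, hjk, hk, h | h⟩ <;>
    · have := code_lt' hij hjk (lt_of_lt_of_le hk hn)
      omega

theorem isBit_code {x : ℕ → Plane} {n i j k : ℕ} (hn : n ≤ 9) (hij : i < j) (hjk : j < k)
    (hk : k < n) : IsBit x n (code i j k) ↔ 0 < orient (x i) (x j) (x k) := by
  constructor
  · rintro ⟨i', j', k', hij', hjk', hk', h | h⟩
    · obtain ⟨rfl, rfl, rfl⟩ := code_inj hij hjk (by omega) hij' hjk' (by omega) h.1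
      exact h.2
    · have h1 := code_mod hij hjk (by omega)
      have h2 := code_mod hij' hjk' (by omega)
      omega
  · exact fun h => ⟨i, j, k, hij, hjk, hk, Or.inl ⟨rfl, h⟩⟩

theorem isBit_code_add {x : ℕ → Plane} {n i j k : ℕ} (hn : n ≤ 9) (hij : i < j) (hjk : j < k)
    (hk : k < n) : IsBit x n (code i j k + 32) ↔ orient (x i) (x j) (x k) < 0 := by
  constructor
  · rintro ⟨i', j', k', hij', hjk', hk', h | h⟩
    · have h1 := code_mod hij hjk (by omega)
      have h2 := code_mod hij' hjk' (by omega)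
      omega
    · obtain ⟨rfl, rfl, rfl⟩ := code_inj hij hjk (by omega) hij' hjk' (by omega) (by omega)
      exact h.2
  · exact fun h => ⟨i, j, k, hij, hjk, hk, Or.inr ⟨rfl, h⟩⟩

theorem isBit_lit {x : ℕ → Plane} {n i j k : ℕ} (hn : n ≤ 9) (hi : i < n) (hj : j < n) (hk : k < n)
    (hij : i ≠ j) (hik : i ≠ k) (hjk : j ≠ k) :
    IsBit x n (lit i j k) ↔ 0 < orient (x i) (x j) (x k) := by
  unfold lit
  rcases lt_or_gt_of_ne hij with h1 | h1 <;> rcases lt_or_gt_of_ne hik with h2 | h2 <;>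
    rcases lt_or_gt_of_ne hjk with h3 | h3 <;>
    simp only [Bool.cond_eq_ite, Nat.blt_eq, h1, h2, h3, h1.not_gt, h2.not_gt, h3.not_gt, if_true,
      if_false]
  · exact isBit_code hn h1 h3 hk
  · rw [isBit_code_add hn h2 h3 hj, orient_swap']
    simp
  · omega
  · rw [isBit_code hn h2 h1 hj, orient_rot]
  · rw [isBit_code_add hn h1 h2 hk, orient_swap]
    simp
  · omega
  · rw [isBit_code hn h3 h2 hi, ← orient_rot]
  · rw [isBit_code_add hn h3 h1 hi, orient_rev]
    simp

/-- The points `x 0, …, x (n - 1)` are in general position and sorted by angle about some apex, and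
do not form an empty convex pentagon, neither by themselves nor with the apex. -/
structure Good (x : ℕ → Plane) (n : ℕ) : Prop where
  ne_zero : ∀ i j k, i < j → j < k → k < n → orient (x i) (x j) (x k) ≠ 0
  apex : ∃ p, ∀ i j, i < j → j < n → 0 < orient p (x i) (x j)
  apex_hole : ∀ a b c d, a < b → b < c → c < d → d < n → 0 < orient (x a) (x b) (x c) →
    0 < orient (x b) (x c) (x d) → (∃ q, a < q ∧ q < b ∧ orient (x a) (x q) (x b) < 0) ∨
      (∃ q, b < q ∧ q < c ∧ orient (x b) (x q) (x c) < 0) ∨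
      (∃ q, c < q ∧ q < d ∧ orient (x c) (x q) (x d) < 0)
  -- The witness may be demanded strictly between `l` and `h`, because a point inside a pentagon is
  -- strictly inside the angle that its vertices span at the apex.
  hole : ∀ l h a b c d e, h < n → l ≤ a → l ≤ b → l ≤ c → l ≤ d → l ≤ e → a ≤ h → b ≤ h → c ≤ h →
    d ≤ h → e ≤ h →
    0 < orient (x a) (x b) (x c) → 0 < orient (x a) (x b) (x d) → 0 < orient (x a) (x b) (x e) →
    0 < orient (x a) (x c) (x d) → 0 < orient (x a) (x c) (x e) → 0 < orient (x a) (x d) (x e) →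
    0 < orient (x b) (x c) (x d) → 0 < orient (x b) (x c) (x e) → 0 < orient (x b) (x d) (x e) →
    0 < orient (x c) (x d) (x e) → ∃ q, l < q ∧ q < h ∧ 0 < orient (x a) (x b) (x q) ∧
      0 < orient (x b) (x c) (x q) ∧ 0 < orient (x c) (x d) (x q) ∧ 0 < orient (x d) (x e) (x q) ∧
      0 < orient (x e) (x a) (x q)

theorem Good.mono {x : ℕ → Plane} {m n : ℕ} (h : Good x n) (hmn : m ≤ n) : Good x m where
  ne_zero i j k hij hjk hk := h.ne_zero i j k hij hjk (by omega)
  apex := h.apex.imp fun p hp i j hij hj => hp i j hij (by omega)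
  apex_hole a b c d h1 h2 h3 h4 := h.apex_hole a b c d h1 h2 h3 (by omega)
  hole l u a b c d e h1 := h.hole l u a b c d e (by omega)

theorem Good.shift {x : ℕ → Plane} {n : ℕ} (h : Good x (n + 1)) :
    Good (fun i => x (i + 1)) n where
  ne_zero i j k hij hjk hk := h.ne_zero _ _ _ (by omega) (by omega) (by omega)
  apex := h.apex.imp fun p hp i j hij hj => hp _ _ (by omega) (by omega)
  apex_hole a b c d h1 h2 h3 h4 h5 h6 := by
    have := h.apex_hole (a + 1) (b + 1) (c + 1) (d + 1) (by omega) (by omega) (by omega)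
      (by omega) h5 h6
    rcases this with ⟨q, h7, h8, h9⟩ | ⟨q, h7, h8, h9⟩ | ⟨q, h7, h8, h9⟩ <;>
      obtain ⟨q, rfl⟩ : ∃ q', q = q' + 1 := ⟨q - 1, by omega⟩
    · exact Or.inl ⟨q, by omega, by omega, h9⟩
    · exact Or.inr (Or.inl ⟨q, by omega, by omega, h9⟩)
    · exact Or.inr (Or.inr ⟨q, by omega, by omega, h9⟩)
  hole l u a b c d e h1 h2 h3 h4 h5 h6 h7 h8 h9 h10 h11 k1 k2 k3 k4 k5 k6 k7 k8 k9 k10 := by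
    obtain ⟨q, r1, r2, r3⟩ := h.hole (l + 1) (u + 1) (a + 1) (b + 1) (c + 1) (d + 1) (e + 1)
      (by omega) (by omega) (by omega) (by omega) (by omega) (by omega) (by omega) (by omega)
      (by omega) (by omega) (by omega) k1 k2 k3 k4 k5 k6 k7 k8 k9 k10
    obtain ⟨q, rfl⟩ : ∃ q', q = q' + 1 := ⟨q - 1, by omega⟩
    exact ⟨q, by omega, by omega, r3⟩

/-- The four signs of a quadruple of points sorted by angle change at most once. -/
theorem Good.signotope {x : ℕ → Plane} {n : ℕ} (h : Good x n) {a b c d : ℕ} (hab : a < b)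
    (hbc : b < c) (hcd : c < d) (hd : d < n) :
    let s1 := orient (x a) (x b) (x c)
    let s2 := orient (x a) (x b) (x d)
    let s3 := orient (x a) (x c) (x d)
    let s4 := orient (x b) (x c) (x d)
    ¬(0 < s1 ∧ s2 < 0 ∧ 0 < s3) ∧ ¬(s1 < 0 ∧ 0 < s2 ∧ s3 < 0) ∧
    ¬(0 < s1 ∧ s2 < 0 ∧ 0 < s4) ∧ ¬(s1 < 0 ∧ 0 < s2 ∧ s4 < 0) ∧
    ¬(0 < s1 ∧ s3 < 0 ∧ 0 < s4) ∧ ¬(s1 < 0 ∧ 0 < s3 ∧ s4 < 0) ∧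
    ¬(0 < s2 ∧ s3 < 0 ∧ 0 < s4) ∧ ¬(s2 < 0 ∧ 0 < s3 ∧ s4 < 0) := by
  obtain ⟨p, hp⟩ := h.apex
  have pab := hp a b hab (by omega)
  have pac := hp a c (by omega) (by omega)
  have pad := hp a d (by omega) (by omega)
  have pbc := hp b c (by omega) (by omega)
  have pbd := hp b d (by omega) (by omega)
  have pcd := hp c d (by omega) (by omega)
  generalize x a = A at *
  generalize x b = B at *
  generalize x c = C at *
  generalize x d = D at *
  -- Each relation involves three of the four signs in their order, with coefficients of signs `+ -
  -- +`, so these three cannot alternate.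
  have ga : orient p A B * orient A C D - orient p A C * orient A B D +
      orient p A D * orient A B C = 0 := by unfold orient; ring
  have gb : orient p A B * orient B C D - orient p B C * orient A B D +
      orient p B D * orient A B C = 0 := by unfold orient; ring
  have gc : orient p A C * orient B C D - orient p B C * orient A C D +
      orient p C D * orient A B C = 0 := by unfold orient; ring
  have gd : orient p A D * orient B C D - orient p B D * orient A C D +
      orient p C D * orient A B D = 0 := by unfold orient; ring
  refine ⟨?_, ?_, ?_, ?_, ?_, ?_, ?_, ?_⟩ <;> rintro ⟨h1, h2, h3⟩
  · nlinarith [mul_pos pab h3, mul_pos_of_neg_of_neg (neg_neg_of_pos pac) h2, mul_pos pad h1]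
  · nlinarith [mul_pos pac h2, mul_pos_of_neg_of_neg (neg_neg_of_pos pab) h3,
      mul_pos_of_neg_of_neg (neg_neg_of_pos pad) h1]
  · nlinarith [mul_pos pab h3, mul_pos_of_neg_of_neg (neg_neg_of_pos pbc) h2, mul_pos pbd h1]
  · nlinarith [mul_pos pbc h2, mul_pos_of_neg_of_neg (neg_neg_of_pos pab) h3,
      mul_pos_of_neg_of_neg (neg_neg_of_pos pbd) h1]
  · nlinarith [mul_pos pac h3, mul_pos_of_neg_of_neg (neg_neg_of_pos pbc) h2, mul_pos pcd h1]
  · nlinarith [mul_pos pbc h2, mul_pos_of_neg_of_neg (neg_neg_of_pos pac) h3,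
      mul_pos_of_neg_of_neg (neg_neg_of_pos pcd) h1]
  · nlinarith [mul_pos pad h3, mul_pos_of_neg_of_neg (neg_neg_of_pos pbd) h2, mul_pos pcd h1]
  · nlinarith [mul_pos pbd h2, mul_pos_of_neg_of_neg (neg_neg_of_pos pad) h3,
      mul_pos_of_neg_of_neg (neg_neg_of_pos pcd) h1]

theorem mem_between {a b q : ℕ} : q ∈ between a b ↔ a < q ∧ q < b := by
  unfold between
  rw [List.mem_range'_1]
  omega

theorem apexTest_valid {x : ℕ → Plane} {n : ℕ} (h : Good x n) (hn : n ≤ 9) {a b c d : ℕ}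
    (hab : a < b) (hbc : b < c) (hcd : c < d) (hd : d < n) :
    (apexTest a b c d).Valid (salt (signs x n)) := by
  intro h1
  simp only [holds_mask, testBit_signs hn, List.mem_cons, List.not_mem_nil, or_false,
    forall_eq_or_imp, forall_eq, isBit_code hn hab hbc (by omega : c < n),
    isBit_code hn hbc hcd hd] at h1
  simp only [List.mem_append, List.mem_map, mem_between]
  rcases h.apex_hole a b c d hab hbc hcd hd h1.1 h1.2 with ⟨q, h2, h3, h4⟩ | ⟨q, h2, h3, h4⟩ |
    ⟨q, h2, h3, h4⟩
  · refine ⟨_, Or.inl ⟨q, ⟨h2, h3⟩, rfl⟩, ?_⟩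
    simpa [holds_mask, testBit_signs hn, isBit_code_add hn h2 h3 (by omega : b < n)] using h4
  · refine ⟨_, Or.inr (Or.inl ⟨q, ⟨h2, h3⟩, rfl⟩), ?_⟩
    simpa [holds_mask, testBit_signs hn, isBit_code_add hn h2 h3 (by omega : c < n)] using h4
  · refine ⟨_, Or.inr (Or.inr ⟨q, ⟨h2, h3⟩, rfl⟩), ?_⟩
    simpa [holds_mask, testBit_signs hn, isBit_code_add hn h2 h3 hd] using h4

theorem pentagonTest_valid {x : ℕ → Plane} {n : ℕ} (h : Good x (n + 1)) (hn : n < 9)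
    {a b c d e : ℕ} (ha : a ≤ n) (hb : b ≤ n) (hc : c ≤ n) (hd : d ≤ n) (he : e ≤ n)
    (hab : a ≠ b) (hac : a ≠ c) (had : a ≠ d) (hae : a ≠ e) (hbc : b ≠ c) (hbd : b ≠ d)
    (hbe : b ≠ e) (hcd : c ≠ d) (hce : c ≠ e) (hde : d ≠ e) :
    (pentagonTest n a b c d e).Valid (salt (signs x (n + 1))) := by
  intro h1
  have hl : ∀ {i j k : ℕ}, i ≤ n → j ≤ n → k ≤ n → i ≠ j → i ≠ k → j ≠ k →
      ((signs x (n + 1)).testBit (lit i j k) = true ↔ 0 < orient (x i) (x j) (x k)) := by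
    intro i j k hi hj hk hij hik hjk
    rw [testBit_signs (by omega), isBit_lit (by omega) (by omega) (by omega) (by omega) hij hik hjk]
  simp only [holds_mask, List.mem_cons, List.not_mem_nil, or_false, forall_eq_or_imp, forall_eq]
    at h1
  rw [hl ha hb hc hab hac hbc, hl ha hb hd hab had hbd, hl ha hb he hab hae hbe,
    hl ha hc hd hac had hcd, hl ha hc he hac hae hce, hl ha hd he had hae hde,
    hl hb hc hd hbc hbd hcd, hl hb hc he hbc hbe hce, hl hb hd he hbd hbe hde,
    hl hc hd he hcd hce hde] at h1
  obtain ⟨k1, k2, k3, k4, k5, k6, k7, k8, k9, k10⟩ := h1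
  obtain ⟨q, hq0, hqn, q1, q2, q3, q4, q5⟩ := h.hole 0 n a b c d e (by omega) (by omega) (by omega)
    (by omega) (by omega) (by omega) ha hb hc hd he k1 k2 k3 k4 k5 k6 k7 k8 k9 k10
  have n1 : q ≠ a := by rintro rfl; simp at q1
  have n2 : q ≠ b := by rintro rfl; simp at q1
  have n3 : q ≠ c := by rintro rfl; simp at q2
  have n4 : q ≠ d := by rintro rfl; simp at q3
  have n5 : q ≠ e := by rintro rfl; simp at q4
  refine ⟨_, List.mem_map.2 ⟨q, List.mem_filter.2 ⟨mem_between.2 ⟨hq0, hqn⟩, ?_⟩, rfl⟩, ?_⟩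
  · have hb : ∀ {z : ℕ}, q ≠ z → Nat.beq q z = false := fun hz =>
      Bool.eq_false_iff.2 fun h => hz (Nat.eq_of_beq_eq_true h)
    simp only [hb n1, hb n2, hb n3, hb n4, hb n5, Bool.or_false, Bool.not_false]
  · simp only [holds_mask, List.mem_cons, List.not_mem_nil, or_false, forall_eq_or_imp, forall_eq]
    rw [hl ha hb hqn.le hab n1.symm n2.symm, hl hb hc hqn.le hbc n2.symm n3.symm,
      hl hc hd hqn.le hcd n3.symm n4.symm, hl hd he hqn.le hde n4.symm n5.symm,
      hl he ha hqn.le hae.symm n5.symm n1.symm]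
    exact ⟨q1, q2, q3, q4, q5⟩

theorem holeTests_valid {x : ℕ → Plane} {n : ℕ} (h : Good x (n + 1)) (hn : n < 9) {t : Test}
    (ht : t ∈ holeTests n) : t.Valid (salt (signs x (n + 1))) := by
  unfold holeTests at ht
  simp only [List.mem_flatMap, mem_between, List.mem_cons, List.mem_map] at ht
  obtain ⟨b, ⟨hb, hbn⟩, c, ⟨hbc, hcn⟩, rfl | ⟨d, ⟨hcd, hdn⟩, rfl⟩⟩ := ht
  · exact apexTest_valid h (by omega) hb hbc hcn (by omega)
  · unfold pentagonTree
    refine ⟨⟨⟨?_, ?_⟩, ⟨?_, ?_⟩⟩, ⟨⟨?_, ?_⟩, ⟨?_, ?_⟩⟩⟩ <;>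
      apply pentagonTest_valid h hn <;> omega

end SignSearch

/-! ### Assignments that come from points survive the search -/

namespace SignSearch

theorem signs_ext {r F : ℕ} (h : ∀ t, r.testBit t = true ↔ F.testBit t = true) : r = F :=
  Nat.eq_of_testBit_eq fun t => Bool.eq_iff_iff.2 (h t)

theorem noneHolds_posMasks {x : ℕ → Plane} {n : ℕ} (h : Good x (n + 1)) (hn : n < 9) {m : ℕ}
    (hm : 0 < m) (hmn : m < n) {r : ℕ} (hr : ∀ t, r.testBit t = true → IsBit x (n + 1) t) :
    noneHolds (salt r) (signStep n m).posMasks = true := by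
  have hpos : ∀ {i j k : ℕ}, i < j → j < k → k < n + 1 →
      r.testBit (code i j k) = true → 0 < orient (x i) (x j) (x k) :=
    fun h1 h2 h3 ht => (isBit_code (by omega) h1 h2 h3).1 (hr _ ht)
  have hneg : ∀ {i j k : ℕ}, i < j → j < k → k < n + 1 →
      r.testBit (code i j k + 32) = true → orient (x i) (x j) (x k) < 0 :=
    fun h1 h2 h3 ht => (isBit_code_add (by omega) h1 h2 h3).1 (hr _ ht)
  rw [noneHolds_eq_true]
  intro e he
  rw [← Bool.not_eq_true]
  intro hh
  simp only [signStep, List.mem_append, List.mem_map, List.mem_flatMap, mem_between, List.mem_cons,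
    List.not_mem_nil, or_false] at he
  rcases he with ⟨q, ⟨h1, h2⟩, rfl⟩ | ⟨j, ⟨h1, h2⟩, rfl | rfl | rfl⟩ <;>
    rw [holds_mask] at hh <;>
    simp only [List.mem_cons, List.not_mem_nil, or_false, forall_eq_or_imp, forall_eq] at hh <;>
    obtain ⟨b1, b2, b3⟩ := hh
  · exact (h.signotope hm h1 h2 (Nat.lt_succ_self n)).2.2.2.1
      ⟨hneg hm h1 (by omega) b1, hpos hm hmn (by omega) b2, hneg h1 h2 (by omega) b3⟩
  · exact (h.signotope h1 h2 hmn (Nat.lt_succ_self n)).2.2.2.2.2.1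
      ⟨hneg h1 h2 (by omega) b1, hpos hm hmn (by omega) b2, hneg h2 hmn (by omega) b3⟩
  · exact (h.signotope h1 h2 hmn (Nat.lt_succ_self n)).1
      ⟨hpos h1 h2 (by omega) b1, hneg h1 (by omega) (by omega) b2, hpos hm hmn (by omega) b3⟩
  · exact (h.signotope h1 h2 hmn (Nat.lt_succ_self n)).2.2.2.2.2.2.2
      ⟨hneg h1 (by omega) (by omega) b1, hpos hm hmn (by omega) b2, hneg h2 hmn (by omega) b3⟩

theorem noneHolds_negMasks {x : ℕ → Plane} {n : ℕ} (h : Good x (n + 1)) (hn : n < 9) {m : ℕ}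
    (hm : 0 < m) (hmn : m < n) {r : ℕ} (hr : ∀ t, r.testBit t = true → IsBit x (n + 1) t) :
    noneHolds (salt r) (signStep n m).negMasks = true := by
  have hpos : ∀ {i j k : ℕ}, i < j → j < k → k < n + 1 →
      r.testBit (code i j k) = true → 0 < orient (x i) (x j) (x k) :=
    fun h1 h2 h3 ht => (isBit_code (by omega) h1 h2 h3).1 (hr _ ht)
  have hneg : ∀ {i j k : ℕ}, i < j → j < k → k < n + 1 →
      r.testBit (code i j k + 32) = true → orient (x i) (x j) (x k) < 0 :=
    fun h1 h2 h3 ht => (isBit_code_add (by omega) h1 h2 h3).1 (hr _ ht)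
  rw [noneHolds_eq_true]
  intro e he
  rw [← Bool.not_eq_true]
  intro hh
  simp only [signStep, List.mem_append, List.mem_map, List.mem_flatMap, mem_between, List.mem_cons,
    List.not_mem_nil, or_false] at he
  rcases he with ⟨q, ⟨h1, h2⟩, rfl⟩ | ⟨j, ⟨h1, h2⟩, rfl | rfl | rfl⟩ <;>
    rw [holds_mask] at hh <;>
    simp only [List.mem_cons, List.not_mem_nil, or_false, forall_eq_or_imp, forall_eq] at hh <;>
    obtain ⟨b1, b2, b3⟩ := hh
  · exact (h.signotope hm h1 h2 (Nat.lt_succ_self n)).2.2.1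
      ⟨hpos hm h1 (by omega) b1, hneg hm hmn (by omega) b2, hpos h1 h2 (by omega) b3⟩
  · exact (h.signotope h1 h2 hmn (Nat.lt_succ_self n)).2.2.2.2.1
      ⟨hpos h1 h2 (by omega) b1, hneg hm hmn (by omega) b2, hpos h2 hmn (by omega) b3⟩
  · exact (h.signotope h1 h2 hmn (Nat.lt_succ_self n)).2.1
      ⟨hneg h1 h2 (by omega) b1, hpos h1 (by omega) (by omega) b2, hneg hm hmn (by omega) b3⟩
  · exact (h.signotope h1 h2 hmn (Nat.lt_succ_self n)).2.2.2.2.2.2.1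
      ⟨hpos h1 (by omega) (by omega) b1, hneg hm hmn (by omega) b2, hpos h2 hmn (by omega) b3⟩

/-- Induction with the invariant that exactly the triples `0 j n` with `j ≥ m` are undecided in `r`;
each step takes the actual sign, which no mask rejects. -/
theorem reaches_of_range {x : ℕ → Plane} {n : ℕ} (h : Good x (n + 1)) (hn : n < 9) (m d : ℕ)
    (hm : 0 < m) (hmd : m + d = n) (r : ℕ)
    (hr : ∀ t, r.testBit t = true ↔ ∃ i j k, i < j ∧ j < k ∧ k < n + 1 ∧ (i = 0 → k = n → j < m) ∧
      ((t = code i j k ∧ 0 < orient (x i) (x j) (x k)) ∨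
        (t = code i j k + 32 ∧ orient (x i) (x j) (x k) < 0))) :
    Reaches (signs x (n + 1)) ((List.range' m d).map (signStep n)) r := by
  induction d generalizing m r with
  | zero =>
    have : r = signs x (n + 1) := by
      refine signs_ext fun t => ?_
      rw [hr, testBit_signs (by omega)]
      constructor
      · rintro ⟨i, j, k, h1, h2, h3, -, h4⟩
        exact ⟨i, j, k, h1, h2, h3, h4⟩
      · rintro ⟨i, j, k, h1, h2, h3, h4⟩
        exact ⟨i, j, k, h1, h2, h3, fun _ _ => by omega, h4⟩
    rw [this, List.range'_zero, List.map_nil]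
    exact Reaches.nil
  | succ d ih =>
    rw [List.range'_succ, List.map_cons]
    have hF : ∀ t, r.testBit t = true → IsBit x (n + 1) t := by
      intro t ht
      obtain ⟨i, j, k, h1, h2, h3, -, h4⟩ := (hr t).1 ht
      exact ⟨i, j, k, h1, h2, h3, h4⟩
    rcases (h.ne_zero 0 m n hm (by omega) (by omega)).lt_or_gt with hs | hs
    · refine Reaches.neg (noneHolds_negMasks h hn hm (by omega) fun t ht => ?_)
        (ih (m + 1) (by omega) (by omega) _ fun t => ?_)
      · simp only [signStep, Nat.testBit_or, Bool.or_eq_true, Nat.testBit_two_pow,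
          decide_eq_true_eq] at ht
        rcases ht with ht | rfl
        · exact hF t ht
        · exact ⟨0, m, n, hm, by omega, by omega, Or.inr ⟨rfl, hs⟩⟩
      · simp only [signStep]
        rw [Nat.testBit_or, Bool.or_eq_true, hr, Nat.testBit_two_pow, decide_eq_true_eq]
        constructor
        · rintro (⟨i, j, k, h1, h2, h3, h4, h5⟩ | rfl)
          · exact ⟨i, j, k, h1, h2, h3, fun a b => (h4 a b).trans (by omega), h5⟩
          · exact ⟨0, m, n, hm, by omega, by omega, fun _ _ => by omega, Or.inr ⟨rfl, hs⟩⟩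
        · rintro ⟨i, j, k, h1, h2, h3, h4, h5⟩
          by_cases hc : i = 0 ∧ k = n ∧ j = m
          · obtain ⟨rfl, rfl, rfl⟩ := hc
            rcases h5 with h5 | h5
            · exact absurd h5.2 hs.not_gt
            · exact Or.inr h5.1.symm
          · exact Or.inl ⟨i, j, k, h1, h2, h3, fun a b => by have := h4 a b; omega, h5⟩
    · refine Reaches.pos (noneHolds_posMasks h hn hm (by omega) fun t ht => ?_)
        (ih (m + 1) (by omega) (by omega) _ fun t => ?_)
      · simp only [signStep, Nat.testBit_or, Bool.or_eq_true, Nat.testBit_two_pow,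
          decide_eq_true_eq] at ht
        rcases ht with ht | rfl
        · exact hF t ht
        · exact ⟨0, m, n, hm, by omega, by omega, Or.inl ⟨rfl, hs⟩⟩
      · simp only [signStep]
        rw [Nat.testBit_or, Bool.or_eq_true, hr, Nat.testBit_two_pow, decide_eq_true_eq]
        constructor
        · rintro (⟨i, j, k, h1, h2, h3, h4, h5⟩ | rfl)
          · exact ⟨i, j, k, h1, h2, h3, fun a b => (h4 a b).trans (by omega), h5⟩
          · exact ⟨0, m, n, hm, by omega, by omega, fun _ _ => by omega, Or.inl ⟨rfl, hs⟩⟩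
        · rintro ⟨i, j, k, h1, h2, h3, h4, h5⟩
          by_cases hc : i = 0 ∧ k = n ∧ j = m
          · obtain ⟨rfl, rfl, rfl⟩ := hc
            rcases h5 with h5 | h5
            · exact Or.inr h5.1.symm
            · exact absurd h5.2 hs.not_gt
          · exact Or.inl ⟨i, j, k, h1, h2, h3, fun a b => by have := h4 a b; omega, h5⟩

/-- A triple that is not of the form `0 j n` avoids `n` or avoids `0`, so its sign is known from the
first `n` or from the last `n` points. -/
theorem reaches_signs {x : ℕ → Plane} {n : ℕ} (h : Good x (n + 1)) (hn0 : 0 < n) (hn : n < 9) :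
    Reaches (signs x (n + 1)) (signSteps n)
      (signs x n ||| signs (fun i => x (i + 1)) n <<< 64) := by
  refine reaches_of_range h hn 1 (n - 0 - 1) one_pos (by omega) _ fun t => ?_
  rw [Nat.testBit_or, Bool.or_eq_true, testBit_signs hn.le, Nat.testBit_shiftLeft,
    Bool.and_eq_true, testBit_signs hn.le, decide_eq_true_eq]
  constructor
  · rintro (⟨i, j, k, h1, h2, h3, h4⟩ | ⟨ht, i, j, k, h1, h2, h3, h4⟩)
    · exact ⟨i, j, k, h1, h2, by omega, fun _ _ => by omega, h4⟩
    · refine ⟨i + 1, j + 1, k + 1, by omega, by omega, by omega, fun h => by omega, ?_⟩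
      rw [code_shift]
      refine h4.imp (fun h5 => ⟨by omega, h5.2⟩) fun h5 => ⟨by omega, h5.2⟩
  · rintro ⟨i, j, k, h1, h2, h3, h4, h5⟩
    by_cases hk : k < n
    · exact Or.inl ⟨i, j, k, h1, h2, hk, h5⟩
    · have hi : i ≠ 0 := fun hi => by have := h4 hi (by omega); omega
      obtain ⟨i, rfl⟩ := Nat.exists_eq_succ_of_ne_zero hi
      obtain ⟨j, rfl⟩ := Nat.exists_eq_succ_of_ne_zero (by omega : j ≠ 0)
      obtain ⟨k, rfl⟩ := Nat.exists_eq_succ_of_ne_zero (by omega : k ≠ 0)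
      simp only [Nat.succ_eq_add_one] at *
      rw [code_shift] at h5
      refine Or.inr ⟨by omega, i, j, k, by omega, by omega, by omega, ?_⟩
      refine h5.imp (fun h5 => ⟨by omega, h5.2⟩) fun h5 => ⟨by omega, h5.2⟩

theorem key_eq {x : ℕ → Plane} {n : ℕ} (hn : n < 9) :
    salt ((salt (signs x n) >>> 80) &&& fullMask (n - 1)) =
      salt (signs (fun i => x (i + 1)) (n - 1)) := by
  refine congrArg salt ?_
  rw [show 80 = 16 + 64 from rfl, Nat.shiftRight_add, salt_shiftRight]
  refine signs_ext fun t => ?_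
  rw [Nat.testBit_and, Bool.and_eq_true, Nat.testBit_shiftRight, testBit_signs hn.le,
    testBit_signs (by omega), fullMask, testBit_rawMask]
  simp only [List.mem_flatMap, mem_between, List.mem_range, List.mem_cons, List.not_mem_nil,
    or_false]
  constructor
  · rintro ⟨h1, k, ⟨h2, h3⟩, j, ⟨h4, h5⟩, i, h6, rfl | rfl⟩
    · rw [add_comm, ← code_shift, isBit_code hn.le (by omega) (by omega) (by omega)] at h1
      exact ⟨i, j, k, h6, h5, h3, Or.inl ⟨rfl, h1⟩⟩
    · rw [add_comm, add_right_comm, ← code_shift,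
        isBit_code_add hn.le (by omega) (by omega) (by omega)] at h1
      exact ⟨i, j, k, h6, h5, h3, Or.inr ⟨rfl, h1⟩⟩
  · rintro ⟨i, j, k, h1, h2, h3, ⟨rfl, h4⟩ | ⟨rfl, h4⟩⟩
    · refine ⟨?_, k, ⟨by omega, h3⟩, j, ⟨by omega, h2⟩, i, h1, Or.inl rfl⟩
      rw [add_comm, ← code_shift, isBit_code hn.le (by omega) (by omega) (by omega)]
      exact h4
    · refine ⟨?_, k, ⟨by omega, h3⟩, j, ⟨by omega, h2⟩, i, h1, Or.inr rfl⟩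
      rw [add_comm, add_right_comm, ← code_shift,
        isBit_code_add hn.le (by omega) (by omega) (by omega)]
      exact h4

/-- The table contains the signs of all good sequences of `n` points. -/
def Complete (n : ℕ) (T : List Group) : Prop :=
  ∀ x : ℕ → Plane, Good x n → ∃ g ∈ T, g.1 = salt (signs x (n - 1)) ∧ salt (signs x n) ∈ g.2

/-- The first `n` and the last `n` points of a good sequence are good, hence both are in the table,
and the key makes them meet. -/
theorem Complete.next {n : ℕ} {T : List Group} (h : Complete n T) (hn0 : 0 < n) (hn : n < 9) :
    Complete (n + 1) (nextAll (holeTests n) (signSteps n) (fullMask (n - 1)) T T) := by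
  intro x hx
  obtain ⟨g, hg, -, hg'⟩ := h x (hx.mono (Nat.le_succ n))
  refine ⟨_, mem_nextAll hg hg', rfl, ?_⟩
  rw [key_eq hn]
  obtain ⟨g', hg1, hg2, hg3⟩ := h _ hx.shift
  rw [← hg2]
  exact mem_extendBy (B := signs (fun i => x (i + 1)) n) (l := g'.2) hg1 hg3
    (reaches_signs hx hn0 hn) (allOk_eq_true fun t ht => holeTests_valid hx hn ht)

theorem signs_eq_zero (x : ℕ → Plane) {n : ℕ} (hn : n ≤ 2) : signs x n = 0 := by
  refine signs_ext fun t => ?_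
  rw [testBit_signs (by omega)]
  simp only [Nat.zero_testBit, Bool.false_eq_true, iff_false]
  rintro ⟨i, j, k, h1, h2, h3, -⟩
  omega

theorem complete_two : Complete 2 [(0, [0])] := by
  intro x _
  refine ⟨_, List.mem_cons_self, ?_, ?_⟩
  · rw [signs_eq_zero x (by norm_num)]; rfl
  · rw [signs_eq_zero x le_rfl]; exact List.mem_cons_self

theorem not_good_nine (x : ℕ → Plane) : ¬ Good x 9 := by
  intro hx
  have h := search_eq_true
  simp only [search, nextLevel, forceTests_eq, forceSteps_eq, forceNat_eq, forceGroups_eq] at h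
  have hT := ((((((complete_two.next (by norm_num) (by norm_num)).next (by norm_num)
    (by norm_num)).next (by norm_num) (by norm_num)).next (by norm_num) (by norm_num)).next
    (by norm_num) (by norm_num)).next (by norm_num) (by norm_num)).next (by norm_num) (by norm_num)
  obtain ⟨g, hg, -, hg'⟩ := hT x hx
  rw [eq_nil_of_noneLeft h hg] at hg'
  exact List.not_mem_nil hg'

end SignSearch

/-! ### Harborth's theorem for ten points -/

/-- **Harborth's theorem**: nine points sorted by angle in a half-plane about a tenth point contain,
together with the tenth point, an empty convex pentagon. -/
theorem exists_hole5_of_sorted {p : Plane} {x : ℕ → Plane} {S : Finset Plane}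
    (hS : ∀ z, z ∈ S ↔ z = p ∨ ∃ i < 9, z = x i)
    (hx : ∀ i j k, i < j → j < k → k < 9 → orient (x i) (x j) (x k) ≠ 0)
    (hp : ∀ i j, i < j → j < 9 → 0 < orient p (x i) (x j)) :
    (∃ i j k l, i < j ∧ j < k ∧ k < l ∧ l < 9 ∧ Hole5 S p (x i) (x j) (x k) (x l)) ∨
    (∃ i j k l m, i < 9 ∧ j < 9 ∧ k < 9 ∧ l < 9 ∧ m < 9 ∧
      Hole5 S (x i) (x j) (x k) (x l) (x m)) := by
  by_contra hcon
  push Not at hcon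
  obtain ⟨hc1, hc2⟩ := hcon
  have hmem : ∀ i < 9, x i ∈ S := fun i hi => (hS _).2 (Or.inr ⟨i, hi, rfl⟩)
  refine SignSearch.not_good_nine x ⟨hx, ⟨p, hp⟩, ?_, ?_⟩
  · intro a b c d hab hbc hcd hd h1 h2
    by_contra hno
    push Not at hno
    obtain ⟨n1, n2, n3⟩ := hno
    have pab := hp a b hab (by omega)
    have pac := hp a c (by omega) (by omega)
    have pad := hp a d (by omega) (by omega)
    have pbc := hp b c (by omega) (by omega)
    have pbd := hp b d (by omega) (by omega)
    have pcd := hp c d (by omega) (by omega)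
    have gb := orient_gp (x b) (x a) (x c) p (x d)
    have gc := orient_gp (x c) (x a) (x b) p (x d)
    -- By a Grassmann–Plücker relation with the apex, left turns at `b` and `c` make the remaining
    -- triples of `a b c d` left turns as well.
    have e1 : 0 < orient (x a) (x b) (x d) := by
      have ga : orient p (x a) (x b) * orient (x b) (x c) (x d)
        - orient p (x b) (x c) * orient (x a) (x b) (x d) +
        orient p (x b) (x d) * orient (x a) (x b) (x c) = 0 := by unfold orient; ring
      by_contra hneg
      nlinarith [mul_pos pab h2, mul_pos pbd h1, mul_nonneg pbc.le (neg_nonneg.2 (not_lt.1 hneg))]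
    have e2 : 0 < orient (x a) (x c) (x d) := by
      have ga : orient p (x a) (x c) * orient (x b) (x c) (x d)
        - orient p (x b) (x c) * orient (x a) (x c) (x d) +
        orient p (x c) (x d) * orient (x a) (x b) (x c) = 0 := by unfold orient; ring
      by_contra hneg
      nlinarith [mul_pos pac h2, mul_pos pcd h1, mul_nonneg pbc.le (neg_nonneg.2 (not_lt.1 hneg))]
    refine hc1 a b c d hab hbc hcd hd ⟨(hS p).2 (Or.inl rfl), hmem a (by omega), hmem b (by omega),
      hmem c (by omega), hmem d hd, pab, pac, pad, pbc, pbd, pcd, h1, e1, e2, h2, ?_⟩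
    intro z hz z1 z2 z3 z4 z5
    rcases (hS z).1 hz with rfl | ⟨q, hq, rfl⟩
    · simp at z1
    have haq : a < q := by
      by_contra h
      rcases (not_lt.1 h).lt_or_eq with h | rfl
      · have := hp q a h (by omega)
        rw [orient_swap'] at this
        linarith
      · simp at z1
    have hqd : q < d := by
      by_contra h
      rcases (not_lt.1 h).lt_or_eq with h | rfl
      · have := hp d q h hq
        rw [orient_swap] at this
        linarith
      · simp at z5
    rw [orient_swap'] at z2 z3 z4
    rcases lt_trichotomy q b with h | rfl | h
    · exact absurd (n1 q haq h) (by linarith)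
    · simp at z2
    rcases lt_trichotomy q c with h' | rfl | h'
    · exact absurd (n2 q h h') (by linarith)
    · simp at z3
    exact absurd (n3 q h' hqd) (by linarith)
  · intro l h a b c d e hh la lb lc ld le' ha hb hc hd he k1 k2 k3 k4 k5 k6 k7 k8 k9 k10
    by_contra hno
    push Not at hno
    refine hc2 a b c d e (by omega) (by omega) (by omega) (by omega) (by omega)
      ⟨hmem a (by omega), hmem b (by omega), hmem c (by omega), hmem d (by omega),
      hmem e (by omega), k1, k2, k3, k4, k5, k6, k7, k8, k9, k10, ?_⟩
    intro z hz z1 z2 z3 z4 z5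
    -- If the apex were inside the pentagon, the indices would increase along the whole cycle `a b c
    -- d e a`.
    have mono : ∀ i j, i < 9 → j < 9 → 0 < orient p (x i) (x j) → i < j := by
      intro i j hi hj hij
      by_contra hle
      rcases (not_lt.1 hle).lt_or_eq with h' | rfl
      · have := hp j i h' hi
        rw [orient_swap'] at this
        linarith
      · simp at hij
    rcases (hS z).1 hz with rfl | ⟨q, hq, rfl⟩
    · have := mono a b (by omega) (by omega) (by rwa [orient_rot])
      have := mono b c (by omega) (by omega) (by rwa [orient_rot])
      have := mono c d (by omega) (by omega) (by rwa [orient_rot])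
      have := mono d e (by omega) (by omega) (by rwa [orient_rot])
      have := mono e a (by omega) (by omega) (by rwa [orient_rot])
      omega
    have qa : q ≠ a := by rintro rfl; simp at z1
    have qb : q ≠ b := by rintro rfl; simp at z1
    have qc : q ≠ c := by rintro rfl; simp at z2
    have qd : q ≠ d := by rintro rfl; simp at z3
    have qe : q ≠ e := by rintro rfl; simp at z4
    -- A point with index outside the range of the pentagon sees all vertices on one side of its
    -- line to the apex, so it is not inside.
    by_cases hlq : l < q
    · by_cases hqh : q < h
      · exact absurd z5 (not_lt.2 (hno q hlq hqh z1 z2 z3 z4))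
      · have hv : ∀ i, i ≤ h → q ≠ i → 0 < orient (x q) p (x i) := fun i hi hne => by
          rw [orient_rot]
          exact hp i q (by omega) hq
        exact not_all_left (hv a ha qa) (hv b hb qb) (hv c hc qc) (hv d hd qd) (hv e he qe)
          z1 z2 z3 z4 z5
    · have hv : ∀ i, l ≤ i → i ≤ h → q ≠ i → 0 < orient p (x q) (x i) := fun i hi hi' hne =>
        hp q i (by omega) (by omega)
      have ha' := hv a la ha qa
      have hb' := hv b lb hb qb
      have hc' := hv c lc hc qc
      have hd' := hv d ld hd qd
      have he' := hv e le' he qe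
      rw [← orient_rot] at ha' hb' hc' hd' he'
      have tr : ∀ {u v w : Plane}, 0 < orient u p (x q) → 0 < orient v p (x q) →
          0 < orient w p (x q) → 0 < orient u v (x q) → 0 < orient v w (x q) →
          0 < orient u w (x q) := by
        intro u v w hu hv hw h1 h2
        have g : orient u p (x q) * orient v w (x q) - orient v p (x q) * orient u w (x q) +
          orient w p (x q) * orient u v (x q) = 0 := by unfold orient; ring
        by_contra hneg
        nlinarith [mul_pos hu h2, mul_pos hw h1, mul_nonneg hv.le (neg_nonneg.2 (not_lt.1 hneg))]
      have t1 := tr ha' hb' hc' z1 z2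
      have t2 := tr ha' hc' hd' t1 z3
      have t3 := tr ha' hd' he' t2 z4
      have t4 := orient_swap (x e) (x a) (x q)
      linarith

/-! ### Pairs seen from a point, and windows of ten points -/

/-- Transitivity of the angular order about `p`, with a reference point that comes last. -/
theorem orient_trans' {p w a b c : Plane} (ha : 0 < orient p a w) (hb : 0 < orient p b w)
    (hc : 0 < orient p c w) (hab : 0 < orient p a b) (hbc : 0 < orient p b c) :
    0 < orient p a c := by
  have h := orient_gp p w a b c
  have h1 := orient_swap' p w a
  have h2 := orient_swap' p w b
  have h3 := orient_swap' p w c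
  by_contra hcon
  nlinarith [mul_pos ha hbc, mul_pos hc hab, mul_nonneg hb.le (not_lt.1 hcon |> neg_nonneg.2)]

theorem orient_nonneg_of_triangle {a b c z u v : Plane} (h : 0 < orient a b c)
    (h1 : 0 ≤ orient z b c) (h2 : 0 ≤ orient a z c) (h3 : 0 ≤ orient a b z)
    (ha : 0 ≤ orient u v a) (hb : 0 ≤ orient u v b) (hc : 0 ≤ orient u v c) :
    0 ≤ orient u v z := by
  have hbary := orient_bary a b c z u v
  rw [orient_rot] at ha hb hc ⊢
  rw [orient_rot] at ha hb hc ⊢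
  by_contra hcon
  nlinarith [mul_nonneg h1 ha, mul_nonneg h2 hb, mul_nonneg h3 hc,
    mul_pos h (neg_pos.2 (not_le.1 hcon))]

/-- A point inside a convex pentagon is on the same side of a line as all vertices. -/
theorem orient_nonneg_of_pentagon {a b c d e z u v : Plane} (habc : 0 < orient a b c)
    (hacd : 0 < orient a c d) (hade : 0 < orient a d e)
    (h1 : 0 < orient a b z) (h2 : 0 < orient b c z) (h3 : 0 < orient c d z)
    (h4 : 0 < orient d e z) (h5 : 0 < orient e a z)
    (ha : 0 ≤ orient u v a) (hb : 0 ≤ orient u v b) (hc : 0 ≤ orient u v c)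
    (hd : 0 ≤ orient u v d) (he : 0 ≤ orient u v e) : 0 ≤ orient u v z := by
  have e1 := orient_rot z b c
  have e2 := orient_swap' a z c
  have e3 := orient_rot z c d
  have e4 := orient_swap' a z d
  have e5 := orient_rot z d e
  have e6 : orient a z e = orient e a z := orient_rot _ _ _ |>.trans (orient_rot _ _ _)
  by_cases hac : orient a c z ≤ 0
  · exact orient_nonneg_of_triangle habc (by linarith) (by linarith) h1.le ha hb hc
  by_cases had : orient a d z ≤ 0
  · exact orient_nonneg_of_triangle hacd (by linarith) (by linarith) (by linarith) ha hc hd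
  · exact orient_nonneg_of_triangle hade (by linarith) (by linarith) (by linarith) ha hd he

/-- Two points are vertices of a common 5-hole. -/
def InHole (S : Finset Plane) (a b : Plane) : Prop := a ≠ b ∧ ∃ H ∈ holes 5 S, a ∈ H ∧ b ∈ H

theorem mem_holes_iff {k : ℕ} {S H : Finset Plane} : H ∈ holes k S ↔ H ⊆ S ∧ IsHole k S H := by
  simp only [holes, Finset.mem_filter, Finset.mem_powerset]

theorem subset_of_mem_holes {S H : Finset Plane} (h : H ∈ holes 5 S) : H ⊆ S :=
  (mem_holes_iff.1 h).1

theorem card_of_mem_holes {S H : Finset Plane} (h : H ∈ holes 5 S) : H.card = 5 :=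
  (mem_holes_iff.1 h).2.card_eq

theorem InHole.mem_right {S : Finset Plane} {a b : Plane} (h : InHole S a b) : b ∈ S := by
  obtain ⟨_, H, hH, _, hb⟩ := h
  exact subset_of_mem_holes hH hb

/-- The point `r` sees the pair `a b` of a common 5-hole at the left: the triangle `r a b` is empty
and `b` is the first point, in counterclockwise order about `r`, that shares a 5-hole with `a`. -/
structure Viewer (S : Finset Plane) (r a b : Plane) : Prop where
  mr : r ∈ S
  ma : a ∈ S
  hole : InHole S a b
  pos : 0 < orient r a b
  empty : ∀ z ∈ S, 0 < orient r a z → 0 < orient a b z → 0 < orient b r z → False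
  first : ∀ c ∈ S, InHole S a c → 0 < orient r a c → 0 < orient r c b → False

/-- Applied to the indices of a 5-hole in a run of nine points, when neighbours never share a
5-hole. -/
theorem eq_of_sparse : ∀ I ∈ (Finset.range 9).powerset, I.card = 5 →
    (∀ i ∈ I, i + 1 ∉ I) → I = {0, 2, 4, 6, 8} := by decide +kernel

section Window

variable {S : Finset Plane} {r : Plane} {x : ℕ → Plane}

/-- The points `x 0, …, x 9` of `S` are consecutive in the counterclockwise order about `r`. -/
structure Window (S : Finset Plane) (r : Plane) (x : ℕ → Plane) : Prop where
  mr : r ∈ S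
  mx : ∀ i < 10, x i ∈ S
  pos : ∀ i j, i < j → j < 10 → 0 < orient r (x i) (x j)
  cone : ∀ z ∈ S, 0 < orient r (x 0) z → 0 < orient r z (x 9) → ∃ i < 10, z = x i

theorem Window.lt (w : Window S r x) {i j : ℕ} (hi : i < 10) (h : 0 < orient r (x i) (x j)) :
    i < j := by
  by_contra hle
  rcases (not_lt.1 hle).lt_or_eq with h' | rfl
  · have := w.pos j i h' hi
    rw [orient_swap'] at this
    linarith
  · simp at h

theorem Window.between (w : Window S r x) {i j : ℕ} (hj : j < 10) (hij : i < j) {z : Plane}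
    (hz : z ∈ S) (h1 : 0 < orient r (x i) z) (h2 : 0 < orient r z (x j)) :
    ∃ k, i < k ∧ k < j ∧ z = x k := by
  have h3 : 0 < orient r (x 0) z := by
    rcases Nat.eq_zero_or_pos i with rfl | hi
    · exact h1
    · exact orient_trans' (w.pos 0 j (by omega) hj) (w.pos i j hij hj) h2
        (w.pos 0 i hi (by omega)) h1
  have h4 : 0 < orient r z (x 9) := by
    rcases (by omega : j = 9 ∨ j < 9) with rfl | hj'
    · exact h2
    · exact orient_trans h3 (w.pos 0 j (by omega) hj) (w.pos 0 9 (by omega) (by omega)) h2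
        (w.pos j 9 hj' (by omega))
  obtain ⟨k, hk, rfl⟩ := w.cone z hz h3 h4
  exact ⟨k, w.lt (by omega) h1, w.lt hk h2, rfl⟩

theorem Window.injOn (w : Window S r x) {i j : ℕ} (hi : i < 10) (hj : j < 10) (h : x i = x j) :
    i = j := by
  rcases lt_trichotomy i j with h1 | h1 | h1
  · have := w.pos i j h1 hj; rw [h] at this; simp at this
  · exact h1
  · have := w.pos j i h1 hi; rw [h] at this; simp at this

/-- The open angle between neighbours contains no point of `S`, so nothing can lie in the triangle
or come before `x (i + 1)`. -/
theorem Window.viewer_succ (w : Window S r x) {i : ℕ} (hi : i + 1 < 10)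
    (h : InHole S (x i) (x (i + 1))) : Viewer S r (x i) (x (i + 1)) where
  mr := w.mr
  ma := w.mx i (by omega)
  hole := h
  pos := w.pos i (i + 1) (by omega) hi
  empty z hz h1 _ h3 := by
    rw [orient_rot] at h3
    obtain ⟨k, h4, h5, -⟩ := w.between hi (by omega) hz h1 h3
    omega
  first c hc _ h1 h2 := by
    obtain ⟨k, h4, h5, -⟩ := w.between hi (by omega) hc h1 h2
    omega

/-- Only `x (i + 1)` is in the angle; `h1` keeps it out of the triangle and `h0` keeps it from being
an earlier partner of `x i`. -/
theorem Window.viewer_succ_succ (w : Window S r x) {i : ℕ} (hi : i + 2 < 10)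
    (h : InHole S (x i) (x (i + 2))) (h0 : ¬ InHole S (x i) (x (i + 1)))
    (h1 : ¬ 0 < orient (x i) (x (i + 2)) (x (i + 1))) : Viewer S r (x i) (x (i + 2)) where
  mr := w.mr
  ma := w.mx i (by omega)
  hole := h
  pos := w.pos i (i + 2) (by omega) hi
  empty z hz h2 h3 h4 := by
    rw [orient_rot] at h4
    obtain ⟨k, h5, h6, rfl⟩ := w.between hi (by omega) hz h2 h4
    obtain rfl : k = i + 1 := by omega
    exact h1 h3
  first c hc hac h2 h3 := by
    obtain ⟨k, h5, h6, rfl⟩ := w.between hi (by omega) hc h2 h3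
    obtain rfl : k = i + 1 := by omega
    exact h0 hac

/-- The pentagon stays in the angle at `r` from `x s` to `x t`, where `S` has no points but those of
the window. Thus emptiness within the window is emptiness in `S`. -/
theorem Window.mem_of_pentagon (w : Window S r x) {s t : ℕ} (hst : s < t) (ht : t < 10)
    (hgp : GenPos S) {a b c d e z : Plane} (hz : z ∈ S)
    (hv : ∀ y, y = a ∨ y = b ∨ y = c ∨ y = d ∨ y = e → y = r ∨ ∃ i, s ≤ i ∧ i ≤ t ∧ y = x i)
    (habc : 0 < orient a b c) (hacd : 0 < orient a c d) (hade : 0 < orient a d e)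
    (h1 : 0 < orient a b z) (h2 : 0 < orient b c z) (h3 : 0 < orient c d z)
    (h4 : 0 < orient d e z) (h5 : 0 < orient e a z) :
    z = r ∨ ∃ i, s ≤ i ∧ i ≤ t ∧ z = x i := by
  have hs : ∀ y, y = a ∨ y = b ∨ y = c ∨ y = d ∨ y = e → 0 ≤ orient r (x s) y := by
    intro y hy
    rcases hv y hy with rfl | ⟨i, h1, h2, rfl⟩
    · simp
    · rcases h1.eq_or_lt with rfl | h1
      · simp
      · exact (w.pos s i h1 (by omega)).le
  have ht' : ∀ y, y = a ∨ y = b ∨ y = c ∨ y = d ∨ y = e → 0 ≤ orient (x t) r y := by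
    intro y hy
    rcases hv y hy with rfl | ⟨i, h1, h2, rfl⟩
    · simp
    · rcases h2.eq_or_lt with rfl | h2
      · simp
      · rw [orient_rot]; exact (w.pos i t h2 (by omega)).le
  have k1 := orient_nonneg_of_pentagon habc hacd hade h1 h2 h3 h4 h5 (hs a (by simp))
    (hs b (by simp)) (hs c (by simp)) (hs d (by simp)) (hs e (by simp))
  have k2 := orient_nonneg_of_pentagon habc hacd hade h1 h2 h3 h4 h5 (ht' a (by simp))
    (ht' b (by simp)) (ht' c (by simp)) (ht' d (by simp)) (ht' e (by simp))
  by_cases hzr : z = r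
  · exact Or.inl hzr
  by_cases hzs : z = x s
  · exact Or.inr ⟨s, le_rfl, hst.le, hzs⟩
  by_cases hzt : z = x t
  · exact Or.inr ⟨t, hst.le, le_rfl, hzt⟩
  have hrs : r ≠ x s := by
    rintro h
    have := w.pos s t hst ht
    rw [h] at this; simp at this
  have hrt : x t ≠ r := by
    rintro h
    have := w.pos s t hst ht
    rw [h] at this; simp at this
  have k1' := k1.lt_of_ne' (hgp r w.mr _ (w.mx s (by omega)) z hz hrs (Ne.symm hzr) (Ne.symm hzs))
  have k2' := k2.lt_of_ne' (hgp _ (w.mx t ht) r w.mr z hz hrt (Ne.symm hzt) (Ne.symm hzr))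
  rw [orient_rot] at k2'
  obtain ⟨k, h6, h7, rfl⟩ := w.between ht hst hz k1' k2'
  exact Or.inr ⟨k, h6.le, h7.le, rfl⟩

-- Harborth's theorem for `r` and the nine points from `x s` on. Both runs of nine in the window, `s
-- = 0` and `s = 1`, are used later.
open Classical in
theorem Window.exists_hole5 (w : Window S r x) (hgp : GenPos S) {s : ℕ} (hs : s ≤ 1) :
    (∃ i j k l, s ≤ i ∧ i < j ∧ j < k ∧ k < l ∧ l ≤ s + 8 ∧
      Hole5 S r (x i) (x j) (x k) (x l)) ∨
    (∃ I : Finset ℕ, I ⊆ Finset.range 9 ∧ I.card = 5 ∧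
      ∃ H ∈ holes 5 S, ∀ i ∈ I, x (s + i) ∈ H) := by
  have hne : ∀ i < 10, r ≠ x i := by
    intro i hi h
    rcases (by omega : 0 < i ∨ i < 9) with h1 | h1
    · have := w.pos 0 i h1 hi; rw [h] at this; simp at this
    · have := w.pos i 9 h1 (by omega); rw [h] at this; simp at this
  have hmem : ∀ z, z ∈ insert r ((Finset.range 9).image fun i => x (s + i)) ↔
      z = r ∨ ∃ i < 9, z = x (s + i) := by
    intro z
    simp only [Finset.mem_insert, Finset.mem_image, Finset.mem_range]
    refine or_congr Iff.rfl (exists_congr fun i => and_congr Iff.rfl eq_comm)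
  have hsub : ∀ {a b c d e : Plane},
      Hole5 (insert r ((Finset.range 9).image fun i => x (s + i))) a b c d e →
      Hole5 S a b c d e := by
    intro a b c d e h
    have hW : ∀ z ∈ insert r ((Finset.range 9).image fun i => x (s + i)), z ∈ S := by
      intro z hz
      rcases (hmem z).1 hz with rfl | ⟨i, hi, rfl⟩
      · exact w.mr
      · exact w.mx _ (by omega)
    refine ⟨hW _ h.ma, hW _ h.mb, hW _ h.mc, hW _ h.md, hW _ h.me, h.abc, h.abd, h.abe, h.acd,
      h.ace, h.ade, h.bcd, h.bce, h.bde, h.cde, ?_⟩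
    intro z hz h1 h2 h3 h4 h5
    refine h.empty z ((hmem z).2 ?_) h1 h2 h3 h4 h5
    have := w.mem_of_pentagon (s := s) (t := s + 8) (by omega) (by omega) hgp hz ?_ h.abc h.acd
      h.ade h1 h2 h3 h4 h5
    · refine this.imp id ?_
      rintro ⟨i, h6, h7, rfl⟩
      exact ⟨i - s, by omega, by rw [Nat.add_sub_cancel' h6]⟩
    · intro y hy
      have hy' : y ∈ insert r ((Finset.range 9).image fun i => x (s + i)) := by
        rcases hy with rfl | rfl | rfl | rfl | rfl
        exacts [h.ma, h.mb, h.mc, h.md, h.me]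
      refine ((hmem y).1 hy').imp id ?_
      rintro ⟨i, h6, rfl⟩
      exact ⟨s + i, by omega, by omega, rfl⟩
  rcases exists_hole5_of_sorted (p := r) (x := fun i => x (s + i)) hmem
    (fun i j k hij hjk hk => hgp _ (w.mx _ (by omega)) _ (w.mx _ (by omega)) _ (w.mx _ (by omega))
      (fun h => by have := w.injOn (by omega) (by omega) h; omega)
      (fun h => by have := w.injOn (by omega) (by omega) h; omega)
      (fun h => by have := w.injOn (by omega) (by omega) h; omega))
    (fun i j hij hj => w.pos _ _ (by omega) (by omega)) with
    ⟨i, j, k, l, hij, hjk, hkl, hl, h⟩ | ⟨i, j, k, l, m, hi, hj, hk, hl, hm, h⟩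
  · exact Or.inl ⟨s + i, s + j, s + k, s + l, by omega, by omega, by omega, by omega, by omega,
      hsub h⟩
  · refine Or.inr ⟨{i, j, k, l, m}, ?_, ?_, _, (hsub h).mem_holes, ?_⟩
    · intro t ht
      simp only [Finset.mem_insert, Finset.mem_singleton] at ht
      simp only [Finset.mem_range]
      omega
    · have h1 := ne_of_orient_pos h.abc
      have h2 := ne_of_orient_pos h.ade
      have h3 := ne_of_orient_pos h.bcd
      have h4 := ne_of_orient_pos h.bde
      have h5 := ne_of_orient_pos h.cde
      have hn : ∀ {i j : ℕ}, x (s + i) ≠ x (s + j) → i ≠ j := fun h e => h (by rw [e])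
      rw [Finset.card_insert_of_notMem, Finset.card_insert_of_notMem,
        Finset.card_insert_of_notMem, Finset.card_insert_of_notMem, Finset.card_singleton] <;>
      simp [hn h1.1, hn h1.2.1, hn h2.1, hn h2.2.1, hn h3.1, hn h3.2.1, hn h4.2.1, hn h5.1,
        hn h5.2.1, hn h5.2.2]
    · intro t ht
      simp only [Finset.mem_insert, Finset.mem_singleton] at ht ⊢
      rcases ht with rfl | rfl | rfl | rfl | rfl <;> simp

/-- Reversed cups of five points are convex. -/
theorem Window.hole5_of_cup (w : Window S r x) (hgp : GenPos S)
    (h1 : orient (x 0) (x 1) (x 2) < 0) (h2 : orient (x 1) (x 2) (x 3) < 0)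
    (h3 : orient (x 2) (x 3) (x 4) < 0) : Hole5 S (x 4) (x 3) (x 2) (x 1) (x 0) := by
  have tr1 : ∀ {a b c d : ℕ}, a < b → b < c → c < d → d < 10 → orient (x a) (x b) (x c) < 0 →
      orient (x b) (x c) (x d) < 0 → orient (x a) (x b) (x d) < 0 ∧
      orient (x a) (x c) (x d) < 0 := by
    intro a b c d hab hbc hcd hd k1 k2
    have pab := w.pos a b hab (by omega)
    have pac := w.pos a c (by omega) (by omega)
    have pbc := w.pos b c (by omega) (by omega)
    have pbd := w.pos b d (by omega) (by omega)
    have pcd := w.pos c d (by omega) (by omega)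
    have g1 : orient r (x a) (x b) * orient (x b) (x c) (x d)
        - orient r (x b) (x c) * orient (x a) (x b) (x d) +
        orient r (x b) (x d) * orient (x a) (x b) (x c) = 0 := by unfold orient; ring
    have g2 : orient r (x a) (x c) * orient (x b) (x c) (x d)
        - orient r (x b) (x c) * orient (x a) (x c) (x d) +
        orient r (x c) (x d) * orient (x a) (x b) (x c) = 0 := by unfold orient; ring
    constructor
    · by_contra hneg
      nlinarith [mul_pos pab (neg_pos.2 k2), mul_pos pbd (neg_pos.2 k1),
        mul_nonneg pbc.le (not_lt.1 hneg)]
    · by_contra hneg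
      nlinarith [mul_pos pac (neg_pos.2 k2), mul_pos pcd (neg_pos.2 k1),
        mul_nonneg pbc.le (not_lt.1 hneg)]
  obtain ⟨h013, h023⟩ := tr1 (by omega) (by omega) (by omega) (by omega) h1 h2
  obtain ⟨h124, h134⟩ := tr1 (by omega) (by omega) (by omega) (by omega) h2 h3
  obtain ⟨h014, h024⟩ := tr1 (by omega) (by omega) (by omega) (by omega) h1 h124
  obtain ⟨_, h034⟩ := tr1 (by omega) (by omega) (by omega) (by omega) h023 h3
  have rev : ∀ {a b c : Plane}, orient a b c < 0 → 0 < orient c b a := fun h => by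
    rw [orient_rev]; linarith
  refine ⟨w.mx _ (by omega), w.mx _ (by omega), w.mx _ (by omega), w.mx _ (by omega),
    w.mx _ (by omega), rev h3, rev h134, rev h034, rev h124, rev h024, rev h014, rev h2, rev h023,
    rev h013, rev h1, ?_⟩
  intro z hz k1 k2 k3 k4 k5
  have hv : ∀ y, y = x 4 ∨ y = x 3 ∨ y = x 2 ∨ y = x 1 ∨ y = x 0 →
      y = r ∨ ∃ i, 0 ≤ i ∧ i ≤ 4 ∧ y = x i := by
    rintro y (h | h | h | h | h) <;> exact Or.inr ⟨_, Nat.zero_le _, by norm_num, h⟩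
  rcases w.mem_of_pentagon (s := 0) (t := 4) (by omega) (by omega) hgp hz hv (rev h3) (rev h124)
    (rev h014) k1 k2 k3 k4 k5 with rfl | ⟨i, -, hi, rfl⟩
  · have := w.pos 3 4 (by omega) (by omega)
    rw [orient_rot, orient_swap] at this
    have e := orient_swap (x 4) (x 3) z
    linarith
  · interval_cases i <;> simp_all

/-- In a window of ten points, `r` is a vertex of a 5-hole or sees some pair. -/
theorem Window.exists_viewer (w : Window S r x) (hgp : GenPos S) :
    (∃ i < 10, ∃ H ∈ holes 5 S, r ∈ H ∧ x i ∈ H ∧ ∀ y ∈ H, y = r ∨ ∃ i < 10, y = x i) ∨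
      ∃ i j, i < 10 ∧ j < 10 ∧ Viewer S r (x i) (x j) := by
  classical
  by_contra hcon
  push Not at hcon
  obtain ⟨hr, hv⟩ := hcon
  have g1 : ∀ i, i + 1 < 10 → ¬ InHole S (x i) (x (i + 1)) := fun i hi h =>
    hv i (i + 1) (by omega) hi (w.viewer_succ hi h)
  have g2 : ∀ i, i + 2 < 10 → InHole S (x i) (x (i + 2)) →
      0 < orient (x i) (x (i + 2)) (x (i + 1)) := fun i hi h => by
    by_contra h0
    exact hv i (i + 2) (by omega) hi (w.viewer_succ_succ hi h (g1 i (by omega)) h0)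
  -- The claim puts `x (s + i + 1)` inside the triangle of `r`, `x (s + i)` and `x (s + i + 2)`.
  have key : ∀ s ≤ 1, ∀ i, i = 0 ∨ i = 2 ∨ i = 4 ∨ i = 6 →
      0 < orient (x (s + i)) (x (s + i + 2)) (x (s + i + 1)) := by
    intro s hs i hi
    rcases w.exists_hole5 hgp hs with ⟨a, b, c, d, h1, h2, h3, h4, h5, h⟩ |
      ⟨I, hI, hI5, H, hH, hIH⟩
    · exfalso
      obtain ⟨y, hy, hy1, hy2⟩ := hr a (by omega) _ h.mem_holes (by simp) (by simp)
      simp only [Finset.mem_insert, Finset.mem_singleton] at hy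
      rcases hy with rfl | rfl | rfl | rfl | rfl
      · exact hy1 rfl
      · exact hy2 a (by omega) rfl
      · exact hy2 b (by omega) rfl
      · exact hy2 c (by omega) rfl
      · exact hy2 d (by omega) rfl
    · have hlt : ∀ i ∈ I, i < 9 := fun i hi => Finset.mem_range.1 (hI hi)
      -- The hole avoids `r` and contains no two neighbours by `g1`, so it uses every second point
      -- of the run, and `g2` applies to each step.
      have h6 := eq_of_sparse I (Finset.mem_powerset.2 hI) hI5 fun i hi hi' =>
        g1 (s + i) (by have := hlt _ hi'; omega)
          ⟨fun h => by have := w.injOn (by have := hlt _ hi'; omega)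
                        (by have := hlt _ hi'; omega) h; omega,
            H, hH, hIH i hi, by rw [add_assoc]; exact hIH _ hi'⟩
      have h7 : i ∈ I ∧ i + 2 ∈ I := by
        rw [h6]
        rcases hi with rfl | rfl | rfl | rfl <;> simp
      exact g2 (s + i) (by omega) ⟨fun h => by have := w.injOn (by omega) (by omega) h; omega,
        H, hH, hIH i h7.1, by rw [add_assoc]; exact hIH _ h7.2⟩
  -- The run from `0` gives the triples that start at `0` and `2`, the run from `1` the triple that
  -- starts at `1`. Three consecutive turns make `x 0, …, x 4` an empty convex pentagon, in which
  -- neighbours do share a 5-hole.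
  have c1 := key 0 (by omega) 0 (by omega)
  have c2 := key 1 (by omega) 0 (by omega)
  have c3 := key 0 (by omega) 2 (by omega)
  rw [orient_swap'] at c1 c2 c3
  have h := w.hole5_of_cup hgp (neg_pos.1 c1) (neg_pos.1 c2) (neg_pos.1 c3)
  exact g1 0 (by omega) ⟨(ne_of_orient_pos h.cde).2.2.symm, _, h.mem_holes, by simp, by simp⟩

end Window

/-! ### Counting viewers from below -/

open Classical in
/-- A finite set with a strict total order can be enumerated in increasing order. -/
theorem Finset.exists_enum {α : Type*} [Nonempty α] (A : Finset α) (R : α → α → Prop)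
    (irrefl : ∀ a ∈ A, ¬ R a a) (total : ∀ a ∈ A, ∀ b ∈ A, a ≠ b → R a b ∨ R b a)
    (trans : ∀ a ∈ A, ∀ b ∈ A, ∀ c ∈ A, R a b → R b c → R a c) :
    ∃ x : ℕ → α, (∀ i < A.card, x i ∈ A) ∧ (∀ i j, i < j → j < A.card → R (x i) (x j)) ∧
      ∀ z ∈ A, ∃ i < A.card, x i = z := by
  -- The number of predecessors is strictly increasing, hence a bijection onto `range A.card`; its
  -- inverse is the enumeration.
  set rank : α → ℕ := fun z => (A.filter fun y => R y z).card with hrank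
  have hlt : ∀ z ∈ A, rank z < A.card := fun z hz =>
    Finset.card_lt_card (Finset.filter_ssubset.2 ⟨z, hz, irrefl z hz⟩)
  have hmono : ∀ y ∈ A, ∀ z ∈ A, R y z → rank y < rank z := by
    intro y hy z hz hyz
    apply Finset.card_lt_card
    refine Finset.ssubset_iff_subset_ne.2 ⟨fun w hw => ?_, fun h => ?_⟩
    · rw [Finset.mem_filter] at hw ⊢
      exact ⟨hw.1, trans w hw.1 y hy z hz hw.2 hyz⟩
    · have : y ∈ A.filter fun w => R w y := h ▸ Finset.mem_filter.2 ⟨hy, hyz⟩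
      exact irrefl y hy (Finset.mem_filter.1 this).2
  have hinj : Set.InjOn rank A := by
    intro y hy z hz h
    by_contra hne
    rcases total y hy z hz hne with h1 | h1
    · exact (hmono y hy z hz h1).ne h
    · exact (hmono z hz y hy h1).ne' h
  have himg : A.image rank = Finset.range A.card := by
    apply Finset.eq_of_subset_of_card_le
    · intro i hi
      obtain ⟨z, hz, rfl⟩ := Finset.mem_image.1 hi
      exact Finset.mem_range.2 (hlt z hz)
    · rw [Finset.card_range, Finset.card_image_of_injOn hinj]
  have hsurj : ∀ i, i < A.card → ∃ z ∈ A, rank z = i := fun i hi =>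
    Finset.mem_image.1 (himg ▸ Finset.mem_range.2 hi)
  choose! x hxA hxr using hsurj
  refine ⟨x, hxA, fun i j hij hj => ?_, fun z hz => ⟨rank z, hlt z hz, ?_⟩⟩
  · have hi := hij.trans hj
    rcases total _ (hxA i hi) _ (hxA j hj) (fun h => by
      have := hxr i hi; rw [h, hxr j hj] at this; omega) with h | h
    · exact h
    · have := hmono _ (hxA j hj) _ (hxA i hi) h
      rw [hxr i hi, hxr j hj] at this
      omega
  · exact hinj (hxA _ (hlt z hz)) hz (hxr _ (hlt z hz))

/-- `trans` lets `A` be sorted about `r`, and `conv` makes neighbours in `A` neighbours in all of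
`S`. -/
theorem exists_window_enum {S A : Finset Plane} {r : Plane} (hgp : GenPos S) (hr : r ∈ S)
    (hAS : A ⊆ S) (hrA : r ∉ A)
    (trans : ∀ a ∈ A, ∀ b ∈ A, ∀ c ∈ A, 0 < orient r a b → 0 < orient r b c → 0 < orient r a c)
    (conv : ∀ a ∈ A, ∀ b ∈ A, ∀ z ∈ S, 0 < orient r a b → 0 < orient r a z → 0 < orient r z b →
      z ∈ A) :
    ∃ x : ℕ → Plane, (∀ i < A.card, x i ∈ A) ∧
      (∀ i j, i < j → j < A.card → 0 < orient r (x i) (x j)) ∧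
      (∀ z ∈ A, ∃ i < A.card, x i = z) ∧
      ∀ s, s + 10 ≤ A.card → Window S r fun i => x (s + i) := by
  obtain ⟨x, hxA, hx, hxs⟩ := A.exists_enum (fun a b => 0 < orient r a b) (by simp)
    (fun a ha b hb hab => by
      have hra : r ≠ a := fun h => hrA (h ▸ ha)
      have hrb : r ≠ b := fun h => hrA (h ▸ hb)
      rcases (hgp r hr a (hAS ha) b (hAS hb) hra hrb hab).lt_or_gt with h | h
      · right; rw [orient_swap']; linarith
      · exact Or.inl h) trans
  refine ⟨x, hxA, hx, hxs, fun s hs => ⟨hr, fun i hi => hAS (hxA _ (by omega)), fun i j hij hj =>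
    hx _ _ (by omega) (by omega), fun z hz h1 h2 => ?_⟩⟩
  obtain ⟨k, hk, rfl⟩ := hxs z (conv _ (hxA _ (by omega)) _ (hxA _ (by omega)) z hz
    (hx _ _ (by omega : s + 0 < s + 9) (by omega)) h1 h2)
  have lt : ∀ {i j : ℕ}, i < A.card → 0 < orient r (x i) (x j) → i < j := by
    intro i j hi h
    by_contra hle
    rcases (not_lt.1 hle).lt_or_eq with h' | rfl
    · have := hx j i h' hi
      rw [orient_swap'] at this
      linarith
    · simp at h
  have h3 := lt (by omega) h1
  have h4 := lt hk h2
  exact ⟨k - s, by omega, by congr 1; omega⟩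

-- Each of the disjoint windows yields a hole at `r` or a seen pair. No two windows yield the same
-- one, because each yield contains a point of its window and, apart from `r`, no others.
open Classical in
theorem card_div_le {S A : Finset Plane} {r : Plane} (hgp : GenPos S) (hr : r ∈ S)
    (hAS : A ⊆ S) (hrA : r ∉ A)
    (trans : ∀ a ∈ A, ∀ b ∈ A, ∀ c ∈ A, 0 < orient r a b → 0 < orient r b c → 0 < orient r a c)
    (conv : ∀ a ∈ A, ∀ b ∈ A, ∀ z ∈ S, 0 < orient r a b → 0 < orient r a z → 0 < orient r z b →
      z ∈ A) :
    A.card / 10 ≤ ((holes 5 S).filter fun H => r ∈ H).card +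
      ((S ×ˢ S).filter fun t => Viewer S r t.1 t.2).card := by
  obtain ⟨x, hxA, hx, hxs, hw⟩ := exists_window_enum hgp hr hAS hrA trans conv
  have hinj : ∀ i j, i < A.card → j < A.card → x i = x j → i = j := by
    intro i j hi hj h
    rcases lt_trichotomy i j with h1 | h1 | h1
    · have := hx i j h1 hj; rw [h] at this; simp at this
    · exact h1
    · have := hx j i h1 hi; rw [h] at this; simp at this
  set P : ℕ → Prop := fun k => ∃ i < 10, ∃ H ∈ holes 5 S, r ∈ H ∧ x (10 * k + i) ∈ H ∧
    ∀ y ∈ H, y = r ∨ ∃ i < 10, y = x (10 * k + i) with hP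
  set Q : ℕ → Prop := fun k => ∃ i j, i < 10 ∧ j < 10 ∧
    Viewer S r (x (10 * k + i)) (x (10 * k + j)) with hQ
  have hPQ : ∀ k < A.card / 10, P k ∨ Q k := fun k hk =>
    (hw (10 * k) (by omega)).exists_viewer hgp
  have h1 : ((Finset.range (A.card / 10)).filter P).card ≤
      ((holes 5 S).filter fun H => r ∈ H).card := by
    have : ∀ k ∈ (Finset.range (A.card / 10)).filter P, ∃ H ∈ (holes 5 S).filter fun H => r ∈ H,
        (∃ i < 10, x (10 * k + i) ∈ H) ∧ ∀ y ∈ H, y = r ∨ ∃ i < 10, y = x (10 * k + i) := by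
      intro k hk
      obtain ⟨i, hi, H, hH, hrH, hx, hy⟩ := (Finset.mem_filter.1 hk).2
      exact ⟨H, Finset.mem_filter.2 ⟨hH, hrH⟩, ⟨i, hi, hx⟩, hy⟩
    choose! H hH hx hy using this
    refine Finset.card_le_card_of_injOn H hH ?_
    intro k hk l hl hkl
    have hk' := Finset.mem_range.1 (Finset.mem_filter.1 hk).1
    have hl' := Finset.mem_range.1 (Finset.mem_filter.1 hl).1
    obtain ⟨i, hi, hxi⟩ := hx k hk
    rw [hkl] at hxi
    rcases hy l hl _ hxi with h | ⟨j, hj, h⟩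
    · exact absurd (h ▸ hxA _ (by omega)) hrA
    · have := hinj _ _ (by omega) (by omega) h
      omega
  have h2 : ((Finset.range (A.card / 10)).filter Q).card ≤
      ((S ×ˢ S).filter fun t => Viewer S r t.1 t.2).card := by
    have : ∀ k ∈ (Finset.range (A.card / 10)).filter Q,
        ∃ t ∈ (S ×ˢ S).filter fun t => Viewer S r t.1 t.2, ∃ i < 10, t.1 = x (10 * k + i) := by
      intro k hk
      obtain ⟨i, j, hi, hj, hv⟩ := (Finset.mem_filter.1 hk).2
      exact ⟨(_, _), Finset.mem_filter.2 ⟨Finset.mem_product.2 ⟨hv.ma, hv.hole.mem_right⟩, hv⟩,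
        i, hi, rfl⟩
    choose! t ht hx using this
    refine Finset.card_le_card_of_injOn t ht ?_
    intro k hk l hl hkl
    have hk' := Finset.mem_range.1 (Finset.mem_filter.1 hk).1
    have hl' := Finset.mem_range.1 (Finset.mem_filter.1 hl).1
    obtain ⟨i, hi, hxi⟩ := hx k hk
    obtain ⟨j, hj, hxj⟩ := hx l hl
    rw [hkl, hxj] at hxi
    have := hinj _ _ (by omega) (by omega) hxi
    omega
  calc A.card / 10 = (Finset.range (A.card / 10)).card := (Finset.card_range _).symm
    _ ≤ ((Finset.range (A.card / 10)).filter P ∪ (Finset.range (A.card / 10)).filter Q).card := by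
        apply Finset.card_le_card
        intro k hk
        rw [Finset.mem_union, Finset.mem_filter, Finset.mem_filter]
        exact (hPQ k (Finset.mem_range.1 hk)).imp (fun h => ⟨hk, h⟩) fun h => ⟨hk, h⟩
    _ ≤ _ := (Finset.card_union_le _ _).trans (add_le_add h1 h2)

-- The line through `r` and another point leaves at least half of the remaining `n - 2` points on
-- one side, and there they can be sorted about `r`.
open Classical in
theorem card_viewers_ge_of_mem {S : Finset Plane} {r : Plane} (hgp : GenPos S) (hr : r ∈ S) :
    (S.card - 2) / 20 ≤ ((holes 5 S).filter fun H => r ∈ H).card +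
      ((S ×ˢ S).filter fun t => Viewer S r t.1 t.2).card := by
  by_cases hS : ∃ w ∈ S, w ≠ r
  swap
  · push Not at hS
    have : S.card ≤ 1 := Finset.card_le_one.2 fun a ha b hb => (hS a ha).trans (hS b hb).symm
    have : (S.card - 2) / 20 = 0 := by omega
    omega
  obtain ⟨w, hw, hwr⟩ := hS
  set A := S.filter fun z => 0 < orient r w z with hA
  set B := S.filter fun z => 0 < orient r z w with hB
  have hAB : S.card ≤ A.card + B.card + 2 := by
    have : S ⊆ (A ∪ B) ∪ {r, w} := by
      intro z hz
      simp only [Finset.mem_union, Finset.mem_insert, Finset.mem_singleton, hA, hB,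
        Finset.mem_filter]
      by_cases h1 : z = r
      · exact Or.inr (Or.inl h1)
      by_cases h2 : z = w
      · exact Or.inr (Or.inr h2)
      left
      rcases (hgp r hr w hw z hz hwr.symm (Ne.symm h1) (Ne.symm h2)).lt_or_gt with h | h
      · right; rw [orient_swap']; exact ⟨hz, by linarith⟩
      · exact Or.inl ⟨hz, h⟩
    calc S.card ≤ ((A ∪ B) ∪ {r, w}).card := Finset.card_le_card this
      _ ≤ (A ∪ B).card + ({r, w} : Finset Plane).card := Finset.card_union_le _ _
      _ ≤ A.card + B.card + 2 := add_le_add (Finset.card_union_le _ _) Finset.card_le_two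
  have hdA : A.card / 10 ≤ ((holes 5 S).filter fun H => r ∈ H).card +
      ((S ×ˢ S).filter fun t => Viewer S r t.1 t.2).card := by
    refine card_div_le hgp hr (Finset.filter_subset _ _) (by simp [hA]) ?_ ?_
    · intro a ha b hb c hc
      exact orient_trans (Finset.mem_filter.1 ha).2 (Finset.mem_filter.1 hb).2
        (Finset.mem_filter.1 hc).2
    · intro a ha b hb z hz hab h1 h2
      refine Finset.mem_filter.2 ⟨hz, ?_⟩
      have g := orient_gp r w a z b
      by_contra hneg
      nlinarith [mul_pos (Finset.mem_filter.1 ha).2 h2, mul_pos (Finset.mem_filter.1 hb).2 h1,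
        mul_nonneg hab.le (neg_nonneg.2 (not_lt.1 hneg))]
  have hdB : B.card / 10 ≤ ((holes 5 S).filter fun H => r ∈ H).card +
      ((S ×ˢ S).filter fun t => Viewer S r t.1 t.2).card := by
    refine card_div_le hgp hr (Finset.filter_subset _ _) (by simp [hB]) ?_ ?_
    · intro a ha b hb c hc
      exact orient_trans' (Finset.mem_filter.1 ha).2 (Finset.mem_filter.1 hb).2
        (Finset.mem_filter.1 hc).2
    · intro a ha b hb z hz hab h1 h2
      refine Finset.mem_filter.2 ⟨hz, ?_⟩
      have g : orient r a w * orient r z b - orient r z w * orient r a b +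
        orient r b w * orient r a z = 0 := by unfold orient; ring
      by_contra hneg
      nlinarith [mul_pos (Finset.mem_filter.1 ha).2 h2, mul_pos (Finset.mem_filter.1 hb).2 h1,
        mul_nonneg hab.le (neg_nonneg.2 (not_lt.1 hneg))]
  omega

open Classical in
/-- The triples `(r, a, b)` such that `r` sees the pair `a b`. -/
noncomputable def viewers (S : Finset Plane) : Finset (Plane × Plane × Plane) :=
  (S ×ˢ S ×ˢ S).filter fun t => Viewer S t.1 t.2.1 t.2.2

theorem mem_viewers {S : Finset Plane} {t : Plane × Plane × Plane} :
    t ∈ viewers S ↔ Viewer S t.1 t.2.1 t.2.2 := by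
  simp only [viewers, Finset.mem_filter, Finset.mem_product]
  exact ⟨fun h => h.2, fun h => ⟨⟨h.mr, h.ma, h.hole.mem_right⟩, h⟩⟩

-- Sum over `r`; the coefficient 5 counts each hole once per vertex.
open Classical in
theorem card_viewers_ge {S : Finset Plane} (hgp : GenPos S) :
    S.card * ((S.card - 2) / 20) ≤ 5 * (holes 5 S).card + (viewers S).card := by
  have h1 : ∑ r ∈ S, ((holes 5 S).filter fun H => r ∈ H).card = 5 * (holes 5 S).card := by
    simp only [Finset.card_filter]
    rw [Finset.sum_comm]
    have : ∀ H ∈ holes 5 S, (∑ r ∈ S, if r ∈ H then 1 else 0) = 5 := by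
      intro H hH
      rw [← Finset.card_filter, Finset.filter_mem_eq_inter,
        Finset.inter_eq_right.2 (subset_of_mem_holes hH), card_of_mem_holes hH]
    rw [Finset.sum_congr rfl this, Finset.sum_const, smul_eq_mul, mul_comm]
  have h2 : ∑ r ∈ S, ((S ×ˢ S).filter fun t => Viewer S r t.1 t.2).card = (viewers S).card := by
    unfold viewers
    simp only [Finset.card_filter]
    rw [Finset.sum_product]
  calc S.card * ((S.card - 2) / 20) = ∑ r ∈ S, (S.card - 2) / 20 := by
        rw [Finset.sum_const, smul_eq_mul]
    _ ≤ ∑ r ∈ S, (((holes 5 S).filter fun H => r ∈ H).card +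
        ((S ×ˢ S).filter fun t => Viewer S r t.1 t.2).card) :=
        Finset.sum_le_sum fun r hr => card_viewers_ge_of_mem hgp hr
    _ = _ := by rw [Finset.sum_add_distrib, h1, h2]

/-! ### Existence of a 5-hole -/

/-- A linear functional that separates finitely many points. -/
theorem exists_separating (S : Finset Plane) :
    ∃ t : ℝ, ∀ a ∈ S, ∀ b ∈ S, a 0 + t * a 1 = b 0 + t * b 1 → a = b := by
  -- Two distinct points take equal values for at most one `t`.
  have hfin : (⋃ a ∈ S, ⋃ b ∈ S, {t : ℝ | a ≠ b ∧ a 0 + t * a 1 = b 0 + t * b 1}).Finite := by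
    refine Set.Finite.biUnion S.finite_toSet fun a _ => Set.Finite.biUnion S.finite_toSet fun b _ =>
      Set.Subsingleton.finite ?_
    rintro t ⟨hab, ht⟩ u ⟨_, hu⟩
    by_cases h1 : a 1 = b 1
    · exfalso
      apply hab
      ext i
      fin_cases i
      · simp only [Fin.zero_eta]; rw [h1] at ht; linarith
      · exact h1
    · have : (t - u) * (a 1 - b 1) = 0 := by linarith
      rcases mul_eq_zero.1 this with h | h
      · linarith
      · exact absurd (by linarith) h1
  obtain ⟨t, ht⟩ := hfin.infinite_compl.nonempty
  refine ⟨t, fun a ha b hb h => ?_⟩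
  by_contra hab
  exact ht (Set.mem_biUnion ha (Set.mem_biUnion hb ⟨hab, h⟩))

/-- An extreme point in a generic direction has all others in an open half-plane at it, so
Harborth's theorem applies there. -/
theorem holes_nonempty {S : Finset Plane} (hgp : GenPos S) (hS : 10 ≤ S.card) :
    (holes 5 S).Nonempty := by
  classical
  obtain ⟨t, ht⟩ := exists_separating S
  obtain ⟨r, hr, hmin⟩ := S.exists_min_image (fun z => z 0 + t * z 1)
    (Finset.card_pos.1 (by omega))
  -- Chosen so that `orient r w z` is the difference of the functional at `z` and at `r`.
  set w : Plane := !₂[r 0 + t, r 1 - 1] with hw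
  have hpos : ∀ z ∈ S.erase r, 0 < orient r w z := by
    intro z hz
    have hz' := Finset.mem_erase.1 hz
    have h1 := (hmin z hz'.2).lt_of_ne fun h => hz'.1 (ht r hr z hz'.2 h).symm
    have : orient r w z = (z 0 + t * z 1) - (r 0 + t * r 1) := by
      simp [orient, hw]; ring
    simp only at h1
    linarith
  obtain ⟨x, hxA, hx, hxs, hwin⟩ := exists_window_enum (A := S.erase r) hgp hr
    (Finset.erase_subset _ _) (by simp)
    (fun a ha b hb c hc => orient_trans (hpos a ha) (hpos b hb) (hpos c hc))
    (fun a _ b _ z hz _ h1 _ => Finset.mem_erase.2 ⟨(ne_of_orient_pos h1).2.1.symm, hz⟩)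
  have hcard : (S.erase r).card = S.card - 1 := Finset.card_erase_of_mem hr
  -- Ten points leave only nine besides `r`, too few for a window, so this case uses Harborth's
  -- theorem directly.
  rcases hS.eq_or_lt with h10 | h11
  · rw [hcard, ← h10] at hxA hx hxs
    have hinj : ∀ i j, i < 9 → j < 9 → x i = x j → i = j := by
      intro i j hi hj h
      rcases lt_trichotomy i j with h1 | h1 | h1
      · have := hx i j h1 hj; rw [h] at this; simp at this
      · exact h1
      · have := hx j i h1 hi; rw [h] at this; simp at this
    have hmem : ∀ i < 9, x i ∈ S := fun i hi => (Finset.mem_erase.1 (hxA i hi)).2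
    have hS' : ∀ z, z ∈ S ↔ z = r ∨ ∃ i < 9, z = x i := by
      refine fun z => ⟨fun hz => ?_, ?_⟩
      · by_cases hzr : z = r
        · exact Or.inl hzr
        · obtain ⟨i, hi, h⟩ := hxs z (Finset.mem_erase.2 ⟨hzr, hz⟩)
          exact Or.inr ⟨i, hi, h.symm⟩
      · rintro (rfl | ⟨i, hi, rfl⟩)
        · exact hr
        · exact hmem i hi
    rcases exists_hole5_of_sorted (p := r) (x := x) (S := S) hS'
      (fun i j k hij hjk hk => hgp _ (hmem _ (by omega)) _ (hmem _ (by omega)) _ (hmem _ (by omega))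
      (fun h => by have := hinj _ _ (by omega) (by omega) h; omega)
      (fun h => by have := hinj _ _ (by omega) (by omega) h; omega)
      (fun h => by have := hinj _ _ (by omega) (by omega) h; omega))
      (fun i j hij hj => hx i j hij hj) with ⟨i, j, k, l, -, -, -, -, h⟩ |
      ⟨i, j, k, l, m, -, -, -, -, -, h⟩
    · exact ⟨_, h.mem_holes⟩
    · exact ⟨_, h.mem_holes⟩
  · rcases (hwin 0 (by omega)).exists_hole5 hgp (s := 0) (by omega) with
      ⟨i, j, k, l, -, -, -, -, -, h⟩ | ⟨I, -, -, H, hH, -⟩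
    · exact ⟨_, h.mem_holes⟩
    · exact ⟨H, hH⟩

/-! ### Viewers outside common 5-holes are in convex position -/

theorem orient_pos_of_triangle {a b c z u v : Plane} (h : 0 < orient a b c)
    (h1 : 0 < orient z b c) (h2 : 0 ≤ orient a z c) (h3 : 0 ≤ orient a b z)
    (ha : 0 < orient u v a) (hb : 0 ≤ orient u v b) (hc : 0 ≤ orient u v c) :
    0 < orient u v z := by
  have hbary := orient_bary a b c z u v
  rw [orient_rot] at ha hb hc ⊢
  rw [orient_rot] at ha hb hc ⊢
  by_contra hcon
  nlinarith [mul_pos h1 ha, mul_nonneg h2 hb, mul_nonneg h3 hc,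
    mul_nonneg h.le (neg_nonneg.2 (not_lt.1 hcon))]

theorem orient_pos_of_pentagon {a b c d e z u v : Plane} (habc : 0 < orient a b c)
    (hacd : 0 < orient a c d) (hade : 0 < orient a d e)
    (h1 : 0 < orient a b z) (h2 : 0 < orient b c z) (h3 : 0 < orient c d z)
    (h4 : 0 < orient d e z) (h5 : 0 < orient e a z)
    (ha : 0 < orient u v a) (hb : 0 ≤ orient u v b) (hc : 0 ≤ orient u v c)
    (hd : 0 ≤ orient u v d) (he : 0 ≤ orient u v e) : 0 < orient u v z := by
  have e1 := orient_rot z b c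
  have e2 := orient_swap' a z c
  have e3 := orient_rot z c d
  have e4 := orient_swap' a z d
  have e5 := orient_rot z d e
  have e6 : orient a z e = orient e a z := orient_rot _ _ _ |>.trans (orient_rot _ _ _)
  by_cases hac : orient a c z ≤ 0
  · exact orient_pos_of_triangle habc (by linarith) (by linarith) h1.le ha hb hc
  by_cases had : orient a d z ≤ 0
  · exact orient_pos_of_triangle hacd (by linarith) (by linarith) (by linarith) ha hc hd
  · exact orient_pos_of_triangle hade (by linarith) (by linarith) (by linarith) ha hd he

/-- The points `u` and `v` are on the left and on the right of `r` above `a b`, and `a b v r u` is a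
convex pentagon. -/
structure Wings (a b r u v : Plane) : Prop where
  abu : 0 < orient a b u
  abv : 0 < orient a b v
  aru : 0 < orient a r u
  bru : 0 < orient b r u
  avr : 0 < orient a v r
  bvr : 0 < orient b v r
  vru : 0 < orient v r u

theorem Wings.avu {a b r u v : Plane} (h : Wings a b r u v) (habr : 0 < orient a b r) :
    0 < orient a v u :=
  orient_trans h.abv habr h.abu h.avr h.aru

theorem Wings.bvu {a b r u v : Plane} (h : Wings a b r u v) (habr : 0 < orient a b r) :
    0 < orient b v u :=
  orient_trans' (w := a) (by rw [← orient_rot]; exact h.abv) (by rw [← orient_rot]; exact habr)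
    (by rw [← orient_rot]; exact h.abu) h.bvr h.bru

-- Wings with the fewest points in the pentagon `a b v r u` make it empty: a point inside it is not
-- in the triangle `a b r`, so it can replace `u` or `v`, and the new pentagon is contained in the
-- old one and loses that point.
open Classical in
theorem exists_hole5_of_wings {S : Finset Plane} (hgp : GenPos S) {a b r : Plane} (ha : a ∈ S)
    (hb : b ∈ S) (hr : r ∈ S) (habr : 0 < orient a b r)
    (hemp : ∀ z ∈ S, 0 < orient a b z → 0 < orient b r z → 0 < orient r a z → False)
    (hw : ∃ u ∈ S, ∃ v ∈ S, Wings a b r u v) : ∃ u v, Hole5 S a b v r u := by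
  set N : Plane × Plane → Finset Plane := fun t => S.filter fun z => 0 < orient a b z ∧
    0 < orient b t.2 z ∧ 0 < orient t.2 r z ∧ 0 < orient r t.1 z ∧ 0 < orient t.1 a z with hN
  obtain ⟨u₀, hu₀, v₀, hv₀, hw₀⟩ := hw
  obtain ⟨⟨u, v⟩, huv, hmin⟩ := ((S ×ˢ S).filter fun t => Wings a b r t.1 t.2).exists_min_image
    (fun t => (N t).card)
    ⟨(u₀, v₀), Finset.mem_filter.2 ⟨Finset.mem_product.2 ⟨hu₀, hv₀⟩, hw₀⟩⟩
  obtain ⟨huvS, w⟩ := Finset.mem_filter.1 huv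
  obtain ⟨hu, hv⟩ := Finset.mem_product.1 huvS
  simp only at hu hv w hmin
  have avu := w.avu habr
  have bvu := w.bvu habr
  refine ⟨u, v, ha, hb, hv, hr, hu, w.abv, habr, w.abu, w.avr, avu, w.aru, w.bvr, bvu, w.bru,
    w.vru, fun z hz h1 h2 h3 h4 h5 => ?_⟩
  have hlt : ∀ t, z ∈ N (u, v) → N t ⊆ N (u, v) → z ∉ N t → t.1 ∈ S → t.2 ∈ S →
      Wings a b r t.1 t.2 → False := by
    intro t k1 k2 k3 k4 k5 k6
    have := Finset.card_lt_card (Finset.ssubset_iff_subset_ne.2 ⟨k2, fun h => k3 (h ▸ k1)⟩)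
    exact absurd (hmin t (Finset.mem_filter.2 ⟨Finset.mem_product.2 ⟨k4, k5⟩, k6⟩)) (by omega)
  have hzN : z ∈ N (u, v) := Finset.mem_filter.2 ⟨hz, h1, h2, h3, h4, h5⟩
  have nza := ne_of_orient_pos h1
  have nzr := ne_of_orient_pos h3
  have nar := ne_of_orient_pos habr
  have e1 : orient r a z = -orient a r z := orient_swap _ _ _
  rcases (hgp a ha r hr z hz nar.2.1 nza.2.1 nzr.2.2).lt_or_gt with sa | sa <;>
  rcases (hgp b hb r hr z hz nar.2.2 nza.2.2 nzr.2.2).lt_or_gt with sb | sb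
  · have azr : 0 < orient a z r := by rw [orient_swap']; linarith
    have bzr : 0 < orient b z r := by rw [orient_swap']; linarith
    have zru : 0 < orient z r u := by rw [orient_rot]; exact h4
    refine hlt (u, z) hzN (fun y hy => ?_) (fun h => ?_) hu hz
      ⟨w.abu, h1, w.aru, w.bru, azr, bzr, zru⟩
    · obtain ⟨hy, y1, y2, y3, y4, y5⟩ := Finset.mem_filter.1 hy
      simp only at y2 y3 y4 y5
      refine Finset.mem_filter.2 ⟨hy, y1, ?_, ?_, y4, y5⟩
      · exact orient_pos_of_pentagon h1 azr w.aru y1 y2 y3 y4 y5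
          (by rw [← orient_rot]; exact w.abv) (by simp) h2.le w.bvr.le bvu.le
      · exact orient_pos_of_pentagon h1 azr w.aru y1 y2 y3 y4 y5
          (by rw [← orient_rot]; exact w.avr) (by rw [← orient_rot]; exact w.bvr.le) h3.le (by simp)
          w.vru.le
    · have := (Finset.mem_filter.1 h).2.2.1
      simp at this
  · exact hemp z hz h1 sb (by linarith)
  -- Impossible: about `r`, starting from `u`, the points `z`, `a`, `b` come in this order, so `z`
  -- is to the left of `b r`.
  · have g := orient_trans (p := r) (w := u) (a := z) (b := a) (c := b) h4
      (by rw [← orient_rot]; exact w.aru) (by rw [← orient_rot]; exact w.bru)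
      (by rw [← orient_rot]; exact sa) (by rw [orient_rot]; exact habr)
    rw [← orient_rot] at g
    linarith
  · refine hlt (z, v) hzN (fun y hy => ?_) (fun h => ?_) hz hv
      ⟨h1, w.abv, sa, sb, w.avr, w.bvr, h3⟩
    · obtain ⟨hy, y1, y2, y3, y4, y5⟩ := Finset.mem_filter.1 hy
      simp only at y2 y3 y4 y5
      refine Finset.mem_filter.2 ⟨hy, y1, y2, y3, ?_, ?_⟩
      · exact orient_pos_of_pentagon w.abv w.avr sa y1 y2 y3 y4 y5
          (by rw [← orient_rot]; exact w.aru) (by rw [← orient_rot]; exact w.bru.le)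
          (by rw [← orient_rot]; exact w.vru.le) (by simp) h4.le
      · refine orient_pos_of_pentagon w.bvr sb (by rw [← orient_rot]; exact h1) y2 y3 y4 y5 y1
          (by rw [orient_rot]; exact w.abu) (by rw [orient_rot]; exact avu.le)
          (by rw [orient_rot]; exact w.aru.le) h5.le (by simp)
    · have := (Finset.mem_filter.1 h).2.2.2.2.1
      simp at this

/-- Three points are vertices of a common 5-hole. -/
def InHole3 (S : Finset Plane) (a b c : Plane) : Prop := ∃ H ∈ holes 5 S, a ∈ H ∧ b ∈ H ∧ c ∈ H

theorem Viewer.inHole3_of_wings {S : Finset Plane} (hgp : GenPos S) {r a b u v : Plane}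
    (h : Viewer S r a b) (hu : u ∈ S) (hv : v ∈ S) (w : Wings a b r u v) : InHole3 S r a b := by
  classical
  obtain ⟨u, v, h5⟩ := exists_hole5_of_wings hgp h.ma h.hole.mem_right h.mr
    (by rw [← orient_rot]; exact h.pos)
    (fun z hz h1 h2 h3 => h.empty z hz h3 h1 h2) ⟨u, hu, v, hv, w⟩
  exact ⟨_, h5.mem_holes, by simp, by simp, by simp⟩

open Classical in
theorem card_inHole3_le (S : Finset Plane) :
    ((S ×ˢ S ×ˢ S).filter fun t => InHole3 S t.1 t.2.1 t.2.2).card ≤ 125 * (holes 5 S).card := by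
  calc _ ≤ ((holes 5 S).biUnion fun H => H ×ˢ H ×ˢ H).card := by
        apply Finset.card_le_card
        intro t ht
        obtain ⟨-, H, hH, h1, h2, h3⟩ := Finset.mem_filter.1 ht
        exact Finset.mem_biUnion.2 ⟨H, hH, Finset.mem_product.2 ⟨h1, Finset.mem_product.2 ⟨h2, h3⟩⟩⟩
    _ ≤ (holes 5 S).card * 125 := Finset.card_biUnion_le_card_mul _ _ _ fun H hH => by
        rw [Finset.card_product, Finset.card_product, card_of_mem_holes hH]
    _ = _ := mul_comm _ _

open Classical in
theorem card_inHole_le (S : Finset Plane) :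
    ((S ×ˢ S).filter fun t => InHole S t.1 t.2).card ≤ 25 * (holes 5 S).card := by
  calc _ ≤ ((holes 5 S).biUnion fun H => H ×ˢ H).card := by
        apply Finset.card_le_card
        intro t ht
        obtain ⟨-, -, H, hH, h1, h2⟩ := Finset.mem_filter.1 ht
        exact Finset.mem_biUnion.2 ⟨H, hH, Finset.mem_product.2 ⟨h1, h2⟩⟩
    _ ≤ (holes 5 S).card * 25 := Finset.card_biUnion_le_card_mul _ _ _ fun H hH => by
        rw [Finset.card_product, card_of_mem_holes hH]
    _ = _ := mul_comm _ _

/-- Two points that see the same pair are both on the same side of each other. -/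
theorem Viewer.orient_iff {S : Finset Plane} (hgp : GenPos S) {a b c d : Plane}
    (hc : Viewer S c a b) (hd : Viewer S d a b) (hcd : c ≠ d) :
    (0 < orient a d c ∧ 0 < orient b d c) ∨ (0 < orient a c d ∧ 0 < orient b c d) := by
  have nc := ne_of_orient_pos hc.pos
  have nd := ne_of_orient_pos hd.pos
  have e1 := orient_swap' a c d
  have e2 := orient_swap' b c d
  have habc : 0 < orient a b c := by rw [← orient_rot]; exact hc.pos
  have habd : 0 < orient a b d := by rw [← orient_rot]; exact hd.pos
  rcases (hgp a hc.ma c hc.mr d hd.mr nc.1.symm nd.1.symm hcd).lt_or_gt with sa | sa <;>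
  rcases (hgp b hc.hole.mem_right c hc.mr d hd.mr nc.2.1.symm nd.2.1.symm hcd).lt_or_gt with sb | sb
  · exact Or.inl ⟨by linarith, by linarith⟩
  · exact (hc.empty d hd.mr (by rw [orient_swap]; linarith) habd sb).elim
  · exact (hd.empty c hc.mr (by rw [orient_swap]; linarith) habc (by linarith)).elim
  · exact Or.inr ⟨sa, sb⟩

/-- Points that see the same pair, but do not form a 5-hole with it, are in convex position. -/
theorem exists_cup {S C : Finset Plane} (hgp : GenPos S) {a b : Plane}
    (hC : ∀ c ∈ C, Viewer S c a b ∧ ¬ InHole3 S c a b) :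
    ∃ c : ℕ → Plane, (∀ i < C.card, c i ∈ C) ∧
      ∀ i j k, i < j → j < k → k < C.card → 0 < orient (c i) (c j) (c k) := by
  have habc : ∀ c ∈ C, 0 < orient a b c := fun c hc => by
    rw [← orient_rot]; exact (hC c hc).1.pos
  obtain ⟨x, hxC, hx, -⟩ := C.exists_enum (fun c d => 0 < orient a d c) (by simp)
    (fun c hc d hd hcd => ((hC c hc).1.orient_iff hgp (hC d hd).1 hcd).imp And.left And.left)
    (fun c hc d hd e he h1 h2 =>
      orient_trans (habc e he) (habc d hd) (habc c hc) h2 h1)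
  have hne : ∀ i j, i < j → j < C.card → x i ≠ x j := fun i j hij hj =>
    (ne_of_orient_pos (hx i j hij hj)).2.2.symm
  have hboth : ∀ i j, i < j → j < C.card →
      0 < orient a (x j) (x i) ∧ 0 < orient b (x j) (x i) := by
    intro i j hij hj
    have h := hx i j hij hj
    rcases (hC _ (hxC i (by omega))).1.orient_iff hgp (hC _ (hxC j hj)).1 (hne i j hij hj) with
      h1 | h1
    · exact h1
    · have := orient_swap' a (x j) (x i)
      linarith [h1.1]
  have hS : ∀ i, i < C.card → x i ∈ S := fun i hi => (hC _ (hxC i hi)).1.mr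
  refine ⟨x, hxC, fun i j k hij hjk hk => ?_⟩
  have hj := hjk.trans hk
  have hi := hij.trans hj
  rcases (hgp _ (hS i hi) _ (hS j hj) _ (hS k hk) (hne i j hij hj) (hne i k (hij.trans hjk) hk)
    (hne j k hjk hk)).lt_or_gt with h | h
  -- A wrong turn at `x j` makes `x i` and `x k` wings of `x j`, and then `x j` shares a 5-hole with
  -- `a` and `b`.
  · exfalso
    have h1 := hboth i j hij hj
    have h2 := hboth j k hjk hk
    refine (hC _ (hxC j hj)).2 ((hC _ (hxC j hj)).1.inHole3_of_wings hgp (hS i hi) (hS k hk)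
      ⟨habc _ (hxC i hi), habc _ (hxC k hk), h1.1, h1.2, h2.1, h2.2, ?_⟩)
    rw [orient_rev]; linarith
  · exact h

/-! ### Extending empty triangles and quadrilaterals -/

/-- An empty convex quadrilateral `A B C D` that can be extended to a convex pentagon beyond the
side `D A` can be extended to a 5-hole. -/
theorem exists_hole5_of_quad {S : Finset Plane} (hgp : GenPos S) {A B C D : Plane} (hA : A ∈ S)
    (hB : B ∈ S) (hC : C ∈ S) (hD : D ∈ S) (abc : 0 < orient A B C) (abd : 0 < orient A B D)
    (acd : 0 < orient A C D) (bcd : 0 < orient B C D)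
    (hemp : ∀ z ∈ S, 0 < orient A B z → 0 < orient B C z → 0 < orient C D z → 0 < orient D A z →
      False)
    (hx : ∃ x ∈ S, 0 < orient A B x ∧ 0 < orient C D x ∧ 0 < orient A D x) :
    ∃ x, Hole5 S A B C D x := by
  classical
  have hconv : ∀ x, 0 < orient A B x → 0 < orient C D x → 0 < orient A D x →
      0 < orient A C x ∧ 0 < orient B D x ∧ 0 < orient B C x := by
    intro x abx cdx adx
    have acx : 0 < orient A C x := orient_trans abc abd abx acd adx
    refine ⟨acx, ?_, ?_⟩
    · rw [orient_rot]
      exact orient_trans' (w := C) (by rw [← orient_rot]; exact cdx)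
        (by rw [orient_rot]; exact acd) (by rw [orient_rot]; exact bcd)
        (by rw [← orient_rot]; exact adx) (by rw [orient_rot]; exact abd)
    · rw [orient_rot]
      exact orient_trans (w := D) cdx (by rw [← orient_rot]; exact acd)
        (by rw [← orient_rot]; exact bcd) (by rw [← orient_rot]; exact acx)
        (by rw [orient_rot]; exact abc)
  -- A minimal choice of `x` works: as the quadrilateral is empty, a point `z` inside the pentagon
  -- lies beyond `D A` and would give a smaller pentagon.
  set N : Plane → Finset Plane := fun x => S.filter fun z => 0 < orient A B z ∧ 0 < orient B C z ∧
    0 < orient C D z ∧ 0 < orient D x z ∧ 0 < orient x A z with hN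
  obtain ⟨x₀, hx₀, hx₀'⟩ := hx
  obtain ⟨x, hx, hmin⟩ := (S.filter fun x => 0 < orient A B x ∧ 0 < orient C D x ∧
    0 < orient A D x).exists_min_image (fun x => (N x).card) ⟨x₀, Finset.mem_filter.2 ⟨hx₀, hx₀'⟩⟩
  obtain ⟨hxS, abx, cdx, adx⟩ := Finset.mem_filter.1 hx
  obtain ⟨acx, bdx, bcx⟩ := hconv x abx cdx adx
  refine ⟨x, hA, hB, hC, hD, hxS, abc, abd, abx, acd, acx, adx, bcd, bcx, bdx, cdx,
    fun z hz h1 h2 h3 h4 h5 => ?_⟩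
  have nA := ne_of_orient_pos h1
  have nD := ne_of_orient_pos h3
  have nAD := ne_of_orient_pos adx
  rcases (hgp D hD A hA z hz nAD.1.symm nD.2.2 nA.2.1).lt_or_gt with h | h
  swap
  · exact hemp z hz h1 h2 h3 h
  have adz : 0 < orient A D z := by rw [orient_swap]; linarith
  obtain ⟨acz, bdz, bcz⟩ := hconv z h1 h3 adz
  have hsub : N z ⊆ N x := by
    intro y hy
    obtain ⟨hy, y1, y2, y3, y4, y5⟩ := Finset.mem_filter.1 hy
    refine Finset.mem_filter.2 ⟨hy, y1, y2, y3, ?_, ?_⟩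
    · exact orient_pos_of_pentagon abc acd adz y1 y2 y3 y4 y5 (by rw [← orient_rot]; exact adx)
        (by rw [← orient_rot]; exact bdx.le) (by rw [← orient_rot]; exact cdx.le) (by simp) h4.le
    · exact orient_pos_of_pentagon bcd bdz (by rw [← orient_rot]; exact h1) y2 y3 y4 y5 y1
        (by rw [orient_rot]; exact abx) (by rw [orient_rot]; exact acx.le)
        (by rw [orient_rot]; exact adx.le) h5.le (by simp)
  have hzx : z ∈ N x := Finset.mem_filter.2 ⟨hz, h1, h2, h3, h4, h5⟩
  have hzz : z ∉ N z := fun h => by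
    have := (Finset.mem_filter.1 h).2.2.2.2.2
    simp at this
  have := Finset.card_lt_card (Finset.ssubset_iff_subset_ne.2 ⟨hsub, fun h => hzz (h ▸ hzx)⟩)
  exact absurd (hmin z (Finset.mem_filter.2 ⟨hz, h1, h3, adz⟩)) (by omega)

/-- The point `q` lies in the angle `u w v`, beyond the line `u v`. -/
structure Beyond (w u v q : Plane) : Prop where
  wuv : 0 < orient w u v
  wuq : 0 < orient w u q
  wqv : 0 < orient w q v
  uqv : 0 < orient u q v

/-- No point of `S` lies in the interior of the triangle `a b c`. -/
def TriEmpty (S : Finset Plane) (a b c : Plane) : Prop :=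
  ∀ z ∈ S, 0 < orient a b z → 0 < orient b c z → 0 < orient c a z → False

/-- No point of `S` lies in the interior of the convex quadrilateral `a b c d`. -/
def QuadEmpty (S : Finset Plane) (a b c d : Plane) : Prop :=
  ∀ z ∈ S, 0 < orient a b z → 0 < orient b c z → 0 < orient c d z → 0 < orient d a z → False

open Classical in
/-- The points `q` of `S` such that `w u q v` is an empty convex quadrilateral. -/
noncomputable def fourth (S : Finset Plane) (w u v : Plane) : Finset Plane :=
  S.filter fun q => Beyond w u v q ∧ QuadEmpty S w u q v

theorem mem_fourth {S : Finset Plane} {w u v q : Plane} :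
    q ∈ fourth S w u v ↔ q ∈ S ∧ Beyond w u v q ∧ QuadEmpty S w u q v := by
  simp only [fourth, Finset.mem_filter]

/-- If there are two fourth points, then each of them is in a common 5-hole with `w`, `u`, `v`. -/
theorem exists_hole_of_fourth {S : Finset Plane} (hgp : GenPos S) {w u v q q' : Plane} (hw : w ∈ S)
    (hu : u ∈ S) (hv : v ∈ S) (hq : q ∈ fourth S w u v) (hq' : q' ∈ fourth S w u v)
    (hne : q ≠ q') : ∃ H ∈ holes 5 S, w ∈ H ∧ u ∈ H ∧ v ∈ H ∧ q ∈ H := by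
  classical
  obtain ⟨hqS, hb, he⟩ := mem_fourth.1 hq
  obtain ⟨hqS', hb', he'⟩ := mem_fourth.1 hq'
  have n1 := ne_of_orient_pos hb.uqv
  have n2 := ne_of_orient_pos hb'.uqv
  have e1 := orient_swap' u q q'
  have e2 := orient_swap q v q'
  have e3 : orient q' v q = orient v q q' := orient_rot _ _ _
  have vwq : 0 < orient v w q := by rw [orient_rot]; exact hb.wqv
  have vwq' : 0 < orient v w q' := by rw [orient_rot]; exact hb'.wqv
  have hcase1 : orient u q q' < 0 → 0 < orient q v q' →
      ∃ H ∈ holes 5 S, w ∈ H ∧ u ∈ H ∧ v ∈ H ∧ q ∈ H := by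
    intro h1 h2
    obtain ⟨x, hx⟩ := exists_hole5_of_quad hgp hqS hv hw hu (by rw [← orient_rot]; exact hb.wqv)
      (by rw [← orient_rot]; exact hb.uqv) (by rw [orient_rot]; exact hb.wuq)
      (by rw [orient_rot]; exact hb.wuv) (fun z hz k1 k2 k3 k4 => he z hz k3 k4 k1 k2)
      ⟨q', hqS', h2, hb'.wuq, by rw [orient_swap]; linarith⟩
    exact ⟨_, hx.mem_holes, by simp, by simp, by simp, by simp⟩
  have hcase2 : 0 < orient u q q' → orient q v q' < 0 →
      ∃ H ∈ holes 5 S, w ∈ H ∧ u ∈ H ∧ v ∈ H ∧ q ∈ H := by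
    intro h1 h2
    obtain ⟨x, hx⟩ := exists_hole5_of_quad hgp hv hw hu hqS (by rw [orient_rot]; exact hb.wuv)
      (by rw [orient_rot]; exact hb.wqv) (by rw [orient_rot]; exact hb.uqv)
      hb.wuq (fun z hz k1 k2 k3 k4 => he z hz k2 k3 k4 k1)
      ⟨q', hqS', vwq', h1, by linarith⟩
    exact ⟨_, hx.mem_holes, by simp, by simp, by simp, by simp⟩
  -- If `q'` is beyond both or neither of the sides `u q` and `q v`, then one of the two
  -- quadrilaterals contains the other fourth point. If it is beyond exactly one, the quadrilateral
  -- of `q` extends over that side.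
  rcases (hgp u hu q hqS q' hqS' n1.1 n2.1 hne).lt_or_gt with h1 | h1 <;>
  rcases (hgp q hqS v hv q' hqS' n1.2.2 hne n2.2.2.symm).lt_or_gt with h2 | h2
  · exact (he' q hqS hb.wuq (by linarith) (by linarith) vwq).elim
  · exact hcase1 h1 h2
  · exact hcase2 h1 h2
  · exact (he q' hqS' hb'.wuq h1 h2 vwq').elim

open Classical in
/-- The points of `S` in the interior of the triangle `a b c`. -/
noncomputable def inTri (S : Finset Plane) (a b c : Plane) : Finset Plane :=
  S.filter fun z => 0 < orient a b z ∧ 0 < orient b c z ∧ 0 < orient c a z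

theorem mem_inTri {S : Finset Plane} {a b c z : Plane} :
    z ∈ inTri S a b c ↔ z ∈ S ∧ 0 < orient a b z ∧ 0 < orient b c z ∧ 0 < orient c a z := by
  simp only [inTri, Finset.mem_filter]

/-- A point in the interior of a triangle is to the left of a line if the vertices are weakly so,
and one of them strictly. -/
theorem orient_pos_of_mem_inTri {S : Finset Plane} {a b c u v z : Plane} (hz : z ∈ inTri S a b c)
    (ha : 0 ≤ orient u v a) (hb : 0 ≤ orient u v b) (hc : 0 ≤ orient u v c)
    (hpos : 0 < orient u v a ∨ 0 < orient u v b ∨ 0 < orient u v c) : 0 < orient u v z := by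
  obtain ⟨-, h1, h2, h3⟩ := mem_inTri.1 hz
  have hbary := orient_bary a b c z u v
  have hsum := orient_sum a b c z
  have e1 : orient z b c = orient b c z := orient_rot _ _ _
  have e2 : orient a z c = orient c a z := (orient_rot _ _ _).trans (orient_rot _ _ _)
  rw [e1, e2] at hbary hsum
  have r1 : ∀ y, orient u v y = orient y u v := fun y => (orient_rot _ _ _).trans (orient_rot _ _ _)
  rw [r1] at ha hb hc hpos ⊢
  rw [r1 b, r1 c] at hpos
  by_contra hcon
  have h0 : 0 < orient a b c := by linarith
  have h4 := mul_nonneg h2.le ha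
  have h5 := mul_nonneg h3.le hb
  have h6 := mul_nonneg h1.le hc
  have h7 := mul_nonneg h0.le (neg_nonneg.2 (not_lt.1 hcon))
  rcases hpos with h | h | h
  · have := mul_pos h2 h; linarith
  · have := mul_pos h3 h; linarith
  · have := mul_pos h1 h; linarith

/-- Among `r` and the suitable points in the triangle `u r v`, take `q` with the fewest points in
the triangle `u q v`. A point in the quadrilateral `w u q v` would lie in that triangle, since `w u
v` is empty, and contradict minimality. -/
theorem Beyond.exists_fourth {S : Finset Plane} (hgp : GenPos S) {w u v r : Plane}
    (hu : u ∈ S) (hv : v ∈ S) (hr : r ∈ S) (hb : Beyond w u v r) (he : TriEmpty S w u v) :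
    r ∈ fourth S w u v ∨ ∃ q ∈ fourth S w u v, q ∈ inTri S u r v := by
  classical
  obtain ⟨q, hq, hmin⟩ := (S.filter fun q => Beyond w u v q ∧ (q = r ∨ q ∈ inTri S u r v))
    |>.exists_min_image (fun q => (inTri S u q v).card)
    ⟨r, Finset.mem_filter.2 ⟨hr, hb, Or.inl rfl⟩⟩
  obtain ⟨hqS, hbq, hqr⟩ := Finset.mem_filter.1 hq
  have hfour : q ∈ fourth S w u v := by
    refine mem_fourth.2 ⟨hqS, hbq, fun z hz h1 h2 h3 h4 => ?_⟩
    have n1 := ne_of_orient_pos h1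
    have n2 := ne_of_orient_pos h3
    have n3 := ne_of_orient_pos hbq.wuv
    rcases (hgp u hu v hv z hz n3.2.2 n1.2.2 n2.2.2).lt_or_gt with h | h
    swap
    · exact he z hz h1 h h4
    have vuz : 0 < orient v u z := by rw [orient_swap]; linarith
    have hzq : z ∈ inTri S u q v := mem_inTri.2 ⟨hz, h2, h3, vuz⟩
    have hzb : Beyond w u v z := ⟨hbq.wuv, h1, by rw [← orient_rot]; exact h4, by
      rw [← orient_rot]; exact vuz⟩
    have hzr : z ∈ inTri S u r v := by
      rcases hqr with rfl | hqr
      · exact hzq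
      obtain ⟨-, q1, q2, q3⟩ := mem_inTri.1 hqr
      exact mem_inTri.2 ⟨hz,
        orient_pos_of_mem_inTri hzq (by simp) q1.le hb.uqv.le (Or.inr (Or.inl q1)),
        orient_pos_of_mem_inTri hzq (by rw [← orient_rot]; exact hb.uqv.le) q2.le (by simp)
          (Or.inr (Or.inl q2)), vuz⟩
    have hsub : inTri S u z v ⊆ inTri S u q v := by
      intro y hy
      obtain ⟨hyS, y1, y2, y3⟩ := mem_inTri.1 hy
      exact mem_inTri.2 ⟨hyS,
        orient_pos_of_mem_inTri hy (by simp) h2.le hbq.uqv.le (Or.inr (Or.inl h2)),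
        orient_pos_of_mem_inTri hy (by rw [← orient_rot]; exact hbq.uqv.le) h3.le (by simp)
          (Or.inr (Or.inl h3)), y3⟩
    have hzz : z ∉ inTri S u z v := fun h => by
      have := (mem_inTri.1 h).2.1
      simp at this
    have := Finset.card_lt_card (Finset.ssubset_iff_subset_ne.2 ⟨hsub, fun h => hzz (h ▸ hzq)⟩)
    exact absurd (hmin z (Finset.mem_filter.2 ⟨hz, hzb, Or.inr hzr⟩)) (by omega)
  rcases hqr with rfl | hqr
  · exact Or.inl hfour
  · exact Or.inr ⟨q, hfour, hqr⟩

/-- The pair `(r, w)` is supported by a triple `(w, u, v)` of `T`: the triangle is empty, `r` is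
beyond it, and the triangle `u r v` contains at most `t` points. -/
def Supported (S : Finset Plane) (T : Finset (Plane × Plane × Plane)) (t : ℕ) (r w : Plane) :
    Prop :=
  w ∈ S ∧ r ∈ S ∧ ∃ u ∈ S, ∃ v ∈ S, (w, u, v) ∈ T ∧ TriEmpty S w u v ∧ Beyond w u v r ∧
    (inTri S u r v).card ≤ t

/-- The ray `w q` splits the angle at `w`; the part that contains `r` gives the new triangle, which
is empty as part of an empty quadrilateral. The triangle at `r` shrinks and loses at least `q`. -/
theorem Beyond.descend {S : Finset Plane} (hgp : GenPos S) {w u v r q : Plane} (hw : w ∈ S)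
    (hr : r ∈ S) (hb : Beyond w u v r) (hq : q ∈ fourth S w u v)
    (hqr : q ∈ inTri S u r v) :
    (TriEmpty S w u q ∧ Beyond w u q r ∧ (inTri S u r q).card < (inTri S u r v).card) ∨
    (TriEmpty S w q v ∧ Beyond w q v r ∧ (inTri S q r v).card < (inTri S u r v).card) := by
  obtain ⟨hqS, hbq, heq⟩ := mem_fourth.1 hq
  obtain ⟨-, q1, q2, q3⟩ := mem_inTri.1 hqr
  have n1 := ne_of_orient_pos hbq.wuq
  have n2 := ne_of_orient_pos hb.wuq
  have n3 := ne_of_orient_pos q1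
  have urv := hb.uqv
  rcases (hgp w hw q hqS r hr n1.2.1 n2.2.1 n3.2.2.symm).lt_or_gt with h | h
  · left
    have wrq : 0 < orient w r q := by rw [orient_swap']; linarith
    refine ⟨fun z hz h1 h2 h3 => ?_, ⟨hbq.wuq, hb.wuq, wrq, q1⟩, ?_⟩
    · have hz' : z ∈ inTri S w u q := mem_inTri.2 ⟨hz, h1, h2, h3⟩
      refine heq z hz h1 h2 ?_ ?_
      · exact orient_pos_of_mem_inTri hz' (by rw [← orient_rot]; exact hbq.wqv.le)
          (by rw [← orient_rot]; exact hbq.uqv.le) (by simp)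
          (Or.inl (by rw [← orient_rot]; exact hbq.wqv))
      · exact orient_pos_of_mem_inTri hz' (by simp) (by rw [orient_rot]; exact hbq.wuv.le)
          (by rw [orient_rot]; exact hbq.wqv.le) (Or.inr (Or.inl (by
            rw [orient_rot]; exact hbq.wuv)))
    · refine Finset.card_lt_card (Finset.ssubset_iff_subset_ne.2 ⟨fun y hy => ?_, fun h => ?_⟩)
      · obtain ⟨hyS, y1, y2, y3⟩ := mem_inTri.1 hy
        exact mem_inTri.2 ⟨hyS, y1,
          orient_pos_of_mem_inTri hy (by rw [← orient_rot]; exact urv.le) (by simp) q2.le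
            (Or.inr (Or.inr q2)),
          orient_pos_of_mem_inTri hy (by simp) (by rw [orient_rot]; exact urv.le) q3.le
            (Or.inr (Or.inr q3))⟩
      · have := (mem_inTri.1 (h.symm ▸ hqr)).2.2.1
        simp at this
  · right
    refine ⟨fun z hz h1 h2 h3 => ?_, ⟨hbq.wqv, h, hb.wqv, by rw [orient_rot]; exact q2⟩, ?_⟩
    · have hz' : z ∈ inTri S w q v := mem_inTri.2 ⟨hz, h1, h2, h3⟩
      refine heq z hz ?_ ?_ h2 h3
      · exact orient_pos_of_mem_inTri hz' (by simp) hbq.wuq.le hbq.wuv.le (Or.inr (Or.inl hbq.wuq))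
      · exact orient_pos_of_mem_inTri hz' (by rw [← orient_rot]; exact hbq.wuq.le) (by simp)
          hbq.uqv.le (Or.inr (Or.inr hbq.uqv))
    · refine Finset.card_lt_card (Finset.ssubset_iff_subset_ne.2 ⟨fun y hy => ?_, fun h => ?_⟩)
      · obtain ⟨hyS, y1, y2, y3⟩ := mem_inTri.1 hy
        exact mem_inTri.2 ⟨hyS,
          orient_pos_of_mem_inTri hy q1.le (by simp) urv.le (Or.inl q1), y2,
          orient_pos_of_mem_inTri hy q3.le (by rw [orient_rot]; exact urv.le) (by simp)
            (Or.inl q3)⟩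
      · have := (mem_inTri.1 (h.symm ▸ hqr)).2.1
        simp at this

/-- A constant for `card_supported_le`. -/
def supportConst : ℕ → ℕ
  | 0 => 626
  | t + 1 => 626 + 128 * supportConst t

-- A fourth point that is not the only one of its triple forms with it a quadruple of vertices of
-- one 5-hole, and a hole has `5 ^ 4 = 625` such quadruples.
open Classical in
theorem sum_fourth_le {S : Finset Plane} (hgp : GenPos S) (T : Finset (Plane × Plane × Plane))
    (hT : ∀ τ ∈ T, τ.1 ∈ S ∧ τ.2.1 ∈ S ∧ τ.2.2 ∈ S) :
    ∑ τ ∈ T, (fourth S τ.1 τ.2.1 τ.2.2).card ≤ T.card + 625 * (holes 5 S).card := by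
  set F : Finset (Plane × Plane × Plane × Plane) :=
    (holes 5 S).biUnion fun H => H ×ˢ H ×ˢ H ×ˢ H with hF
  have hFc : F.card ≤ 625 * (holes 5 S).card := by
    rw [mul_comm]
    refine Finset.card_biUnion_le_card_mul _ _ _ fun H hH => ?_
    simp only [Finset.card_product, card_of_mem_holes hH]
    norm_num
  have h1 : ∑ τ ∈ T, ((fourth S τ.1 τ.2.1 τ.2.2).card - 1) ≤ F.card := by
    calc _ ≤ ∑ τ ∈ T, (F.filter fun f => (f.1, f.2.1, f.2.2.1) = τ).card := by
          refine Finset.sum_le_sum fun τ hτ => ?_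
          by_cases hc : (fourth S τ.1 τ.2.1 τ.2.2).card ≤ 1
          · have : (fourth S τ.1 τ.2.1 τ.2.2).card - 1 = 0 := by omega
            omega
          · refine (Nat.sub_le _ _).trans ?_
            refine Finset.card_le_card_of_injOn (fun q => (τ.1, τ.2.1, τ.2.2, q)) ?_ ?_
            · intro q hq
              obtain ⟨q', hq', hne⟩ := Finset.exists_mem_ne (not_le.1 hc) q
              obtain ⟨H, hH, h1, h2, h3, h4⟩ := exists_hole_of_fourth hgp (hT τ hτ).1
                (hT τ hτ).2.1 (hT τ hτ).2.2 hq hq' hne.symm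
              refine Finset.mem_filter.2 ⟨Finset.mem_biUnion.2 ⟨H, hH, ?_⟩, rfl⟩
              simp only [Finset.mem_product]
              exact ⟨h1, h2, h3, h4⟩
            · intro q _ q' _ h
              simpa using h
      _ = (T.biUnion fun τ => F.filter fun f => (f.1, f.2.1, f.2.2.1) = τ).card := by
          rw [Finset.card_biUnion]
          intro τ _ τ' _ hne
          refine Finset.disjoint_left.2 fun f hf hf' => hne ?_
          exact (Finset.mem_filter.1 hf).2.symm.trans (Finset.mem_filter.1 hf').2
      _ ≤ F.card :=
          Finset.card_le_card (Finset.biUnion_subset.2 fun τ _ => Finset.filter_subset _ _)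
  calc _ ≤ ∑ τ ∈ T, (1 + ((fourth S τ.1 τ.2.1 τ.2.2).card - 1)) :=
        Finset.sum_le_sum fun τ _ => by omega
    _ ≤ _ := by
        rw [Finset.sum_add_distrib, Finset.sum_const, smul_eq_mul, mul_one]
        omega

-- Induction on `t`. Either `r` is a fourth point of its triple, and such pairs are bounded by
-- `sum_fourth_le`, or a fourth point `q` in `u r v` replaces the triple by `(w, u, q)` or `(w, q,
-- v)` with fewer points to go. One chosen `q` per triple costs two new triples; any other `q`
-- shares a 5-hole with the chosen one's triple, so the new triples are among the `125 m` triples of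
-- hole vertices.
open Classical in
theorem card_supported_le {S : Finset Plane} (hgp : GenPos S) (t : ℕ)
    (T : Finset (Plane × Plane × Plane)) :
    ((S ×ˢ S).filter fun p => Supported S T t p.1 p.2).card ≤
      supportConst t * (T.card + (holes 5 S).card) := by
  induction t using Nat.strong_induction_on generalizing T with
  | _ t ih =>
  set T' := T.filter fun τ => τ.1 ∈ S ∧ τ.2.1 ∈ S ∧ τ.2.2 ∈ S with hT'
  have hTc : T'.card ≤ T.card := Finset.card_filter_le _ _
  set Q : Finset (Plane × Plane) :=
    T'.biUnion fun τ => (fourth S τ.1 τ.2.1 τ.2.2).image fun q => (q, τ.1) with hQ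
  have hQc : Q.card ≤ T.card + 625 * (holes 5 S).card := by
    calc Q.card ≤ ∑ τ ∈ T', ((fourth S τ.1 τ.2.1 τ.2.2).image fun q => (q, τ.1)).card :=
          Finset.card_biUnion_le
      _ ≤ ∑ τ ∈ T', (fourth S τ.1 τ.2.1 τ.2.2).card :=
          Finset.sum_le_sum fun τ _ => Finset.card_image_le
      _ ≤ T'.card + 625 * (holes 5 S).card :=
          sum_fourth_le hgp T' fun τ hτ => (Finset.mem_filter.1 hτ).2
      _ ≤ _ := by omega
  -- The default value only adds harmless triples to `T₁`.
  set pick : Plane × Plane × Plane → Plane := fun τ =>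
    if h : (fourth S τ.1 τ.2.1 τ.2.2).Nonempty then h.choose else τ.1 with hpick
  set T₁ : Finset (Plane × Plane × Plane) :=
    ((S ×ˢ S ×ˢ S).filter fun τ => InHole3 S τ.1 τ.2.1 τ.2.2) ∪
      (T.image (fun τ => (τ.1, τ.2.1, pick τ)) ∪ T.image fun τ => (τ.1, pick τ, τ.2.2)) with hT₁
  have hT₁c : T₁.card ≤ 125 * (holes 5 S).card + 2 * T.card := by
    have h1 := card_inHole3_le S
    have h2 : (T.image fun τ : Plane × Plane × Plane => (τ.1, τ.2.1, pick τ)).card ≤ T.card :=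
      Finset.card_image_le
    have h3 : (T.image fun τ : Plane × Plane × Plane => (τ.1, pick τ, τ.2.2)).card ≤ T.card :=
      Finset.card_image_le
    calc T₁.card ≤ _ := (Finset.card_union_le _ _).trans (add_le_add_right
          (Finset.card_union_le _ _) _)
      _ ≤ _ := by omega
  have hstep : ∀ r w, Supported S T t r w → (r, w) ∈ Q ∨ (0 < t ∧ Supported S T₁ (t - 1) r w) := by
    rintro r w ⟨hw, hr, u, hu, v, hv, hmem, hemp, hb, hc⟩
    have hτ' : (w, u, v) ∈ T' := Finset.mem_filter.2 ⟨hmem, hw, hu, hv⟩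
    rcases hb.exists_fourth hgp hu hv hr hemp with h | ⟨q, hq, hqr⟩
    · exact Or.inl (Finset.mem_biUnion.2 ⟨_, hτ', Finset.mem_image.2 ⟨r, h, rfl⟩⟩)
    · right
      have hqS := (mem_fourth.1 hq).1
      have hmem₁ : (w, u, q) ∈ T₁ ∧ (w, q, v) ∈ T₁ := by
        have hne : (fourth S w u v).Nonempty := ⟨q, hq⟩
        by_cases hpq : pick (w, u, v) = q
        · constructor
          · refine Finset.mem_union_right _ (Finset.mem_union_left _ (Finset.mem_image.2
              ⟨_, hmem, ?_⟩))
            simp only [hpq]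
          · refine Finset.mem_union_right _ (Finset.mem_union_right _ (Finset.mem_image.2
              ⟨_, hmem, ?_⟩))
            simp only [hpq]
        · have hpS : pick (w, u, v) ∈ fourth S w u v := by
            simp only [hpick, dif_pos hne]
            exact hne.choose_spec
          obtain ⟨H, hH, h1, h2, h3, h4⟩ := exists_hole_of_fourth hgp hw hu hv hq hpS (Ne.symm hpq)
          constructor
          · refine Finset.mem_union_left _ (Finset.mem_filter.2 ⟨?_, H, hH, h1, h2, h4⟩)
            simp only [Finset.mem_product]
            exact ⟨hw, hu, hqS⟩
          · refine Finset.mem_union_left _ (Finset.mem_filter.2 ⟨?_, H, hH, h1, h4, h3⟩)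
            simp only [Finset.mem_product]
            exact ⟨hw, hqS, hv⟩
      rcases hb.descend hgp hw hr hq hqr with ⟨h1, h2, h3⟩ | ⟨h1, h2, h3⟩
      · exact ⟨by omega, hw, hr, u, hu, q, hqS, hmem₁.1, h1, h2, by omega⟩
      · exact ⟨by omega, hw, hr, q, hqS, v, hv, hmem₁.2, h1, h2, by omega⟩
  rcases t with _ | t
  · calc _ ≤ Q.card := by
          refine Finset.card_le_card fun p hp => ?_
          rcases hstep p.1 p.2 (Finset.mem_filter.1 hp).2 with h | h
          · exact h
          · exact absurd h.1 (lt_irrefl 0)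
      _ ≤ _ := by
          simp only [supportConst]
          omega
  · have h1 := ih t (Nat.lt_succ_self t) T₁
    calc _ ≤ (Q ∪ (S ×ˢ S).filter fun p => Supported S T₁ t p.1 p.2).card := by
          refine Finset.card_le_card fun p hp => ?_
          obtain ⟨hpS, hp⟩ := Finset.mem_filter.1 hp
          rcases hstep p.1 p.2 hp with h | h
          · exact Finset.mem_union_left _ h
          · exact Finset.mem_union_right _ (Finset.mem_filter.2 ⟨hpS, h.2⟩)
      _ ≤ Q.card + supportConst t * (T₁.card + (holes 5 S).card) :=
          (Finset.card_union_le _ _).trans (add_le_add_right h1 _)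
      -- The new triples and the holes together number at most `2 |T| + 126 m`, which is below `128
      -- (|T| + m)`.
      _ ≤ (T.card + 625 * (holes 5 S).card) +
          supportConst t * (128 * (T.card + (holes 5 S).card)) :=
          add_le_add hQc (Nat.mul_le_mul_left _ (by omega))
      _ ≤ _ := by
          simp only [supportConst]
          nlinarith

/-! ### Convex polygons with few points inside -/

/-- The points `c 0, …, c (k - 1)` of `S` are the vertices of a convex polygon, in
counterclockwise order. -/
structure Cup (S : Finset Plane) (c : ℕ → Plane) (k : ℕ) : Prop where
  mem : ∀ i < k, c i ∈ S
  pos : ∀ i j l, i < j → j < l → l < k → 0 < orient (c i) (c j) (c l)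

theorem mem_inTri_or_of_quad {S : Finset Plane} (hgp : GenPos S) {p a r b z : Plane} (hr : r ∈ S)
    (ha : a ∈ S) (hz : z ∈ S) (hra : r ≠ a) (h1 : 0 < orient r p z) (h2 : 0 < orient p a z)
    (h3 : 0 < orient a b z) (h4 : 0 < orient b r z) : z ∈ inTri S r p a ∨ z ∈ inTri S r a b := by
  have n1 := ne_of_orient_pos h1
  have n2 := ne_of_orient_pos h2
  have e := orient_swap a r z
  rcases (hgp r hr a ha z hz hra n1.2.1 n2.2.2).lt_or_gt with h | h
  · exact Or.inl (mem_inTri.2 ⟨hz, h1, h2, by linarith⟩)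
  · exact Or.inr (mem_inTri.2 ⟨hz, h, h3, h4⟩)

/-- The triangle `w u v` of a point `r` beyond `u v` can be shrunk to an empty triangle with the
same property. -/
theorem Beyond.exists_triEmpty {S : Finset Plane} (hgp : GenPos S) {w u v r : Plane} (hw : w ∈ S)
    (hu : u ∈ S) (hv : v ∈ S) (hr : r ∈ S) (hb : Beyond w u v r) :
    ∃ u' v', (u' = u ∨ u' ∈ inTri S w u v) ∧ (v' = v ∨ v' ∈ inTri S w u v) ∧ Beyond w u' v' r ∧
      TriEmpty S w u' v' := by
  generalize hn : (inTri S w u v).card = n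
  induction n using Nat.strong_induction_on generalizing u v with
  | _ n ih =>
  by_cases hemp : TriEmpty S w u v
  · exact ⟨u, v, Or.inl rfl, Or.inl rfl, hb, hemp⟩
  simp only [TriEmpty, not_forall, not_false_eq_true, exists_prop, and_true] at hemp
  obtain ⟨z, hz, h1, h2, h3⟩ := hemp
  have hzt : z ∈ inTri S w u v := mem_inTri.2 ⟨hz, h1, h2, h3⟩
  have n1 := ne_of_orient_pos h1
  have n2 := ne_of_orient_pos hb.wuq
  have wzv : 0 < orient w z v := by rw [← orient_rot]; exact h3
  by_cases hzr : z = r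
  · subst hzr
    have := hb.uqv
    rw [orient_swap'] at this
    linarith
  -- The ray `w z` splits the angle `u w v`; the part that contains `r` gives a smaller triangle.
  rcases (hgp w hw z hz r hr n1.2.1 n2.2.1 hzr).lt_or_gt with h | h
  · have hb' : Beyond w u z r := ⟨h1, hb.wuq, by rw [orient_swap']; linarith,
      orient_pos_of_mem_inTri hzt (by rw [← orient_rot]; exact hb.wuq.le) (by simp) hb.uqv.le
        (Or.inr (Or.inr hb.uqv))⟩
    have hsub : inTri S w u z ⊆ inTri S w u v := by
      intro y hy
      obtain ⟨hyS, y1, y2, y3⟩ := mem_inTri.1 hy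
      refine mem_inTri.2 ⟨hyS, y1, ?_, ?_⟩
      · exact orient_pos_of_mem_inTri hy (by rw [← orient_rot]; exact hb.wuv.le) (by simp) h2.le
          (Or.inr (Or.inr h2))
      · exact orient_pos_of_mem_inTri hy (by simp) (by rw [orient_rot]; exact hb.wuv.le) h3.le
          (Or.inr (Or.inr h3))
    have hlt := Finset.card_lt_card (Finset.ssubset_iff_subset_ne.2 ⟨hsub, fun h => by
      have := (mem_inTri.1 (h.symm ▸ hzt)).2.2.1
      simp at this⟩)
    obtain ⟨u', v', g1, g2, g3, g4⟩ := ih _ (hn ▸ hlt) hu hz hb' rfl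
    exact ⟨u', v', g1.imp_right fun h => hsub h,
      Or.inr (g2.elim (fun h => h ▸ hzt) fun h => hsub h), g3, g4⟩
  · have hb' : Beyond w z v r := ⟨wzv, h, hb.wqv, by
      have := orient_pos_of_mem_inTri (u := r) (v := v) hzt
        (by rw [← orient_rot]; exact hb.wqv.le) (by rw [← orient_rot]; exact hb.uqv.le) (by simp)
        (Or.inr (Or.inl (by rw [← orient_rot]; exact hb.uqv)))
      rw [orient_rot]; exact this⟩
    have hsub : inTri S w z v ⊆ inTri S w u v := by
      intro y hy
      obtain ⟨hyS, y1, y2, y3⟩ := mem_inTri.1 hy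
      refine mem_inTri.2 ⟨hyS, ?_, ?_, y3⟩
      · exact orient_pos_of_mem_inTri hy (by simp) h1.le hb.wuv.le (Or.inr (Or.inl h1))
      · exact orient_pos_of_mem_inTri hy (by rw [← orient_rot]; exact hb.wuv.le) h2.le (by simp)
          (Or.inr (Or.inl h2))
    have hlt := Finset.card_lt_card (Finset.ssubset_iff_subset_ne.2 ⟨hsub, fun h => by
      have := (mem_inTri.1 (h.symm ▸ hzt)).2.1
      simp at this⟩)
    obtain ⟨u', v', g1, g2, g3, g4⟩ := ih _ (hn ▸ hlt) hz hv hb' rfl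
    exact ⟨u', v', Or.inr (g1.elim (fun h => h ▸ hzt) fun h => hsub h),
      g2.imp_right fun h => hsub h, g3, g4⟩

section Cup

variable {S : Finset Plane} {c : ℕ → Plane} {k : ℕ}

/-- The number of points in the two triangles from `c j` to the edges at `c (b + 1)`. -/
noncomputable def fan (S : Finset Plane) (c : ℕ → Plane) (j b : ℕ) : ℕ :=
  (inTri S (c j) (c b) (c (b + 1))).card + (inTri S (c j) (c (b + 1)) (c (b + 2))).card

theorem Cup.disjoint (h : Cup S c k) {j a b : ℕ} (hja : j < a) (hab : a < b) (hb : b + 1 < k) :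
    Disjoint (inTri S (c j) (c a) (c (a + 1))) (inTri S (c j) (c b) (c (b + 1))) := by
  refine Finset.disjoint_left.2 fun z hz hz' => ?_
  obtain ⟨-, h1, h2, h3⟩ := mem_inTri.1 hz
  obtain ⟨-, h4, h5, h6⟩ := mem_inTri.1 hz'
  have e := orient_swap (c (a + 1)) (c j) z
  rcases Nat.lt_or_ge (a + 1) b with hlt | hge
  · have := orient_trans (h.pos j a (a + 1) hja (by omega) (by omega))
      (h.pos j a b hja hab (by omega)) h1 (h.pos j (a + 1) b (by omega) hlt (by omega)) h4
    linarith
  · obtain rfl : b = a + 1 := by omega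
    linarith

theorem Cup.sum_inTri_le (h : Cup S c k) {A : Finset Plane}
    (hA : ∀ i j l, i < j → j < l → l < k → inTri S (c i) (c j) (c l) ⊆ A) {j : ℕ} (I : Finset ℕ)
    (hI : ∀ b ∈ I, j < b ∧ b + 1 < k) :
    ∑ b ∈ I, (inTri S (c j) (c b) (c (b + 1))).card ≤ A.card := by
  classical
  rw [← Finset.card_biUnion]
  · exact Finset.card_le_card (Finset.biUnion_subset.2 fun b hb =>
      hA _ _ _ (hI b hb).1 (Nat.lt_succ_self b) (hI b hb).2)
  · intro a ha b hb hab
    rcases lt_or_gt_of_ne hab with hlt | hlt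
    · exact h.disjoint (hI a ha).1 hlt (hI b hb).2
    · exact (h.disjoint (hI b hb).1 hlt (hI a ha).2).symm

/-- The triangles from `c j` to the edges are disjoint, and each occurs in at most two of the fans.
-/
theorem Cup.sum_fan_le (h : Cup S c k) {A : Finset Plane}
    (hA : ∀ i j l, i < j → j < l → l < k → inTri S (c i) (c j) (c l) ⊆ A) {j : ℕ} (I : Finset ℕ)
    (hI : ∀ b ∈ I, j < b ∧ b + 2 < k) : ∑ b ∈ I, fan S c j b ≤ 2 * A.card := by
  have h1 := h.sum_inTri_le hA I fun b hb => ⟨(hI b hb).1, by have := (hI b hb).2; omega⟩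
  have h2 := h.sum_inTri_le hA (j := j) (I.map (addRightEmbedding 1)) fun b hb => by
    obtain ⟨a, ha, rfl⟩ := Finset.mem_map.1 hb
    have := hI a ha
    simp only [addRightEmbedding_apply]
    omega
  rw [Finset.sum_map] at h2
  simp only [addRightEmbedding_apply] at h2
  simp only [fan, Finset.sum_add_distrib]
  have : ∀ b, b + 1 + 1 = b + 2 := fun _ => rfl
  simp only [this] at h2
  omega

/-- Markov's inequality for `Cup.sum_fan_le`. -/
theorem Cup.card_fan_gt_le (h : Cup S c k) {A : Finset Plane}
    (hA : ∀ i j l, i < j → j < l → l < k → inTri S (c i) (c j) (c l) ⊆ A) {j : ℕ} (I : Finset ℕ)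
    (hI : ∀ b ∈ I, j < b ∧ b + 2 < k) (t : ℕ) :
    (I.filter fun b => t < fan S c j b).card * (t + 1) ≤ 2 * A.card := by
  refine le_trans ?_ (h.sum_fan_le hA (I.filter fun b => t < fan S c j b)
    fun b hb => hI b (Finset.mem_filter.1 hb).1)
  rw [← smul_eq_mul]
  exact Finset.card_nsmul_le_sum _ _ _ fun b hb => (Finset.mem_filter.1 hb).2

/-- The vertices that may be used next to `c (b + 1)`. -/
noncomputable def ear (S : Finset Plane) (c : ℕ → Plane) (b : ℕ) : Finset Plane :=
  open Classical in {c b, c (b + 2)} ∪ inTri S (c (b + 1)) (c (b + 2)) (c b)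

/-- The diagonal from `c j` to `c (b + 1)` cuts the quadrilateral into the two triangles that `fan`
counts. -/
theorem Cup.card_fan_quad (h : Cup S c k) (hgp : GenPos S) {j b : ℕ} (hj : j < b) (hb : b + 2 < k)
    (B : Finset Plane) (hB : ∀ z ∈ B, z ∈ S ∧ 0 < orient (c j) (c b) z ∧
      0 < orient (c b) (c (b + 1)) z ∧ 0 < orient (c (b + 1)) (c (b + 2)) z ∧
      0 < orient (c (b + 2)) (c j) z) : B.card ≤ fan S c j b := by
  classical
  refine le_trans (Finset.card_le_card ?_) (Finset.card_union_le _ _)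
  intro z hz
  obtain ⟨hzS, h1, h2, h3, h4⟩ := hB z hz
  exact Finset.mem_union.2 (mem_inTri_or_of_quad hgp (h.mem j (by omega))
    (h.mem (b + 1) (by omega)) hzS
    (ne_of_orient_pos (h.pos j b (b + 1) hj (by omega) (by omega))).2.1 h1 h2 h3 h4)

theorem Cup.inTri_ear_pos (h : Cup S c k) {j b : ℕ} (hj : j < b) (hb : b + 2 < k) {z : Plane}
    (hz : z ∈ inTri S (c (b + 1)) (c (b + 2)) (c b)) :
    z ∈ S ∧ 0 < orient (c j) (c b) z ∧ 0 < orient (c b) (c (b + 1)) z ∧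
      0 < orient (c (b + 1)) (c (b + 2)) z ∧ 0 < orient (c (b + 2)) (c j) z := by
  have p1 := h.pos j b (b + 1) hj (by omega) (by omega)
  have p2 := h.pos j b (b + 2) hj (by omega) (by omega)
  have p3 := h.pos j (b + 1) (b + 2) (by omega) (by omega) (by omega)
  obtain ⟨hzS, h1, h2, h3⟩ := mem_inTri.1 hz
  refine ⟨hzS, ?_, h3, h1, ?_⟩
  · exact orient_pos_of_mem_inTri hz p1.le p2.le (by simp) (Or.inl p1)
  · exact orient_pos_of_mem_inTri hz (by rw [orient_rot]; exact p3.le) (by simp)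
      (by rw [orient_rot]; exact p2.le) (Or.inl (by rw [orient_rot]; exact p3))

theorem Cup.card_ear_le (h : Cup S c k) (hgp : GenPos S) {j b : ℕ} (hj : j < b) (hb : b + 2 < k) :
    (ear S c b).card ≤ 2 + fan S c j b := by
  classical
  refine (Finset.card_union_le _ _).trans (add_le_add Finset.card_le_two ?_)
  exact h.card_fan_quad hgp hj hb _ fun z hz => h.inTri_ear_pos hj hb hz

/-- The pair of two vertices of a convex polygon with few points near the second one is
supported by triples near the second one. -/
theorem Cup.supported (h : Cup S c k) (hgp : GenPos S) {j b : ℕ} (hj : j < b) (hb : b + 2 < k)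
    {t : ℕ} (ht : fan S c j b ≤ t) {T : Finset (Plane × Plane × Plane)}
    (hT : ∀ u ∈ ear S c b, ∀ v ∈ ear S c b, (c (b + 1), u, v) ∈ T) :
    Supported S T t (c j) (c (b + 1)) := by
  classical
  have hw := h.mem (b + 1) (by omega)
  have hu := h.mem (b + 2) (by omega)
  have hv := h.mem b (by omega)
  have hr := h.mem j (by omega)
  have p1 := h.pos j b (b + 1) hj (by omega) (by omega)
  have p2 := h.pos j b (b + 2) hj (by omega) (by omega)
  have p3 := h.pos j (b + 1) (b + 2) (by omega) (by omega) (by omega)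
  have p4 := h.pos b (b + 1) (b + 2) (by omega) (by omega) (by omega)
  have hb0 : Beyond (c (b + 1)) (c (b + 2)) (c b) (c j) :=
    ⟨by rw [← orient_rot]; exact p4, by rw [← orient_rot]; exact p3,
      by rw [orient_rot]; exact p1, by rw [orient_rot]; exact p2⟩
  -- Shrinking keeps both vertices in the ear. Therefore the triangle of `u`, `c j`, `v` stays in
  -- the quadrilateral of `c j` and the three vertices around `c (b + 1)`, whose points `fan`
  -- counts.
  obtain ⟨u, v, hu', hv', hbe, hemp⟩ := hb0.exists_triEmpty hgp hw hu hv hr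
  have mem_ear : ∀ y, (y = c b ∨ y = c (b + 2) ∨ y ∈ inTri S (c (b + 1)) (c (b + 2)) (c b)) →
      y ∈ ear S c b := by
    rintro y (rfl | rfl | hy)
    · exact Finset.mem_union_left _ (by simp)
    · exact Finset.mem_union_left _ (by simp)
    · exact Finset.mem_union_right _ hy
  have nonneg : ∀ y, (y = c b ∨ y = c (b + 2) ∨ y ∈ inTri S (c (b + 1)) (c (b + 2)) (c b)) →
      y ∈ S ∧ 0 ≤ orient (c j) (c b) y ∧ 0 ≤ orient (c b) (c (b + 1)) y ∧
        0 ≤ orient (c (b + 1)) (c (b + 2)) y ∧ 0 ≤ orient (c (b + 2)) (c j) y := by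
    rintro y (rfl | rfl | hy)
    · exact ⟨hv, by simp, by simp, by rw [← orient_rot]; exact p4.le,
        by rw [orient_rot]; exact p2.le⟩
    · exact ⟨hu, p2.le, p4.le, by simp, by simp⟩
    · obtain ⟨g1, g2, g3, g4, g5⟩ := h.inTri_ear_pos hj hb hy
      exact ⟨g1, g2.le, g3.le, g4.le, g5.le⟩
  have hu'' : u = c b ∨ u = c (b + 2) ∨ u ∈ inTri S (c (b + 1)) (c (b + 2)) (c b) := Or.inr hu'
  have hv'' : v = c b ∨ v = c (b + 2) ∨ v ∈ inTri S (c (b + 1)) (c (b + 2)) (c b) :=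
    hv'.imp_right Or.inr
  obtain ⟨uS, u1, u2, u3, u4⟩ := nonneg u hu''
  obtain ⟨vS, v1, v2, v3, v4⟩ := nonneg v hv''
  refine ⟨hw, hr, u, uS, v, vS, hT u (mem_ear u hu'') v (mem_ear v hv''), hemp, hbe,
    (h.card_fan_quad hgp hj hb _ fun z hz => ?_).trans ht⟩
  refine ⟨(mem_inTri.1 hz).1, ?_, ?_, ?_, ?_⟩
  · refine orient_pos_of_mem_inTri hz u1 (by simp) v1 (Or.inl ?_)
    rcases hu' with rfl | hu'
    · exact p2
    · exact (h.inTri_ear_pos hj hb hu').2.1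
  · exact orient_pos_of_mem_inTri hz u2 (by rw [← orient_rot]; exact p1.le) v2
      (Or.inr (Or.inl (by rw [← orient_rot]; exact p1)))
  · exact orient_pos_of_mem_inTri hz u3 (by rw [← orient_rot]; exact p3.le) v3
      (Or.inr (Or.inl (by rw [← orient_rot]; exact p3)))
  · refine orient_pos_of_mem_inTri hz u4 (by simp) v4 (Or.inr (Or.inr ?_))
    rcases hv' with rfl | hv'
    · rw [orient_rot]; exact p2
    · exact (h.inTri_ear_pos hj hb hv').2.2.2.2

open Classical in
/-- A large convex polygon with few points inside forces many 5-holes. -/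
theorem Cup.card_holes_ge {q : ℕ} (h : Cup S c (4 * q)) (hgp : GenPos S) {A : Finset Plane}
    (hA : ∀ i j l, i < j → j < l → l < 4 * q → inTri S (c i) (c j) (c l) ⊆ A) {M : ℕ}
    (hM : A.card ≤ M * q) :
    q * (2 * q - 2) ≤
      supportConst (4 * M) * (4 * q * (2 + 4 * M) ^ 2 + (holes 5 S).card) := by
  set t := 4 * M with ht
  -- All `j < q` are below these `b`, and `b + 2` is still the index of a vertex.
  set I := Finset.Ico q (4 * q - 2) with hI
  have hIc : I.card = 4 * q - 2 - q := by simp [hI]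
  set bad : ℕ → Finset ℕ := fun j => I.filter fun b => t < fan S c j b with hbad
  -- With `t = 4 M` the Markov bound `2 M q / (4 M + 1)` is at most `q / 2`.
  have hbadc : ∀ j < q, 2 * (bad j).card ≤ q := by
    intro j hj
    have h1 := h.card_fan_gt_le hA (j := j) I (fun b hb => by
      have := Finset.mem_Ico.1 hb; omega) t
    have h2 : 2 * A.card ≤ 2 * (M * q) := by omega
    have h3 : (bad j).card * (4 * M + 1) ≤ 2 * (M * q) := h1.trans h2
    by_contra hcon
    rcases Nat.eq_zero_or_pos M with rfl | hM0
    · omega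
    · nlinarith
  -- Removing `bad 0` as well bounds the size of the ear at `c (b + 1)` independently of `j`, so `T`
  -- has `O(q)` triples. Two removals of at most `q / 2` leave `2 q - 2` of the `3 q - 2` indices.
  set G : ℕ → Finset ℕ := fun j => I \ (bad j ∪ bad 0) with hG
  have hGmem : ∀ j b, b ∈ G j → q ≤ b ∧ b + 2 < 4 * q ∧ fan S c j b ≤ t ∧ fan S c 0 b ≤ t := by
    intro j b hb
    simp only [hG, hbad, Finset.mem_sdiff, Finset.mem_union, Finset.mem_filter, not_or, not_and,
      not_lt] at hb
    obtain ⟨hb, h1, h2⟩ := hb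
    have := Finset.mem_Ico.1 hb
    exact ⟨by omega, by omega, h1 hb, h2 hb⟩
  have hGc : ∀ j < q, 2 * q - 2 ≤ (G j).card := by
    intro j hj
    have h1 := hbadc j hj
    have h2 := hbadc 0 (by omega)
    have h3 := Finset.card_union_le (bad j) (bad 0)
    have h4 := Finset.le_card_sdiff (bad j ∪ bad 0) I
    simp only [hG]
    omega
  set T : Finset (Plane × Plane × Plane) := (I.filter fun b => fan S c 0 b ≤ t).biUnion fun b =>
    ((ear S c b) ×ˢ (ear S c b)).image fun p => (c (b + 1), p) with hT
  have hTc : T.card ≤ 4 * q * (2 + t) ^ 2 := by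
    calc T.card ≤ (I.filter fun b => fan S c 0 b ≤ t).card * (2 + t) ^ 2 := by
          refine Finset.card_biUnion_le_card_mul _ _ _ fun b hb => ?_
          obtain ⟨hb, hb'⟩ := Finset.mem_filter.1 hb
          have hb := Finset.mem_Ico.1 hb
          refine Finset.card_image_le.trans ?_
          rw [Finset.card_product, ← sq]
          rcases Nat.eq_zero_or_pos q with rfl | hq
          · omega
          refine Nat.pow_le_pow_left ((h.card_ear_le hgp (j := 0) ?_ ?_).trans ?_) 2 <;> omega
      _ ≤ _ := by
          refine Nat.mul_le_mul_right _ ((Finset.card_filter_le _ _).trans ?_)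
          omega
  have hinj : ∀ i j, i < j → j < 4 * q → c i ≠ c j := by
    intro i j hij hj
    by_cases hj' : j + 1 < 4 * q
    · exact (ne_of_orient_pos (h.pos i j (j + 1) hij (by omega) hj')).1
    · by_cases hij' : i + 1 < j
      · exact (ne_of_orient_pos (h.pos i (i + 1) j (by omega) hij' hj)).2.1
      · exact (ne_of_orient_pos (h.pos 0 i j (by omega) hij hj)).2.2
  have hinj' : ∀ i j, i < 4 * q → j < 4 * q → c i = c j → i = j := by
    intro i j hi hj hij
    rcases lt_trichotomy i j with h1 | h1 | h1
    · exact (hinj i j h1 hj hij).elim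
    · exact h1
    · exact (hinj j i h1 hi hij.symm).elim
  calc q * (2 * q - 2) ≤ ∑ j ∈ Finset.range q, (G j).card := by
        have := Finset.card_nsmul_le_sum (Finset.range q) (fun j => (G j).card) (2 * q - 2)
          fun j hj => hGc j (Finset.mem_range.1 hj)
        simpa using this
    _ = ((Finset.range q).sigma G).card := (Finset.card_sigma _ _).symm
    _ ≤ ((S ×ˢ S).filter fun p => Supported S T t p.1 p.2).card := by
        refine Finset.card_le_card_of_injOn (fun x => (c x.1, c (x.2 + 1))) ?_ ?_
        · rintro ⟨j, b⟩ hx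
          obtain ⟨hj, hb⟩ := Finset.mem_sigma.1 hx
          have hj := Finset.mem_range.1 hj
          simp only at hj hb
          obtain ⟨b1, b2, b3, b4⟩ := hGmem j b hb
          have hjb : j < b := by omega
          refine Finset.mem_filter.2 ⟨Finset.mem_product.2 ⟨h.mem _ ?_, h.mem _ ?_⟩,
            h.supported hgp hjb b2 b3 fun u hu v hv => ?_⟩
          · simp only; omega
          · simp only; omega
          · refine Finset.mem_biUnion.2 ⟨b, Finset.mem_filter.2 ⟨Finset.mem_Ico.2 ?_, b4⟩,
              Finset.mem_image.2 ⟨(u, v), Finset.mem_product.2 ⟨hu, hv⟩, rfl⟩⟩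
            omega
        · rintro ⟨j, b⟩ hx ⟨j', b'⟩ hx' heq
          obtain ⟨hj, hb⟩ := Finset.mem_sigma.1 hx
          obtain ⟨hj', hb'⟩ := Finset.mem_sigma.1 hx'
          simp only [Finset.mem_range] at hj hb hj' hb'
          obtain ⟨h1, h2⟩ := Prod.mk.inj heq
          have b1 := hGmem j b hb
          have b2 := hGmem j' b' hb'
          have e1 := hinj' _ _ (by simp only; omega) (by simp only; omega) h1
          have e2 := hinj' _ _ (by simp only; omega) (by simp only; omega) h2
          simp only at e1 e2
          obtain rfl := e1
          obtain rfl : b = b' := by omega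
          rfl
    _ ≤ _ := card_supported_le hgp t T
    _ ≤ _ := Nat.mul_le_mul_left _ (by omega)

end Cup

/-! ### Keys: a classification of points relative to `a` -/

/-- The points `x` in a common 5-hole with `a`, on the side `s` of the line through `a` in the
direction `d`, such that `a x c` is counterclockwise. -/
structure Low (S : Finset Plane) (d : Plane) (s : ℝ) (a c x : Plane) : Prop where
  hole : InHole S a x
  side : 0 < s * orient a (a + d) x
  pos : 0 < orient a x c

/-- Among the points `Low` for `c`, the point `b` is the first one seen from `c`, and the edge from
`b` of the convex hull of the later ones goes to `e`; `e = b` if there are no later ones. -/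
structure Key (S : Finset Plane) (d : Plane) (s : ℝ) (a b e c : Plane) : Prop where
  side : 0 < orient a (a + d) c
  low : Low S d s a c b
  first : ∀ x, Low S d s a c x → x ≠ b → 0 < orient b x c
  next : e = b ∨ Low S d s a c e ∧ 0 < s * orient a b e
  last : ∀ x, Low S d s a c x → 0 < s * orient a b x → x ≠ e → s * orient b e x < 0

section Key

variable {S : Finset Plane} {d : Plane} {s : ℝ} {a b b' e e' c z : Plane}

/-- Seen from `a`, turning from `y` towards the direction `d` on the side `s` preserves the
condition on `c`. -/
theorem Low.of_lt {x y : Plane} (hc : 0 < orient a (a + d) c)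
    (hy : Low S d s a c y) (hx : InHole S a x) (hxs : 0 < s * orient a (a + d) x)
    (hxy : 0 < s * orient a x y) : Low S d s a c x := by
  refine ⟨hx, hxs, ?_⟩
  have h := orient_gp a (a + d) x y c
  have h1 := mul_pos hxs hy.pos
  have h2 := mul_pos hc hxy
  have h3 : 0 < (s * orient a (a + d) y) * orient a x c := by
    have : s * (orient a (a + d) x * orient a y c - orient a (a + d) y * orient a x c +
      orient a (a + d) c * orient a x y) = 0 := by rw [h, mul_zero]
    nlinarith
  exact (pos_iff_pos_of_mul_pos h3).1 hy.side

theorem sign_cases (hs : s = 1 ∨ s = -1) {y : ℝ} (hy : y ≠ 0) : s * y < 0 ∨ 0 < s * y := by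
  have : s ≠ 0 := by rcases hs with rfl | rfl <;> norm_num
  exact (mul_ne_zero this hy).lt_or_gt

/-- That `b` is first is the corresponding property of the viewer; `e` is the last of the later
points in the angular order about `b`. -/
theorem Viewer.exists_key (hgp : GenPos S) (hs : s = 1 ∨ s = -1) (h : Viewer S c a b)
    (hc : 0 < orient a (a + d) c) (hb : 0 < s * orient a (a + d) b) :
    ∃ e ∈ S, Key S d s a b e c := by
  classical
  have hbS := h.hole.mem_right
  have nb := ne_of_orient_pos h.pos
  have hlow : Low S d s a c b := ⟨h.hole, hb, by rw [← orient_rot]; exact h.pos⟩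
  have hfirst : ∀ x, Low S d s a c x → x ≠ b → 0 < orient b x c := by
    intro x hx hxb
    have nx := ne_of_orient_pos hx.pos
    rcases (hgp b hbS x hx.hole.mem_right c h.mr hxb.symm nb.2.1.symm nx.2.2).lt_or_gt with h1 | h1
    · exact (h.first x hx.hole.mem_right hx.hole (by rw [orient_rot]; exact hx.pos)
        (by rw [orient_rev]; linarith)).elim
    · exact h1
  set X := S.filter fun x => Low S d s a c x ∧ 0 < s * orient a b x with hX
  have hXmem : ∀ x, x ∈ X ↔ Low S d s a c x ∧ 0 < s * orient a b x := fun x => by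
    rw [hX, Finset.mem_filter]
    exact ⟨fun h => h.2, fun h => ⟨h.1.hole.mem_right, h⟩⟩
  rcases X.eq_empty_or_nonempty with hE | hne
  · refine ⟨b, hbS, hc, hlow, hfirst, Or.inl rfl, fun x hx hx' _ => ?_⟩
    have : x ∈ X := (hXmem x).2 ⟨hx, hx'⟩
    rw [hE] at this
    exact absurd this (Finset.notMem_empty x)
  · obtain ⟨x, hxX, hx, hxs⟩ := X.exists_enum (fun x y => 0 < s * orient b x y) (by simp)
      (fun x hx y hy hxy => by
        have h1 := (hXmem x).1 hx
        have h2 := (hXmem y).1 hy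
        have n1 : b ≠ x := by rintro rfl; simpa using h1.2
        have n2 : b ≠ y := by rintro rfl; simpa using h2.2
        have e := orient_swap' b x y
        rcases sign_cases hs (hgp b hbS x h1.1.hole.mem_right y h2.1.hole.mem_right n1 n2 hxy) with
          h3 | h3
        · right; rw [e] at h3; linarith
        · exact Or.inl h3)
      (fun x hx y hy w hw hxy hyw => by
        have h1 := ((hXmem x).1 hx).2
        have h2 := ((hXmem y).1 hy).2
        have h3 := ((hXmem w).1 hw).2
        have e1 : orient b x a = orient a b x := (orient_rot _ _ _).symm
        have e2 : orient b y a = orient a b y := (orient_rot _ _ _).symm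
        have e3 : orient b w a = orient a b w := (orient_rot _ _ _).symm
        rcases hs with rfl | rfl
        · rw [one_mul] at *
          exact orient_trans' (w := a) (by linarith) (by linarith) (by linarith) hxy hyw
        · have f1 := orient_swap' b x a
          have f2 := orient_swap' b y a
          have f3 := orient_swap' b w a
          have g1 := orient_swap' b x y
          have g2 := orient_swap' b y w
          have g3 := orient_swap' b x w
          have := orient_trans (p := b) (w := a) (a := w) (b := y) (c := x) (by linarith)
            (by linarith) (by linarith) (by linarith) (by linarith)
          linarith)
    have hcard : X.card - 1 < X.card := Nat.sub_lt (Finset.card_pos.2 hne) one_pos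
    have hm := (hXmem _).1 (hxX _ hcard)
    refine ⟨x (X.card - 1), hm.1.hole.mem_right, hc, hlow, hfirst, Or.inr hm,
      fun y hy hy' hne' => ?_⟩
    obtain ⟨i, hi, rfl⟩ := hxs y ((hXmem y).2 ⟨hy, hy'⟩)
    have hi' : i < X.card - 1 := by
      refine lt_of_le_of_ne (by omega) ?_
      rintro rfl
      exact hne' rfl
    have h1 := hx i _ hi' hcard
    rw [orient_swap'] at h1
    linarith

theorem Key.ne_next (h : Key S d s a b e c) {x : Plane} (hx : Low S d s a c x)
    (hx' : 0 < s * orient a b x) : e ≠ b := by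
  rintro rfl
  by_cases hxe : x = e
  · subst hxe; simp at hx'
  · simpa using h.last x hx hx' hxe

theorem Key.eq (h : Key S d s a b e c) (h' : Key S d s a b' e' c) : b = b' ∧ e = e' := by
  obtain rfl : b = b' := by
    by_contra hne
    have h1 := h.first b' h'.low (Ne.symm hne)
    have h2 := h'.first b h.low hne
    rw [orient_swap] at h2
    linarith
  refine ⟨rfl, ?_⟩
  by_contra hne
  rcases h.next with rfl | h1
  · rcases h'.next with rfl | h2
    · exact hne rfl
    · exact h.ne_next h2.1 h2.2 rfl
  · rcases h'.next with rfl | h2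
    · exact h'.ne_next h1.1 h1.2 rfl
    · have k1 := h.last e' h2.1 h2.2 (Ne.symm hne)
      have k2 := h'.last e h1.1 h1.2 hne
      rw [orient_swap'] at k2
      linarith

/-- Otherwise `b'`, which precedes `e`, is low for `c`, and `b` is low for `z`. Then `last` fixes
the side of `b e` on which `b'` lies, `first` puts `b` and `e` on the same side of the line `b' z`,
and the Grassmann–Plücker relation at `b'` fails. -/
theorem Key.not_lt (h : Key S d s a b e c) (h' : Key S d s a b' e z)
    (hb : e ≠ b) (hb' : e ≠ b') : ¬ 0 < s * orient a b b' := by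
  intro hlt
  obtain ⟨he, he'⟩ := h.next.resolve_left hb
  obtain ⟨hf, hf'⟩ := h'.next.resolve_left hb'
  have l1 : Low S d s a c b' := he.of_lt h.side h'.low.hole h'.low.side hf'
  have l2 : Low S d s a z b := h'.low.of_lt h'.side h.low.hole h.low.side hlt
  have k1 := h.last b' l1 hlt hb'.symm
  have hne : b ≠ b' := by rintro rfl; simp at hlt
  have k2 := h'.first b l2 hne
  have k3 := h'.first e hf hb'
  have g := orient_gp b' a e b z
  have e1 : orient b' a b = orient a b b' := orient_rot _ _ _
  have e2 : orient b' a e = -orient a b' e := orient_swap _ _ _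
  have e3 : orient b' a z = -orient a b' z := orient_swap _ _ _
  have e4 : orient b' e b = -orient b e b' := orient_rev _ _ _
  rw [e1, e2, e3, e4] at g
  have m1 := mul_pos hf' k2
  have m2 := mul_pos hlt k3
  have m3 := mul_pos h'.low.pos (neg_pos.2 k1)
  have : s * (-orient a b' e * orient b' b z - orient a b b' * orient b' e z +
    -orient a b' z * -orient b e b') = 0 := by rw [g, mul_zero]
  nlinarith

theorem Key.first_eq (hgp : GenPos S) (ha : a ∈ S) (hs : s = 1 ∨ s = -1) (h : Key S d s a b e c)
    (h' : Key S d s a b' e z) (hb : e ≠ b) (hb' : e ≠ b') : b = b' := by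
  by_contra hne
  have n1 := ne_of_orient_pos h.low.pos
  have n2 := ne_of_orient_pos h'.low.pos
  rcases sign_cases hs (hgp a ha b h.low.hole.mem_right b' h'.low.hole.mem_right n1.1 n2.1 hne) with
    h1 | h1
  · refine h'.not_lt h hb' hb ?_
    rw [orient_swap']
    linarith
  · exact h.not_lt h' hb hb' h1

theorem Low.exists_of_mem_inTri {x c₀ c₁ c₂ : Plane} (h : Low S d s a z x)
    (hz : z ∈ inTri S c₀ c₁ c₂) : Low S d s a c₀ x ∨ Low S d s a c₁ x ∨ Low S d s a c₂ x := by
  by_contra hcon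
  simp only [not_or] at hcon
  have key : ∀ y, ¬ Low S d s a y x → 0 ≤ orient x a y := fun y hy => by
    rw [orient_swap]
    have : ¬ 0 < orient a x y := fun h' => hy ⟨h.hole, h.side, h'⟩
    linarith
  obtain ⟨-, h1, h2, h3⟩ := mem_inTri.1 hz
  have h2' : 0 < orient z c₁ c₂ := by rw [orient_rot]; exact h2
  have h3' : 0 < orient c₀ z c₂ := by rw [← orient_rot]; exact h3
  have := orient_nonneg_of_triangle (by linarith [orient_sum c₀ c₁ c₂ z]) h2'.le h3'.le h1.le
    (key _ hcon.1) (key _ hcon.2.1) (key _ hcon.2.2)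
  rw [orient_swap] at this
  linarith [h.pos]

/-- The points with a given key form a convex set. -/
theorem Key.of_mem_inTri (hgp : GenPos S) (ha : a ∈ S) (hs : s = 1 ∨ s = -1) {c₀ c₁ c₂ : Plane}
    (k₀ : Key S d s a b e c₀) (k₁ : Key S d s a b e c₁) (k₂ : Key S d s a b e c₂)
    (hz : z ∈ inTri S c₀ c₁ c₂) : Key S d s a b e z := by
  have pos : ∀ u v : Plane, 0 < orient u v c₀ → 0 < orient u v c₁ → 0 < orient u v c₂ →
      0 < orient u v z := fun u v h0 h1 h2 =>
    orient_pos_of_mem_inTri hz h0.le h1.le h2.le (Or.inl h0)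
  have abz := pos a b k₀.low.pos k₁.low.pos k₂.low.pos
  have hlast : ∀ x, Low S d s a z x → 0 < s * orient a b x → x ≠ e → s * orient b e x < 0 := by
    intro x hx hx' hxe
    rcases hx.exists_of_mem_inTri hz with h | h | h
    · exact k₀.last x h hx' hxe
    · exact k₁.last x h hx' hxe
    · exact k₂.last x h hx' hxe
  have hnext : e = b ∨ Low S d s a z e ∧ 0 < s * orient a b e := by
    by_cases heb : e = b
    · exact Or.inl heb
    obtain ⟨h0, h0'⟩ := k₀.next.resolve_left heb
    exact Or.inr ⟨⟨h0.hole, h0.side, pos a e h0.pos (k₁.next.resolve_left heb).1.pos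
      (k₂.next.resolve_left heb).1.pos⟩, h0'⟩
  refine ⟨pos _ _ k₀.side k₁.side k₂.side, ⟨k₀.low.hole, k₀.low.side, abz⟩, fun x hx hxb => ?_,
    hnext, hlast⟩
  have n1 := ne_of_orient_pos abz
  have n2 := ne_of_orient_pos hx.pos
  -- A point before `b` is low for all three vertices, so their inequalities carry over to `z`. A
  -- point after `b` is handled through `e`: it lies on the known side of `b e`, and `orient b e` is
  -- positive at all three vertices.
  rcases sign_cases hs (hgp a ha b k₀.low.hole.mem_right x hx.hole.mem_right n1.1 n2.1 hxb.symm)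
    with h1 | h1
  · have hxb' : 0 < s * orient a x b := by rw [orient_swap']; linarith
    exact pos _ _ (k₀.first x (k₀.low.of_lt k₀.side hx.hole hx.side hxb') hxb)
      (k₁.first x (k₁.low.of_lt k₁.side hx.hole hx.side hxb') hxb)
      (k₂.first x (k₂.low.of_lt k₂.side hx.hole hx.side hxb') hxb)
  · have heb : e ≠ b := by
      rcases hx.exists_of_mem_inTri hz with h | h | h
      · exact k₀.ne_next h h1
      · exact k₁.ne_next h h1
      · exact k₂.ne_next h h1
    obtain ⟨-, hbe⟩ := k₀.next.resolve_left heb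
    have bez : 0 < orient b e z := pos b e (k₀.first e (k₀.next.resolve_left heb).1 heb)
      (k₁.first e (k₁.next.resolve_left heb).1 heb) (k₂.first e (k₂.next.resolve_left heb).1 heb)
    by_cases hxe : x = e
    · rw [hxe]; exact bez
    have h2 := hlast x hx h1 hxe
    have g := orient_gp b a e x z
    rw [orient_swap b a e, orient_swap b a x, orient_swap b a z] at g
    have m1 := mul_pos h1 bez
    have m2 := mul_pos abz (neg_pos.2 h2)
    have h3 : 0 < (s * orient a b e) * orient b x z := by
      have : s * (-orient a b e * orient b x z - -orient a b x * orient b e z +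
        -orient a b z * orient b e x) = 0 := by rw [g, mul_zero]
      nlinarith
    exact (pos_iff_pos_of_mul_pos h3).1 hbe

open Classical in
/-- The keys that occur. -/
noncomputable def keys (S : Finset Plane) (d : Plane) (s : ℝ) : Finset (Plane × Plane × Plane) :=
  (S ×ˢ S ×ˢ S).filter fun κ => ∃ c ∈ S, Key S d s κ.1 κ.2.1 κ.2.2 c

open Classical in
/-- The points of `S` with a given key. -/
noncomputable def keyClass (S : Finset Plane) (d : Plane) (s : ℝ) (κ : Plane × Plane × Plane) :
    Finset Plane :=
  S.filter fun c => Key S d s κ.1 κ.2.1 κ.2.2 c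

theorem mem_keyClass {κ : Plane × Plane × Plane} :
    c ∈ keyClass S d s κ ↔ c ∈ S ∧ Key S d s κ.1 κ.2.1 κ.2.2 c := by
  simp only [keyClass, Finset.mem_filter]

/-- By `Key.first_eq` a key is determined by the pair `a`, `e`, which shares a 5-hole, and by
whether `e = b`; a hole has 25 ordered pairs of vertices. -/
theorem card_keys_le (hgp : GenPos S) (hs : s = 1 ∨ s = -1) :
    (keys S d s).card ≤ 50 * (holes 5 S).card := by
  classical
  have h1 : (keys S d s).card ≤
      (((S ×ˢ S).filter fun t => InHole S t.1 t.2) ×ˢ (Finset.univ : Finset Bool)).card := by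
    refine Finset.card_le_card_of_injOn
      (fun κ => ((κ.1, κ.2.2), decide (κ.2.2 = κ.2.1))) ?_ ?_
    · rintro ⟨a, b, e⟩ hκ
      obtain ⟨hκ, c, hc, hk⟩ := Finset.mem_filter.1 hκ
      obtain ⟨haS, hκ⟩ := Finset.mem_product.1 hκ
      obtain ⟨hbS, heS⟩ := Finset.mem_product.1 hκ
      simp only at hk
      refine Finset.mem_product.2 ⟨Finset.mem_filter.2 ⟨Finset.mem_product.2 ⟨haS, heS⟩, ?_⟩,
        Finset.mem_univ _⟩
      rcases hk.next with rfl | h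
      · exact hk.low.hole
      · exact h.1.hole
    · rintro ⟨a, b, e⟩ hκ ⟨a', b', e'⟩ hκ' heq
      obtain ⟨hκ, c, hc, hk⟩ := Finset.mem_filter.1 hκ
      obtain ⟨-, c', hc', hk'⟩ := Finset.mem_filter.1 hκ'
      have haS := (Finset.mem_product.1 hκ).1
      simp only at hk hk' haS
      simp only [Prod.mk.injEq, decide_eq_decide] at heq
      obtain ⟨⟨rfl, rfl⟩, h3⟩ := heq
      by_cases heb : e = b
      · rw [← heb, ← h3.1 heb]
      · rw [hk.first_eq hgp haS hs hk' heb fun h => heb (h3.2 h)]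
  have h2 := card_inHole_le S
  rw [Finset.card_product, Finset.card_univ, Fintype.card_bool] at h1
  omega

/-- By `Key.eq` a pair of `a` and `c` occurs in only one class. -/
theorem sum_card_keyClass_le : ∑ κ ∈ keys S d s, (keyClass S d s κ).card ≤ S.card ^ 2 := by
  classical
  rw [← Finset.card_sigma, sq, ← Finset.card_product]
  refine Finset.card_le_card_of_injOn (fun x => (x.1.1, x.2)) ?_ ?_
  · rintro ⟨κ, c⟩ hx
    obtain ⟨hκ, hc⟩ := Finset.mem_sigma.1 hx
    exact Finset.mem_product.2 ⟨(Finset.mem_product.1 (Finset.mem_filter.1 hκ).1).1,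
      (mem_keyClass.1 hc).1⟩
  · rintro ⟨⟨a, b, e⟩, c⟩ hx ⟨⟨a', b', e'⟩, c'⟩ hx' heq
    have hk := (mem_keyClass.1 (Finset.mem_sigma.1 hx).2).2
    have hk' := (mem_keyClass.1 (Finset.mem_sigma.1 hx').2).2
    simp only [Prod.mk.injEq] at heq
    obtain ⟨rfl, rfl⟩ := heq
    obtain ⟨h1, h2⟩ := hk.eq hk'
    simp only at h1 h2
    rw [h1, h2]

end Key

/-! ### Pigeonhole over the keys, and the conclusion -/

open Classical in
/-- The viewers of `a b` on the side `d` of `a`, with `b` on the side `s`, that are not in a common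
5-hole with `a` and `b`. -/
noncomputable def hullViewers (S : Finset Plane) (d : Plane) (s : ℝ) :
    Finset (Plane × Plane × Plane) :=
  (viewers S).filter fun t => ¬ InHole3 S t.1 t.2.1 t.2.2 ∧
    0 < orient t.2.1 (t.2.1 + d) t.1 ∧ 0 < s * orient t.2.1 (t.2.1 + d) t.2.2

theorem mem_hullViewers {S : Finset Plane} {d : Plane} {s : ℝ} {t : Plane × Plane × Plane} :
    t ∈ hullViewers S d s ↔ Viewer S t.1 t.2.1 t.2.2 ∧ ¬ InHole3 S t.1 t.2.1 t.2.2 ∧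
      0 < orient t.2.1 (t.2.1 + d) t.1 ∧ 0 < s * orient t.2.1 (t.2.1 + d) t.2.2 := by
  simp only [hullViewers, Finset.mem_filter, mem_viewers]

open Classical in
/-- The hull viewers with a given key. -/
noncomputable def hullClass (S : Finset Plane) (d : Plane) (s : ℝ) (κ : Plane × Plane × Plane) :
    Finset Plane :=
  S.filter fun c => (c, κ.1, κ.2.1) ∈ hullViewers S d s ∧ Key S d s κ.1 κ.2.1 κ.2.2 c

theorem mem_hullClass {S : Finset Plane} {d : Plane} {s : ℝ} {κ : Plane × Plane × Plane}
    {c : Plane} : c ∈ hullClass S d s κ ↔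
      c ∈ S ∧ (c, κ.1, κ.2.1) ∈ hullViewers S d s ∧ Key S d s κ.1 κ.2.1 κ.2.2 c := by
  simp only [hullClass, Finset.mem_filter]

theorem card_hullViewers_le {S : Finset Plane} (hgp : GenPos S) (d : Plane) {s : ℝ}
    (hs : s = 1 ∨ s = -1) :
    (hullViewers S d s).card ≤ ∑ κ ∈ keys S d s, (hullClass S d s κ).card := by
  classical
  calc _ ≤ ((keys S d s).biUnion fun κ =>
        (hullClass S d s κ).image fun c => (c, κ.1, κ.2.1)).card := by
        refine Finset.card_le_card fun t ht => ?_
        obtain ⟨hv, -, h2, h3⟩ := mem_hullViewers.1 ht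
        obtain ⟨e, heS, hk⟩ := hv.exists_key hgp hs h2 h3
        refine Finset.mem_biUnion.2 ⟨(t.2.1, t.2.2, e), Finset.mem_filter.2 ⟨?_, t.1, hv.mr, hk⟩,
          Finset.mem_image.2 ⟨t.1, mem_hullClass.2 ⟨hv.mr, ht, hk⟩, rfl⟩⟩
        simp only [Finset.mem_product]
        exact ⟨hv.ma, hv.hole.mem_right, heS⟩
    _ ≤ ∑ κ ∈ keys S d s, ((hullClass S d s κ).image fun c => (c, κ.1, κ.2.1)).card :=
        Finset.card_biUnion_le
    _ ≤ _ := Finset.sum_le_sum fun κ _ => Finset.card_image_le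

/-- The hull viewers with a given key form a convex polygon that contains only points with the same
key. -/
theorem hullClass_card_holes_ge {S : Finset Plane} (hgp : GenPos S) {d : Plane} {s : ℝ}
    (hs : s = 1 ∨ s = -1) {κ : Plane × Plane × Plane} (hκ : κ ∈ keys S d s) {q M : ℕ}
    (hq : 4 * q ≤ (hullClass S d s κ).card) (hM : (keyClass S d s κ).card ≤ M * q) :
    q * (2 * q - 2) ≤
      supportConst (4 * M) * (4 * q * (2 + 4 * M) ^ 2 + (holes 5 S).card) := by
  classical
  obtain ⟨c, hc, hpos⟩ := exists_cup (C := hullClass S d s κ) hgp (a := κ.1) (b := κ.2.1)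
    fun c hc => by
      have h := mem_hullViewers.1 (mem_hullClass.1 hc).2.1
      exact ⟨h.1, h.2.1⟩
  have hcup : Cup S c (4 * q) := ⟨fun i hi => (mem_hullClass.1 (hc i (hi.trans_le hq))).1,
    fun i j l hij hjl hl => hpos i j l hij hjl (hl.trans_le hq)⟩
  have ha : κ.1 ∈ S := (Finset.mem_product.1 (Finset.mem_filter.1 hκ).1).1
  have hkey : ∀ i < 4 * q, Key S d s κ.1 κ.2.1 κ.2.2 (c i) := fun i hi =>
    (mem_hullClass.1 (hc i (hi.trans_le hq))).2.2
  exact hcup.card_holes_ge hgp (A := keyClass S d s κ) (fun i j l hij hjl hl z hz =>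
    mem_keyClass.2 ⟨(mem_inTri.1 hz).1, (hkey i (by omega)).of_mem_inTri hgp ha hs
      (hkey j (by omega)) (hkey l hl) hz⟩) hM

/-- Pigeonhole for two weights. -/
theorem Finset.exists_large_of_sum {ι : Type*} (I : Finset ι) (D F : ι → ℕ) {v N : ℕ} (hv : 0 < v)
    (hD : v ≤ ∑ i ∈ I, D i) (hF : ∑ i ∈ I, F i ≤ N) (hN : 0 < N) :
    ∃ i ∈ I, v < 4 * I.card * D i ∧ v * F i < 4 * N * D i := by
  have hI : 0 < I.card := by
    rw [Finset.card_pos]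
    by_contra h
    rw [Finset.not_nonempty_iff_eq_empty] at h
    subst h
    simp at hD
    omega
  -- The left sides sum to at most `2 v N |I|`, the right sides to at least `4 v N |I|`; at a
  -- suitable index each of the two left summands gives one bound.
  obtain ⟨i, hi, h⟩ := Finset.exists_lt_of_sum_lt (s := I)
    (f := fun i => v * N + v * I.card * F i) (g := fun i => 4 * I.card * N * D i) (by
      simp only [Finset.sum_add_distrib, ← Finset.mul_sum, Finset.sum_const, smul_eq_mul]
      have h1 : v * I.card * ∑ i ∈ I, F i ≤ v * I.card * N := Nat.mul_le_mul_left _ hF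
      have h2 : 4 * I.card * N * v ≤ 4 * I.card * N * ∑ i ∈ I, D i := Nat.mul_le_mul_left _ hD
      have h3 : 0 < I.card * N * v := by positivity
      nlinarith)
  refine ⟨i, hi, ?_, ?_⟩
  · by_contra hcon
    have := Nat.mul_le_mul_right N (not_lt.1 hcon)
    have h0 : 4 * I.card * N * D i = 4 * I.card * D i * N := by ring
    have h1 := Nat.zero_le (v * I.card * F i)
    omega
  · by_contra hcon
    have := Nat.mul_le_mul_right I.card (not_lt.1 hcon)
    have h0 : 4 * I.card * N * D i = 4 * N * D i * I.card := by ring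
    have h2 : v * I.card * F i = v * F i * I.card := by ring
    have h1 := Nat.zero_le (v * N)
    omega

/-- A set with many hull viewers has many 5-holes. -/
theorem exists_pow_le_of_hullViewers (γ : ℕ) : ∃ R : ℕ, ∀ (S : Finset Plane) (d : Plane) (s : ℝ),
    GenPos S → (s = 1 ∨ s = -1) → 0 < S.card → 0 < (holes 5 S).card →
    S.card ^ 2 ≤ γ * (hullViewers S d s).card → S.card ^ 4 ≤ R * (holes 5 S).card ^ 3 := by
  -- A class has at most `4 γ k` points and `k ≤ 7 q`, whence `28 γ`.
  set M := 28 * γ with hM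
  set Z := supportConst (4 * M) with hZ
  set W := 2 + Z * (4 * (2 + 4 * M) ^ 2) with hW
  refine ⟨(1400 * γ) ^ 2 * ((W + 1) ^ 2 + Z), fun S d s hgp hs hn hm hv => ?_⟩
  set n := S.card with hn'
  set m := (holes 5 S).card with hm'
  set v := (hullViewers S d s).card with hv'
  have hv0 : 0 < v := by
    rcases Nat.eq_zero_or_pos v with h | h
    · rw [h] at hv
      have : 0 < n ^ 2 := by positivity
      omega
    · exact h
  -- A key with more than `v / (200 m)` hull viewers whose class is only a constant factor larger.
  obtain ⟨κ, hκ, h1, h2⟩ := (keys S d s).exists_large_of_sum _ _ hv0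
    (card_hullViewers_le hgp d hs) sum_card_keyClass_le (pow_pos hn 2)
  set k := (hullClass S d s κ).card with hk
  set q := k / 4 with hq
  have hkeys := card_keys_le hgp hs (d := d)
  rw [← hm'] at hkeys
  have h3 : v < 200 * m * k := h1.trans_le (Nat.mul_le_mul_right _ (by omega))
  have hmain : n ^ 2 ≤ 1400 * γ * (m * (q + 1)) := by
    have : k ≤ 7 * (q + 1) := by omega
    calc n ^ 2 ≤ γ * (200 * m * k) := hv.trans (Nat.mul_le_mul_left _ h3.le)
      _ ≤ γ * (200 * m * (7 * (q + 1))) :=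
          Nat.mul_le_mul_left _ (Nat.mul_le_mul_left _ this)
      _ = _ := by ring
  -- Either `q` is bounded, or the polygon bound reads `2 q² ≤ W q + Z m` and its linear term is
  -- absorbed by `q²`.
  have hq2 : (q + 1) ^ 2 ≤ ((W + 1) ^ 2 + Z) * m := by
    by_cases hqW : q ≤ W
    · calc (q + 1) ^ 2 ≤ (W + 1) ^ 2 := Nat.pow_le_pow_left (by omega) 2
        _ ≤ ((W + 1) ^ 2 + Z) * 1 := by omega
        _ ≤ _ := Nat.mul_le_mul_left _ hm
    · have hFq : (keyClass S d s κ).card ≤ M * q := by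
        have hkq : k ≤ 7 * q := by omega
        have h4 : v * (keyClass S d s κ).card < v * (4 * γ * k) := by
          calc _ < 4 * n ^ 2 * k := h2
            _ ≤ 4 * (γ * v) * k := by gcongr
            _ = _ := by ring
        have h5 := Nat.lt_of_mul_lt_mul_left h4
        calc _ ≤ 4 * γ * k := h5.le
          _ ≤ 4 * γ * (7 * q) := Nat.mul_le_mul_left _ hkq
          _ = _ := by rw [hM]; ring
      have h6 := hullClass_card_holes_ge hgp hs hκ (by omega : 4 * q ≤ k) hFq
      rw [← hZ, ← hm'] at h6
      have h7 : 2 * q ^ 2 ≤ W * q + Z * m := by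
        obtain ⟨p, hp⟩ : ∃ p, q = p + 1 := ⟨q - 1, by omega⟩
        have : q * (2 * q - 2) + 2 * q = 2 * q ^ 2 := by
          have : 2 * q - 2 = 2 * p := by omega
          rw [this, hp]; ring
        have e : W * q = 2 * q + Z * (4 * (2 + 4 * M) ^ 2) * q := by rw [hW]; ring
        have e2 : Z * (4 * q * (2 + 4 * M) ^ 2 + m) = Z * (4 * (2 + 4 * M) ^ 2) * q + Z * m := by
          ring
        omega
      have h8 : (W + 1) * q ≤ q ^ 2 := by
        rw [sq]; exact Nat.mul_le_mul_right _ (by omega)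
      have h9 : (W + 1) ^ 2 * 1 ≤ (W + 1) ^ 2 * m := Nat.mul_le_mul_left _ hm
      nlinarith
  calc n ^ 4 = (n ^ 2) ^ 2 := by ring
    _ ≤ (1400 * γ * (m * (q + 1))) ^ 2 := Nat.pow_le_pow_left hmain 2
    _ = (1400 * γ) ^ 2 * m ^ 2 * (q + 1) ^ 2 := by ring
    _ ≤ (1400 * γ) ^ 2 * m ^ 2 * (((W + 1) ^ 2 + Z) * m) := Nat.mul_le_mul_left _ hq2
    _ = _ := by ring

/-- A direction that is not parallel to any line through two points of `S`. -/
theorem exists_direction (S : Finset Plane) :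
    ∃ d : Plane, ∀ a ∈ S, ∀ b ∈ S, a ≠ b → orient a (a + d) b ≠ 0 := by
  obtain ⟨t, ht⟩ := exists_separating S
  refine ⟨!₂[t, -1], fun a ha b hb hab h => hab (ht a ha b hb ?_)⟩
  simp only [orient, PiLp.add_apply, Matrix.cons_val_zero, Matrix.cons_val_one,
    Matrix.cons_val_fin_one] at h
  linarith

theorem orient_add_neg (a d b : Plane) : orient a (a + -d) b = -orient a (a + d) b := by
  simp only [orient, PiLp.add_apply, PiLp.neg_apply]
  ring

/-- A generic direction and its opposite, together with the two sides for `b`, split the viewers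
outside common 5-holes into four classes, and the largest has at least a quarter of them. -/
theorem card_viewers_le {S : Finset Plane} :
    ∃ (d : Plane) (s : ℝ), (s = 1 ∨ s = -1) ∧
      (viewers S).card ≤ 125 * (holes 5 S).card + 4 * (hullViewers S d s).card := by
  classical
  obtain ⟨d, hd⟩ := exists_direction S
  by_contra hcon
  push Not at hcon
  have h1 := hcon d 1 (Or.inl rfl)
  have h2 := hcon d (-1) (Or.inr rfl)
  have h3 := hcon (-d) 1 (Or.inl rfl)
  have h4 := hcon (-d) (-1) (Or.inr rfl)
  have h0 := card_inHole3_le S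
  have hsub : viewers S ⊆ ((S ×ˢ S ×ˢ S).filter fun t => InHole3 S t.1 t.2.1 t.2.2) ∪
      ((hullViewers S d 1 ∪ hullViewers S d (-1)) ∪
        (hullViewers S (-d) 1 ∪ hullViewers S (-d) (-1))) := by
    intro t ht
    have hv := mem_viewers.1 ht
    by_cases hi : InHole3 S t.1 t.2.1 t.2.2
    · refine Finset.mem_union_left _ (Finset.mem_filter.2 ⟨?_, hi⟩)
      simp only [Finset.mem_product]
      exact ⟨hv.mr, hv.ma, hv.hole.mem_right⟩
    refine Finset.mem_union_right _ ?_
    simp only [Finset.mem_union, mem_hullViewers, orient_add_neg]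
    have n := ne_of_orient_pos hv.pos
    rcases (hd _ hv.ma _ hv.mr n.1.symm).lt_or_gt with k1 | k1 <;>
    rcases (hd _ hv.ma _ hv.hole.mem_right n.2.2).lt_or_gt with k2 | k2
    · exact Or.inr (Or.inl ⟨hv, hi, by linarith, by linarith⟩)
    · exact Or.inr (Or.inr ⟨hv, hi, by linarith, by linarith⟩)
    · exact Or.inl (Or.inr ⟨hv, hi, by linarith, by linarith⟩)
    · exact Or.inl (Or.inl ⟨hv, hi, by linarith, by linarith⟩)
  have h5 := Finset.card_le_card hsub
  have h6 := Finset.card_union_le ((S ×ˢ S ×ˢ S).filter fun t => InHole3 S t.1 t.2.1 t.2.2)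
    ((hullViewers S d 1 ∪ hullViewers S d (-1)) ∪
        (hullViewers S (-d) 1 ∪ hullViewers S (-d) (-1)))
  have h7 := Finset.card_union_le (hullViewers S d 1 ∪ hullViewers S d (-1))
    (hullViewers S (-d) 1 ∪ hullViewers S (-d) (-1))
  have h8 := Finset.card_union_le (hullViewers S d 1) (hullViewers S d (-1))
  have h9 := Finset.card_union_le (hullViewers S (-d) 1) (hullViewers S (-d) (-1))
  omega

theorem exists_pow_card_le : ∃ R : ℕ, ∀ S : Finset Plane, GenPos S → 10 ≤ S.card →
    S.card ^ 4 ≤ R * (holes 5 S).card ^ 3 := by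
  -- The counts give `n² ≤ 40 (130 m + 4 v) = 5200 m + 160 v` for `v` hull viewers; if `n² > 10400
  -- m`, the first term is below `n² / 2`, and `n² ≤ 320 v` follows.
  obtain ⟨R, hR⟩ := exists_pow_le_of_hullViewers 320
  refine ⟨R + 10400 ^ 2 + 42 ^ 4, fun S hgp hS => ?_⟩
  have hm : 0 < (holes 5 S).card := Finset.card_pos.2 (holes_nonempty hgp hS)
  have hm3 : 1 ≤ (holes 5 S).card ^ 3 := Nat.one_le_pow _ _ hm
  set n := S.card with hn
  set m := (holes 5 S).card with hm'
  -- Above 42 the rounded quotient `(n - 2) / 20` is at least `n / 40`; below, a single 5-hole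
  -- suffices.
  by_cases hn42 : n ≤ 42
  · calc n ^ 4 ≤ 42 ^ 4 := Nat.pow_le_pow_left hn42 4
      _ ≤ (R + 10400 ^ 2 + 42 ^ 4) * 1 := by omega
      _ ≤ _ := Nat.mul_le_mul_left _ hm3
  have h1 := card_viewers_ge hgp
  obtain ⟨d, s, hs, h2⟩ := card_viewers_le (S := S)
  rw [← hn, ← hm'] at h1
  rw [← hm'] at h2
  have h3 : n ^ 2 ≤ 40 * (n * ((n - 2) / 20)) := by
    have : n ≤ 40 * ((n - 2) / 20) := by omega
    calc n ^ 2 = n * n := sq n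
      _ ≤ n * (40 * ((n - 2) / 20)) := Nat.mul_le_mul_left _ this
      _ = _ := by ring
  by_cases h4 : n ^ 2 ≤ 10400 * m
  · calc n ^ 4 = (n ^ 2) ^ 2 := by ring
      _ ≤ (10400 * m) ^ 2 := Nat.pow_le_pow_left h4 2
      _ = 10400 ^ 2 * (m ^ 2 * 1) := by ring
      _ ≤ (R + 10400 ^ 2 + 42 ^ 4) * (m ^ 2 * m) :=
          Nat.mul_le_mul (by omega) (Nat.mul_le_mul_left _ hm)
      _ = _ := by ring
  · have h5 := hR S d s hgp hs (by omega) hm (by rw [← hn]; omega)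
    exact h5.trans (Nat.mul_le_mul_right _ (by omega))

theorem theorem3p2 :
    ∃ c : ℝ, 0 < c ∧
      ∀ (n : ℕ), 10 ≤ n →
        ∀ (P : Finset Plane), P.card = n → InGeneralPosition (P : Set Plane) →
          c * (n : ℝ) ^ ((4 : ℝ) / 3) ≤ ((holes 5 P).card : ℝ) := by
  obtain ⟨R, hR⟩ := exists_pow_card_le
  have hR0 : (0 : ℝ) < R + 1 := by positivity
  refine ⟨((R + 1 : ℝ) ^ ((1 : ℝ) / 3))⁻¹, by positivity, ?_⟩
  rintro n hn P rfl hP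
  have h := hR P (genPos_of_inGeneralPosition hP) hn
  set m := (holes 5 P).card with hm
  set N := P.card with hN
  have h1 : (N : ℝ) ^ 4 ≤ (R + 1 : ℝ) * (m : ℝ) ^ 3 := by
    have h2 : (N : ℝ) ^ 4 ≤ (R : ℝ) * (m : ℝ) ^ 3 := by exact_mod_cast h
    have h3 : (0 : ℝ) ≤ (m : ℝ) ^ 3 := by positivity
    linarith
  have h2 := Real.rpow_le_rpow (by positivity) h1 (by norm_num : (0 : ℝ) ≤ 1 / 3)
  rw [Real.mul_rpow (by positivity) (by positivity), ← Real.rpow_natCast, ← Real.rpow_natCast,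
    ← Real.rpow_mul (by positivity), ← Real.rpow_mul (by positivity)] at h2
  rw [inv_mul_le_iff₀ (by positivity)]
  norm_num at h2 ⊢
  exact h2
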